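/- **Theorem (Partial decode-and-forward inner bound).** Let $\mathcal X,\mathcal X_1$ be finite alphabets, let $\mathcal H^{B_1},\mathcal H^{B}$ be finite-dimensional Hilbert spaces, and let $(x,x_1)\mapsto\rho^{B_1B}_{x,x_1}$ be a classical-quantum relay channel, i.e. an assignment of a density operator on $\mathcal H^{B_1}\otimes\mathcal H^{B}$ to every pair $(x,x_1)\in\mathcal X\times\mathcal X_1$ (source input $x$, relay input $x_1$, relay output $B_1$, destination output $B$). Then every real number $R$ with $$R\le\sup_{p(u,x,x_1)}\min\bigl\{\,I(XX_1;B)_\theta,\; I(U;B_1|X_1)_\theta+I(X;B|X_1U)_\theta\bigr\}$$ is an achievable rate. The supremum is over all finite alphabets $\mathcal U$ and all probability distributions $p$ on $\mathcal U\times\mathcal X\times\mathcal X_1$, and the information quantities (in bits) are those of the state $$\theta^{UXX_1B_1B}=\sum_{u,x,x_1}p(u,x,x_1)\,|u\rangle\langle u|\otimes|x\rangle\langle x|\otimes|x_1\rangle\langle x_1|\otimes\rho^{B_1B}_{x,x_1}.$$ Here $H$ is the von Neumann entropy, $I(A;B)=H(A)+H(B)-H(AB)$ and $I(A;B|C)=H(AC)+H(BC)-H(C)-H(ABC)$.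 *Codes.* A partial decode-and-forward code with block length $n$ for $b$ message pairs $(m_j,\ell_j)\in\mathcal M\times\mathcal L$, $0\le j<b$, uses the channel in $b+1$ blocks $0,\dots,b$ of $n$ uses. It consists of * codewords $x^n_{(j)}(m,\ell,\ell')\in\mathcal X^n$ and $x^n_{1(j)}(\ell')\in\mathcal X_1^n$ for each block $j$; in block $j$ the source sends $x^n_{(j)}(m_j,\ell_j,\ell_{j-1})$ and the relay $x^n_{1(j)}(\ell_{j-1})$, where $\ell_{-1}$ and $(m_b,\ell_b)$ are fixed dummy messages; * for each $j<b$ and each value $\ell'$ of $\ell_{j-1}$, a POVM $\{\Gamma^{(j)}_{\ell|\ell'}\}_{\ell\in\mathcal L}$ of the relay on the system $B_1^n$ of block $j$, for decoding $\ell_j$, and measurement operators $\{K^{(j)}_{m,\ell|\ell'}\}_{(m,\ell)\in\mathcal M\times\mathcal L}$, $\sum K^\dagger K=I$, of the destination on the systems $B^n$ of the two consecutive blocks $j$ and $j+1$, for decoding $(m_j,\ell_j)$, with POVM elements $\Lambda^{(j)}_{m,\ell|\ell'}=K^\dagger K$. All the messages are independent and uniformly distributed. For $j<b$ let $$\bar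 p^{R}_{e,j}=\mathbb E\,\mathrm{Tr}\bigl[(I-\Gamma^{(j)}_{\ell_j|\ell_{j-1}})\,\rho^{B^n_{1(j)}}\bigr],\qquad \bar p^{D}_{e,j}=\mathbb E\,\mathrm{Tr}\bigl[(I-\Lambda^{(j)}_{m_j,\ell_j|\ell_{j-1}})\,(\rho^{B^n_{(j)}}\otimes\rho^{B^n_{(j+1)}})\bigr],$$ where $\mathbb E$ is the average over all the messages and $\rho^{B_{1(j)}^n},\rho^{B_{(j)}^n}$ are the output states of block $j$ when the codewords above are sent. Let $\bar p_{\mathrm{tot}}$ be the average probability that some message is decoded wrongly, by the relay or by the destination, when the whole protocol is run: the relay uses its own decoded messages in place of the $\ell_{j-1}$, and the destination performs its measurements one after the other, $j=0,\dots,b-1$, on the states left by the preceding ones, each with its own decoded message in place of $\ell_{j-1}$. *Achievability.* The rate $R$ is achievable if for every $b$, all $\varepsilon,\delta>0$ and all sufficiently large $n$ there is such a code with $|\mathcal M|\,|\mathcal L|\ge2^{n(R-\delta)}$, with $\bar p^{R}_{e,j}+\bar p^{D}_{e,j}\le\varepsilon$ for all $j<b$, and with $\bar p_{\mathrm{tot}}\le\varepsilon$.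 (As $b$ is arbitrary, the loss of the factor $b/(b+1)$ in the rate per channel use is as small as desired.) -/

import Mathlib

open Matrix
open scoped ComplexOrder

noncomputable section

namespace QuantumRelay

/-- The reduced state on the subsystem indexed by `κ` of a state on a composite system indexed by
`ι`, where `f k m` is the index of the composite system made of the index `k` of the subsystem that
is kept and the index `m` of the rest, which is traced out. -/
def reduce {ι κ μ : Type*} [Fintype μ] (f : κ → μ → ι) (θ : Matrix ι ι ℂ) : Matrix κ κ ℂ :=
  Matrix.of fun k k' => ∑ m, θ (f k m) (f k' m)

/-- Von Neumann entropy in bits, `-∑ λ log₂ λ` over the eigenvalues of a Hermitian matrix. -/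
def entropy {ι : Type*} [Fintype ι] [DecidableEq ι] (θ : Matrix ι ι ℂ) : ℝ :=
  open scoped Classical in
  if h : θ.IsHermitian then ∑ i, Real.negMulLog (h.eigenvalues i) / Real.log 2 else 0

/-- Quantum mutual information `I(A;B) = H(A) + H(B) - H(AB)` of a state on `AB`. -/
def mutualInfo {A B : Type*} [Fintype A] [Fintype B] [DecidableEq A] [DecidableEq B]
    (θ : Matrix (A × B) (A × B) ℂ) : ℝ :=
  entropy (reduce (fun (a : A) (b : B) => (a, b)) θ)
    + entropy (reduce (fun (b : B) (a : A) => (a, b)) θ)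
    - entropy θ

/-- Quantum conditional mutual information `I(A;B|C) = H(AC) + H(BC) - H(C) - H(ABC)` of a state
on `ABC`. -/
def condMutualInfo {A B C : Type*} [Fintype A] [Fintype B] [Fintype C]
    [DecidableEq A] [DecidableEq B] [DecidableEq C]
    (θ : Matrix (A × B × C) (A × B × C) ℂ) : ℝ :=
  entropy (reduce (fun (k : A × C) (b : B) => (k.1, b, k.2)) θ)
    + entropy (reduce (fun (k : B × C) (a : A) => (a, k.1, k.2)) θ)
    - entropy (reduce (fun (c : C) (k : A × B) => (k.1, k.2, c)) θ)
    - entropy θ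

/-- A classical-quantum relay channel: to every pair of input symbols `(x, x₁)` of the source and of
the relay it assigns a density operator on `ℋ^{B₁} ⊗ ℋ^B`, where `ℋ^{B₁} = ℂ^{B₁}` is the system
of the relay and `ℋ^B = ℂ^B` is that of the destination. -/
structure RelayChannel (X X₁ B₁ B : Type*) [Fintype B₁] [Fintype B] where
  state : X → X₁ → Matrix (B₁ × B) (B₁ × B) ℂ
  posSemidef : ∀ x x₁, (state x x₁).PosSemidef
  trace_eq_one : ∀ x x₁, (state x x₁).trace = 1

/-- A POVM with outcomes in `κ` on the Hilbert space `ℂ^ι`. -/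
structure POVM (κ ι : Type*) [Fintype κ] [Fintype ι] [DecidableEq ι] where
  op : κ → Matrix ι ι ℂ
  posSemidef : ∀ k, (op k).PosSemidef
  sum_eq_one : ∑ k, op k = 1

/-- A quantum measurement on `ℂ^ι` given by measurement operators `K k`: outcome `k` takes the state
`σ` to `K k * σ * (K k)ᴴ`, up to normalization. -/
structure QMeasurement (κ ι : Type*) [Fintype κ] [Fintype ι] [DecidableEq ι] where
  kraus : κ → Matrix ι ι ℂ
  sum_eq_one : ∑ k, (kraus k)ᴴ * kraus k = 1

/-- The POVM element `Λ_k = (K k)ᴴ * K k` of an outcome of a measurement. -/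
def QMeasurement.effect {κ ι : Type*} [Fintype κ] [Fintype ι] [DecidableEq ι]
    (Q : QMeasurement κ ι) (k : κ) : Matrix ι ι ℂ :=
  (Q.kraus k)ᴴ * Q.kraus k

section

variable {X X₁ B₁ B : Type*} [Fintype X] [Fintype X₁] [Fintype B₁] [Fintype B]
  [DecidableEq X] [DecidableEq X₁] [DecidableEq B₁] [DecidableEq B]

/-! ### The rate expression -/

/-- The code state `θ^{U X X₁ B₁ B} = ∑ p(u,x,x₁) |u⟩⟨u| ⊗ |x⟩⟨x| ⊗ |x₁⟩⟨x₁| ⊗ ρ_{x,x₁}`. -/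
def codeState {U : Type*} [DecidableEq U] (𝒩 : RelayChannel X X₁ B₁ B) (p : U × X × X₁ → ℝ) :
    Matrix (U × X × X₁ × B₁ × B) (U × X × X₁ × B₁ × B) ℂ :=
  Matrix.of fun (u, x, x₁, s) (u', x', x₁', s') =>
    if u = u' ∧ x = x' ∧ x₁ = x₁' then (p (u, x, x₁) : ℂ) * 𝒩.state x x₁ s s' else 0

/-- `I(XX₁;B)_θ`. -/
def infoXX₁B {U : Type*} [Fintype U] [DecidableEq U] (𝒩 : RelayChannel X X₁ B₁ B)
    (p : U × X × X₁ → ℝ) : ℝ :=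
  mutualInfo (reduce (fun (k : (X × X₁) × B) (m : U × B₁) => (m.1, k.1.1, k.1.2, m.2, k.2))
    (codeState 𝒩 p))

/-- `I(U;B₁|X₁)_θ`. -/
def infoUB₁X₁ {U : Type*} [Fintype U] [DecidableEq U] (𝒩 : RelayChannel X X₁ B₁ B)
    (p : U × X × X₁ → ℝ) : ℝ :=
  condMutualInfo (reduce (fun (k : U × B₁ × X₁) (m : X × B) => (k.1, m.1, k.2.2, k.2.1, m.2))
    (codeState 𝒩 p))

/-- `I(X;B|X₁U)_θ`. -/
def infoXBX₁U {U : Type*} [Fintype U] [DecidableEq U] (𝒩 : RelayChannel X X₁ B₁ B)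
    (p : U × X × X₁ → ℝ) : ℝ :=
  condMutualInfo (reduce
    (fun (k : X × B × (X₁ × U)) (m : B₁) => (k.2.2.2, k.1, k.2.2.1, m, k.2.1))
    (codeState 𝒩 p))

/-- The optimum of `min {I(XX₁;B), I(U;B₁|X₁) + I(X;B|X₁U)}` over all probability distributions
`p(u,x,x₁)`, with an auxiliary variable `U` of any finite alphabet. It is taken in the extended
reals, where every supremum exists. -/
def pdfRate (𝒩 : RelayChannel X X₁ B₁ B) : EReal :=
  ⨆ (k : ℕ) (p : stdSimplex ℝ (Fin k × X × X₁)),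
    ((min (infoXX₁B 𝒩 p.1) (infoUB₁X₁ 𝒩 p.1 + infoXBX₁U 𝒩 p.1) : ℝ) : EReal)

/-! ### Codes -/

/-- The output `⨂ᵢ ρ_{xᵢ,x₁ᵢ}` of `n` uses of the channel, as an operator on `B₁ⁿ ⊗ Bⁿ`. -/
def RelayChannel.block (𝒩 : RelayChannel X X₁ B₁ B) {n : ℕ} (x : Fin n → X) (x₁ : Fin n → X₁) :
    Matrix ((Fin n → B₁) × (Fin n → B)) ((Fin n → B₁) × (Fin n → B)) ℂ :=
  Matrix.of fun s t => ∏ i, 𝒩.state (x i) (x₁ i) (s.1 i, s.2 i) (t.1 i, t.2 i)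

variable (X X₁ B₁ B) in
/-- A partial decode-and-forward code with block length `n`, which conveys the message pairs
`(m_j, ℓ_j)`, `j < b`, by means of the blocks `0, …, b` of `n` channel uses.

In block `j` the source sends `x^n_{(j)}(m_j, ℓ_j, ℓ_{j-1})` and the relay sends
`x^n_{1(j)}(ℓ_{j-1})`. The relay finds `ℓ_j` by a POVM on the system `B₁ⁿ` of block `j`; the
destination finds `(m_j, ℓ_j)` by a measurement of the systems `Bⁿ` of the two blocks `j` and
`j+1`. Both measurements may depend on the message `ℓ_{j-1}` decoded before. -/
structure PDFCode (n b : ℕ) where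
  /-- the number of messages `m_j` -/
  numM : ℕ+
  /-- the number of messages `ℓ_j` -/
  numL : ℕ+
  /-- `sourceWord j m ℓ ℓ'` is the codeword for `m_j = m`, `ℓ_j = ℓ`, `ℓ_{j-1} = ℓ'` -/
  sourceWord : Fin (b + 1) → Fin numM → Fin numL → Fin numL → Fin n → X
  /-- `relayWord j ℓ'` is the codeword for `ℓ_{j-1} = ℓ'` -/
  relayWord : Fin (b + 1) → Fin numL → Fin n → X₁
  /-- `relayPOVM j ℓ'` is the measurement of the relay in block `j` when `ℓ_{j-1} = ℓ'` -/
  relayPOVM : Fin b → Fin numL → POVM (Fin numL) (Fin n → B₁)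
  /-- `destMeas j ℓ'` is the measurement of the destination on the blocks `j` and `j+1` when
  `ℓ_{j-1} = ℓ'` -/
  destMeas : Fin b → Fin numL → QMeasurement (Fin numM × Fin numL) ((Fin n → B) × (Fin n → B))

namespace PDFCode

variable {n b : ℕ} (C : PDFCode X X₁ B₁ B n b)

/-- The sequences `(m_j, ℓ_j)_{j < b}` of message pairs. -/
abbrev Messages : Type := Fin b → Fin C.numM × Fin C.numL

/-- The message pair that the source encodes in each block: `(m_j, ℓ_j)` in the blocks `j < b`, and
a fixed dummy pair in block `b`. -/
def cur (w : C.Messages) : Fin (b + 1) → Fin C.numM × Fin C.numL :=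
  Fin.snoc (α := fun _ => Fin C.numM × Fin C.numL) w (⟨0, C.numM.pos⟩, ⟨0, C.numL.pos⟩)

/-- The previous message `ℓ_{j-1}` in block `j`; it is a fixed dummy message for `j = 0`. -/
def prev (w : C.Messages) : Fin (b + 1) → Fin C.numL :=
  Fin.cons (α := fun _ => Fin C.numL) ⟨0, C.numL.pos⟩ fun j => (w j).2

/-- The output state of block `j` on `B₁ⁿ ⊗ Bⁿ`. -/
def blockState (𝒩 : RelayChannel X X₁ B₁ B) (w : C.Messages) (j : Fin (b + 1)) :
    Matrix ((Fin n → B₁) × (Fin n → B)) ((Fin n → B₁) × (Fin n → B)) ℂ :=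
  𝒩.block (C.sourceWord j (C.cur w j).1 (C.cur w j).2 (C.prev w j)) (C.relayWord j (C.prev w j))

/-- The output state of block `j` at the relay, on `B₁ⁿ`. -/
def relayState (𝒩 : RelayChannel X X₁ B₁ B) (w : C.Messages) (j : Fin (b + 1)) :
    Matrix (Fin n → B₁) (Fin n → B₁) ℂ :=
  reduce (fun (k : Fin n → B₁) (m : Fin n → B) => (k, m)) (C.blockState 𝒩 w j)

/-- The output state of block `j` at the destination, on `Bⁿ`. -/
def destState (𝒩 : RelayChannel X X₁ B₁ B) (w : C.Messages) (j : Fin (b + 1)) :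
    Matrix (Fin n → B) (Fin n → B) ℂ :=
  reduce (fun (k : Fin n → B) (m : Fin n → B₁) => (m, k)) (C.blockState 𝒩 w j)

/-- The average of a quantity over uniformly distributed messages. -/
def average (f : C.Messages → ℝ) : ℝ :=
  (∑ w, f w) / Fintype.card C.Messages

/-- The average probability of error of the relay in block `j`, given `ℓ_{j-1}`. -/
def relayError (𝒩 : RelayChannel X X₁ B₁ B) (j : Fin b) : ℝ :=
  C.average fun w =>
    (((1 - (C.relayPOVM j (C.prev w j.castSucc)).op (w j).2)
      * C.relayState 𝒩 w j.castSucc).trace).re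

/-- The average probability of error of the destination in decoding `(m_j, ℓ_j)` from the blocks `j`
and `j+1`, given `ℓ_{j-1}`. -/
def destError (𝒩 : RelayChannel X X₁ B₁ B) (j : Fin b) : ℝ :=
  C.average fun w =>
    (((1 - (C.destMeas j (C.prev w j.castSucc)).effect (w j))
      * Matrix.kroneckerMap (· * ·) (C.destState 𝒩 w j.castSucc) (C.destState 𝒩 w j.succ)).trace).re

/-- The output state of all the blocks together. -/
def totalState (𝒩 : RelayChannel X X₁ B₁ B) (w : C.Messages) :
    Matrix ((Fin (b + 1) → Fin n → B₁) × (Fin (b + 1) → Fin n → B))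
      ((Fin (b + 1) → Fin n → B₁) × (Fin (b + 1) → Fin n → B)) ℂ :=
  Matrix.of fun s t => ∏ j, C.blockState 𝒩 w j (s.1 j, s.2 j) (t.1 j, t.2 j)

/-- The effect "the relay decodes every `ℓ_j` correctly": the tensor product over `j < b` of the
POVM elements of the correct outcomes, and the identity on the last block. -/
def relayTotal (w : C.Messages) :
    Matrix (Fin (b + 1) → Fin n → B₁) (Fin (b + 1) → Fin n → B₁) ℂ :=
  Matrix.of fun s t =>
    (∏ j : Fin b, (C.relayPOVM j (C.prev w j.castSucc)).op (w j).2 (s j.castSucc) (t j.castSucc))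
      * (if s (Fin.last b) = t (Fin.last b) then 1 else 0)

/-- The measurement operator of the correct outcome `(m_j, ℓ_j)` of the destination's measurement
of the blocks `j` and `j+1`, extended to all the blocks by the identity on the others. -/
def windowOp (w : C.Messages) (j : Fin b) :
    Matrix (Fin (b + 1) → Fin n → B) (Fin (b + 1) → Fin n → B) ℂ :=
  Matrix.of fun s t =>
    if ∀ i, i ≠ j.castSucc → i ≠ j.succ → s i = t i then
      (C.destMeas j (C.prev w j.castSucc)).kraus (w j)
        (s j.castSucc, s j.succ) (t j.castSucc, t j.succ)
    else 0

/-- The measurement operator of "the destination decodes every `(m_j, ℓ_j)` correctly" when it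
performs its measurements one after the other, for `j = 0, …, b-1` in this order, on the state left
by the preceding ones, each with the previously decoded message for `ℓ_{j-1}`. -/
def destTotal (w : C.Messages) :
    Matrix (Fin (b + 1) → Fin n → B) (Fin (b + 1) → Fin n → B) ℂ :=
  (List.ofFn fun j => C.windowOp w j).reverse.prod

/-- The average probability that the relay or the destination makes an error in any of the blocks
when the whole protocol is run. On the event that the relay has made no error so far, its input is
the codeword of the true message, so that the event that everything is decoded correctly has the
probability used here. -/
def totalError (𝒩 : RelayChannel X X₁ B₁ B) : ℝ :=
  1 - C.average fun w =>
    ((Matrix.kroneckerMap (· * ·) (C.relayTotal w) ((C.destTotal w)ᴴ * C.destTotal w)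
      * C.totalState 𝒩 w).trace).re

end PDFCode

/-- The rate `R` is achievable: for every number `b` of message pairs, all `ε, δ > 0` and all
sufficiently large block lengths `n` there is a partial decode-and-forward code of at least
`2^{n(R-δ)}` message pairs per block for which the errors `p̄ᴿ + p̄ᴰ` of each block are at most `ε`,
and so is the probability that anything goes wrong in the run over all the blocks. -/
def IsAchievable (𝒩 : RelayChannel X X₁ B₁ B) (R : ℝ) : Prop :=
  ∀ b : ℕ, ∀ ε > (0 : ℝ), ∀ δ > (0 : ℝ), ∃ N : ℕ, ∀ n ≥ N,
    ∃ C : PDFCode X X₁ B₁ B n b,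
      (2 : ℝ) ^ ((n : ℝ) * (R - δ)) ≤ (C.numM : ℝ) * (C.numL : ℝ) ∧
      (∀ j : Fin b, C.relayError 𝒩 j + C.destError 𝒩 j ≤ ε) ∧
      C.totalError 𝒩 ≤ ε

end

end QuantumRelay

end

/-! The rate `R - δ` lies strictly below the value of some single distribution, which factors as
p₁(x₁) p₂(u|x₁) p₃(x|x₁,u). The code is a random superposition code, with independent codebooks for
the blocks: words x₁(ℓ'), around each of them words u(ℓ,ℓ'), and around these words x(m,ℓ,ℓ'). Given
ℓ_{j-1}, the relay recovers ℓ_j by recognizing u, which is possible below I(U;B₁|X₁). The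
destination sees ℓ_j twice, through u in block j and through the relay's word x₁ in block j+1, and
recovers it from both blocks jointly below I(U;B|X₁) + I(X₁;B). It then recovers m_j from block j
below I(X;B|X₁U). By the chain rule `infoXX₁B_eq` the two destination bounds add up to I(XX₁;B). So
giving m a rate slightly below I(X;B|X₁U), and ℓ the remainder, meets all constraints exactly when
the total is below the minimum in the rate formula.

No typicality is used. The quantum Chernoff bound `exists_test` yields a projection that tells the
right state A from c times the average state B with total error at most c^s Tr A^{1-s} B^s. The
Hayashi-Nagaoka inequality `exists_povm` makes a decoder out of such projections, and averaging over
the codebook (`expect_failure_le`) bounds its error by that expression, with c the number of wrong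
messages. The expression is multiplicative over tensor products (`chernoff_piKron`), so its average
over words is an n-th power. Its derivative at s = 0 is minus a Holevo quantity, so the error tends
to 0 below that quantity (`eventually_exponent`).

A single average over the codebooks of all blocks controls the sum of all the errors over all
messages, so one deterministic code is good for everything (`exists_blocks`). The destination's
measurements overlap and are made one after the other; their effect is controlled by the quantity
`disturbance`, which is subadditive along products of contractions, at most the square root of the
failure probability for a square-root measurement operator, and at least half the failure
probability of the resulting outcome. A union bound for product effects on a possibly correlated
state (`failure_kronecker_le`) joins relay and destination. -/

noncomputable section

namespace QuantumRelay

/-! ### Functional calculus and powers through explicit diagonalization -/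

section Spectral

variable {ι κ : Type*} [Fintype ι] [DecidableEq ι] [Fintype κ] [DecidableEq κ]

/-- `U diag(d) Uᴴ`. -/
def conjDiag (U : Matrix ι ι ℂ) (d : ι → ℝ) : Matrix ι ι ℂ :=
  U * diagonal (fun i => (d i : ℂ)) * Uᴴ

theorem conjDiag_isHermitian (U : Matrix ι ι ℂ) (d : ι → ℝ) : (conjDiag U d).IsHermitian := by
  unfold conjDiag
  refine isHermitian_mul_mul_conjTranspose U ?_
  rw [isHermitian_diagonal_iff]
  intro i
  simp [IsSelfAdjoint]

theorem conjDiag_posSemidef (U : Matrix ι ι ℂ) {d : ι → ℝ} (hd : ∀ i, 0 ≤ d i) :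
    (conjDiag U d).PosSemidef := by
  unfold conjDiag
  refine PosSemidef.mul_mul_conjTranspose_same ?_ U
  rw [posSemidef_diagonal_iff]
  intro i
  exact_mod_cast hd i

theorem conjDiag_mul {U : Matrix ι ι ℂ} (hU : Uᴴ * U = 1) (d e : ι → ℝ) :
    conjDiag U d * conjDiag U e = conjDiag U (fun i => d i * e i) := by
  unfold conjDiag
  calc _ = U * diagonal (fun i => (d i : ℂ)) * (Uᴴ * U) * diagonal (fun i => (e i : ℂ)) * Uᴴ := by
        simp only [Matrix.mul_assoc]
    _ = _ := by
        rw [hU, Matrix.mul_one, Matrix.mul_assoc U, diagonal_mul_diagonal]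
        simp

theorem conjDiag_add (U : Matrix ι ι ℂ) (d e : ι → ℝ) :
    conjDiag U d + conjDiag U e = conjDiag U (fun i => d i + e i) := by
  simp [conjDiag, ← Matrix.add_mul, ← Matrix.mul_add, diagonal_add]

theorem conjDiag_sub (U : Matrix ι ι ℂ) (d e : ι → ℝ) :
    conjDiag U d - conjDiag U e = conjDiag U (fun i => d i - e i) := by
  simp [conjDiag, ← Matrix.sub_mul, ← Matrix.mul_sub, diagonal_sub]

theorem conjDiag_const {U : Matrix ι ι ℂ} (hU : Uᴴ * U = 1) (r : ℝ) :
    conjDiag U (fun _ => r) = (r : ℂ) • 1 := by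
  rw [conjDiag, ← smul_one_eq_diagonal, Matrix.mul_smul, Matrix.smul_mul, Matrix.mul_one,
    mul_eq_one_comm.mp hU]

theorem trace_conjDiag {U : Matrix ι ι ℂ} (hU : Uᴴ * U = 1) (d : ι → ℝ) :
    (conjDiag U d).trace = ((∑ i, d i : ℝ) : ℂ) := by
  rw [conjDiag, Matrix.trace_mul_cycle, hU, Matrix.one_mul, trace_diagonal]
  push_cast; rfl

theorem exists_conjDiag {A : Matrix ι ι ℂ} (hA : A.IsHermitian) :
    ∃ U : Matrix ι ι ℂ, Uᴴ * U = 1 ∧ A = conjDiag U hA.eigenvalues := by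
  refine ⟨hA.eigenvectorUnitary, ?_, ?_⟩
  · exact Unitary.coe_star_mul_self hA.eigenvectorUnitary
  · conv_lhs => rw [hA.spectral_theorem]
    rfl

/-- The functional calculus of a diagonalized matrix. -/
theorem cfc_conjDiag {U : Matrix ι ι ℂ} (hU : Uᴴ * U = 1) (d : ι → ℝ) (f : ℝ → ℝ) :
    cfc f (conjDiag U d) = conjDiag U (fun i => f (d i)) := by
  classical
  set A := conjDiag U d with hAdef
  have hA : A.IsHermitian := conjDiag_isHermitian U d
  let φ : (ι → ℝ) →ₐ[ℝ] Matrix ι ι ℂ := AlgHom.ofLinearMap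
    { toFun := conjDiag U
      map_add' := fun x y => (conjDiag_add U x y).symm
      map_smul' := fun r x => by
        simp only [conjDiag, Pi.smul_apply, smul_eq_mul, RingHom.id_apply]
        have : (diagonal fun i => ((r * x i : ℝ) : ℂ)) = r • diagonal (fun i => (x i : ℂ)) := by
          ext i j; simp [diagonal_apply]
        rw [this, Matrix.mul_smul, Matrix.smul_mul] }
    (by simpa using! conjDiag_const hU 1)
    (fun x y => (conjDiag_mul hU x y).symm)
  have hφ : ∀ x, φ x = conjDiag U x := fun _ => rfl
  -- A polynomial passes through the algebra homomorphism `φ`, so `f` is replaced by a polynomial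
  -- that interpolates it. Interpolating on `d` as well as on the eigenvalues avoids matching the
  -- two families.
  let s : Finset ℝ := Finset.univ.image d
  let t : Finset ℝ := s ∪ Finset.univ.image hA.eigenvalues
  let q := Lagrange.interpolate t id f
  have hq : ∀ x ∈ t, q.eval x = f x := fun x hx =>
    Lagrange.eval_interpolate_at_node f (Set.injOn_id _) hx
  have h1 : cfc f A = cfc q.eval A := by
    apply cfc_congr
    intro x hx
    rw [hA.spectrum_real_eq_range_eigenvalues] at hx
    obtain ⟨i, rfl⟩ := hx
    exact (hq _ (Finset.mem_union_right _ (Finset.mem_image_of_mem _ (Finset.mem_univ i)))).symm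
  rw [h1, cfc_polynomial q A hA.isSelfAdjoint, hAdef, ← hφ, Polynomial.aeval_algHom_apply, hφ]
  congr 1
  funext i
  rw [← hq (d i) (Finset.mem_union_left _ (Finset.mem_image_of_mem _ (Finset.mem_univ i)))]
  rw [Polynomial.aeval_fn_apply]; simp

theorem entropy_eq_trace_cfc {A : Matrix ι ι ℂ} (hA : A.IsHermitian) :
    entropy A = (cfc Real.negMulLog A).trace.re / Real.log 2 := by
  obtain ⟨U, hU, h⟩ := exists_conjDiag hA
  rw [entropy, dif_pos hA]
  conv_rhs => rw [h]
  rw [cfc_conjDiag hU, trace_conjDiag hU, Complex.ofReal_re, Finset.sum_div]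

theorem entropy_conjDiag {U : Matrix ι ι ℂ} (hU : Uᴴ * U = 1) (d : ι → ℝ) :
    entropy (conjDiag U d) = (∑ i, Real.negMulLog (d i)) / Real.log 2 := by
  rw [entropy_eq_trace_cfc (conjDiag_isHermitian U d), cfc_conjDiag hU, trace_conjDiag hU,
    Complex.ofReal_re]

theorem exists_conjDiag_nonneg {A : Matrix ι ι ℂ} (hA : A.PosSemidef) :
    ∃ (U : Matrix ι ι ℂ) (d : ι → ℝ), Uᴴ * U = 1 ∧ (∀ i, 0 ≤ d i) ∧ A = conjDiag U d := by
  obtain ⟨U, hU, h⟩ := exists_conjDiag hA.1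
  exact ⟨U, _, hU, hA.eigenvalues_nonneg, h⟩

/-- Real power of a positive semidefinite matrix. -/
def mpow (A : Matrix ι ι ℂ) (s : ℝ) : Matrix ι ι ℂ := cfc (fun x : ℝ => x ^ s) A

theorem mpow_conjDiag {U : Matrix ι ι ℂ} (hU : Uᴴ * U = 1) (d : ι → ℝ) (s : ℝ) :
    mpow (conjDiag U d) s = conjDiag U (fun i => d i ^ s) :=
  cfc_conjDiag hU d _

theorem mpow_posSemidef {A : Matrix ι ι ℂ} (hA : A.PosSemidef) (s : ℝ) :
    (mpow A s).PosSemidef := by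
  obtain ⟨U, d, hU, hd, rfl⟩ := exists_conjDiag_nonneg hA
  rw [mpow_conjDiag hU]
  exact conjDiag_posSemidef U fun i => Real.rpow_nonneg (hd i) s

/-- Only the eigenvalue 0 obstructs: `0 ^ 0 = 1`, whereas `0 ^ s * 0 ^ (-s) = 0` for `s ≠ 0`. -/
theorem mpow_mul {A : Matrix ι ι ℂ} (hA : A.PosSemidef) {s t : ℝ} (hst : s + t ≠ 0) :
    mpow A s * mpow A t = mpow A (s + t) := by
  obtain ⟨U, d, hU, hd, rfl⟩ := exists_conjDiag_nonneg hA
  simp only [mpow_conjDiag hU, conjDiag_mul hU]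
  congr 1; funext i
  rw [Real.rpow_add' (hd i) hst]

theorem mpow_one {A : Matrix ι ι ℂ} (hA : A.PosSemidef) : mpow A 1 = A := by
  obtain ⟨U, d, hU, hd, rfl⟩ := exists_conjDiag_nonneg hA
  simp [mpow_conjDiag hU]

theorem mpow_smul {A : Matrix ι ι ℂ} (hA : A.PosSemidef) {c : ℝ} (hc : 0 ≤ c) (s : ℝ) :
    mpow ((c : ℂ) • A) s = ((c ^ s : ℝ) : ℂ) • mpow A s := by
  obtain ⟨U, d, hU, hd, rfl⟩ := exists_conjDiag_nonneg hA
  have key : ∀ (r : ℝ) (e : ι → ℝ), (r : ℂ) • conjDiag U e = conjDiag U (fun i => r * e i) := by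
    intro r e
    rw [← conjDiag_mul hU (fun _ => r) e, conjDiag_const hU, Matrix.smul_mul, Matrix.one_mul]
  rw [key, mpow_conjDiag hU, mpow_conjDiag hU, key]
  congr 1; funext i
  rw [Real.mul_rpow hc (hd i)]

end Spectral

/-! ### Operator monotonicity of powers -/

section Order
open scoped MatrixOrder Matrix.Norms.L2Operator

variable {ι : Type*} [Fintype ι] [DecidableEq ι]

theorem mpow_eq_rpow {A : Matrix ι ι ℂ} (hA : A.PosSemidef) (s : ℝ) : mpow A s = A ^ s := by
  rw [CFC.rpow_eq_cfc_real (ha := hA.nonneg), mpow]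

/-- The Löwner-Heinz inequality, the only analytic input of the Chernoff and Hayashi-Nagaoka bounds
below. -/
theorem mpow_sub_posSemidef {A B : Matrix ι ι ℂ} (hA : A.PosSemidef) (hB : B.PosSemidef)
    (hAB : (B - A).PosSemidef) {s : ℝ} (h0 : 0 ≤ s) (h1 : s ≤ 1) :
    (mpow B s - mpow A s).PosSemidef := by
  rw [mpow_eq_rpow hA, mpow_eq_rpow hB, ← Matrix.le_iff]
  exact CFC.rpow_le_rpow ⟨h0, h1⟩ (Matrix.le_iff.mpr hAB)

end Order

/-! ### Projective tests and the quantum Chernoff bound -/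

section Tests

variable {ι : Type*} [Fintype ι] [DecidableEq ι]

theorem re_trace_mul_nonneg {A B : Matrix ι ι ℂ} (hA : A.PosSemidef) (hB : B.PosSemidef) :
    0 ≤ (A * B).trace.re := by
  obtain ⟨U, d, hU, hd, rfl⟩ := exists_conjDiag_nonneg hA
  have hX : (Uᴴ * B * U).PosSemidef := hB.conjTranspose_mul_mul_same U
  rw [conjDiag, Matrix.trace_mul_comm, ← Matrix.mul_assoc, Matrix.trace_mul_comm,
    ← Matrix.mul_assoc, ← Matrix.mul_assoc, Matrix.trace_mul_comm, Matrix.trace, Complex.re_sum]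
  refine Finset.sum_nonneg fun i _ => ?_
  rw [diag_apply, diagonal_mul, Complex.re_ofReal_mul]
  exact mul_nonneg (hd i) (Complex.nonneg_iff.mp hX.diag_nonneg).1

theorem re_trace_mul_le_left {A B C : Matrix ι ι ℂ} (h : (B - A).PosSemidef)
    (hC : C.PosSemidef) : (A * C).trace.re ≤ (B * C).trace.re := by
  have := re_trace_mul_nonneg h hC
  rw [Matrix.sub_mul, Matrix.trace_sub, Complex.sub_re] at this
  linarith

theorem re_trace_mul_le_right {A B C : Matrix ι ι ℂ} (h : (B - A).PosSemidef)
    (hC : C.PosSemidef) : (C * A).trace.re ≤ (C * B).trace.re := by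
  rw [Matrix.trace_mul_comm C, Matrix.trace_mul_comm C]
  exact re_trace_mul_le_left h hC

theorem re_trace_nonneg {A : Matrix ι ι ℂ} (hA : A.PosSemidef) : 0 ≤ A.trace.re := by
  simpa using re_trace_mul_nonneg hA PosSemidef.one

/-- An orthogonal projection. -/
structure IsProj (T : Matrix ι ι ℂ) : Prop where
  posSemidef : T.PosSemidef
  mul_self : T * T = T

theorem IsProj.one_sub {T : Matrix ι ι ℂ} (hT : IsProj T) : IsProj (1 - T) := by
  have hh : (1 - T)ᴴ = 1 - T := by
    rw [conjTranspose_sub, conjTranspose_one, hT.posSemidef.1]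
  have h2 : (1 - T) * (1 - T) = 1 - T := by
    simp [Matrix.mul_sub, Matrix.sub_mul, hT.mul_self]
  refine ⟨?_, h2⟩
  have := posSemidef_conjTranspose_mul_self (1 - T)
  rwa [hh, h2] at this

/-- A Hermitian matrix `H` has a positive part `P = T * H`, where `T` is an orthogonal
projection. -/
theorem exists_posPart {H : Matrix ι ι ℂ} (hH : H.IsHermitian) :
    ∃ T P : Matrix ι ι ℂ, IsProj T ∧ P.PosSemidef ∧ (P - H).PosSemidef ∧ T * H = P := by
  obtain ⟨U, hU, h⟩ := exists_conjDiag hH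
  set d := hH.eigenvalues
  refine ⟨conjDiag U fun i => if 0 < d i then 1 else 0, conjDiag U fun i => max (d i) 0,
    ⟨conjDiag_posSemidef U fun i => ?_, ?_⟩, conjDiag_posSemidef U fun i => le_max_right _ _, ?_, ?_⟩
  · split_ifs <;> norm_num
  · rw [conjDiag_mul hU]; congr 1; funext i; split_ifs <;> norm_num
  · rw [h, conjDiag_sub]
    exact conjDiag_posSemidef U fun i => sub_nonneg.mpr (le_max_left _ _)
  · rw [h, conjDiag_mul hU]; congr 1; funext i
    split_ifs with hi
    · rw [one_mul, max_eq_left hi.le]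
    · rw [zero_mul, max_eq_right (not_lt.mp hi)]

/-- The quantum Chernoff bound of Audenaert et al. -/
theorem exists_test {A B : Matrix ι ι ℂ} (hA : A.PosSemidef) (hB : B.PosSemidef) {s : ℝ}
    (h0 : 0 < s) (h1 : s < 1) :
    ∃ T : Matrix ι ι ℂ, IsProj T ∧
      ((1 - T) * A).trace.re + (T * B).trace.re ≤ (mpow A (1 - s) * mpow B s).trace.re := by
  -- `T` projects onto the positive part `P` of A - B. The matrix C = B + P dominates both A and B,
  -- which is what lets monotonicity be applied.
  obtain ⟨T, P, hT, hP, hPH, hTP⟩ := exists_posPart (hA.1.sub hB.1)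
  refine ⟨T, hT, ?_⟩
  have hC : (B + P).PosSemidef := hB.add hP
  have hAC : (B + P - A).PosSemidef := by convert hPH using 1; abel
  have hBC : (B + P - B).PosSemidef := by convert hP using 1; abel
  have e1 : mpow A (1 - s) * mpow A s = A := by
    rw [mpow_mul hA (by norm_num)]; simp [mpow_one hA]
  have e2 : mpow B (1 - s) * mpow B s = B := by
    rw [mpow_mul hB (by norm_num)]; simp [mpow_one hB]
  have e3 : mpow (B + P) (1 - s) * mpow (B + P) s = B + P := by
    rw [mpow_mul hC (by norm_num)]; simp [mpow_one hC]
  -- Tr A^{1-s}(A^s - B^s) ≤ Tr A^{1-s}(C^s - B^s) ≤ Tr C^{1-s}(C^s - B^s) ≤ Tr C - Tr B = Tr P. The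
  -- three inequalities are `k1`, `k2`, `k3`; since the left side is Tr A - Tr A^{1-s}B^s, this
  -- bounds Tr A - Tr P.
  have k1 := re_trace_mul_le_right (mpow_sub_posSemidef hA hC hAC h0.le h1.le)
    (mpow_posSemidef hA (1 - s))
  have k2 := re_trace_mul_le_left
    (mpow_sub_posSemidef hA hC hAC (sub_nonneg.mpr h1.le) (sub_le_self 1 h0.le))
    (mpow_sub_posSemidef hB hC hBC h0.le h1.le)
  have k3 := re_trace_mul_le_left
    (mpow_sub_posSemidef hB hC hBC (sub_nonneg.mpr h1.le) (sub_le_self 1 h0.le))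
    (mpow_posSemidef hB s)
  have k4 : ((1 - T) * A).trace.re + (T * B).trace.re = A.trace.re - P.trace.re := by
    rw [← hTP, ← Complex.sub_re, ← Complex.add_re, ← Matrix.trace_sub, ← Matrix.trace_add]
    congr 2
    noncomm_ring
  rw [k4]
  rw [Matrix.mul_sub, Matrix.mul_sub, Matrix.trace_sub, Matrix.trace_sub, Complex.sub_re,
    Complex.sub_re, e3] at k2
  rw [e1] at k1
  rw [e2] at k3
  rw [Matrix.trace_add, Complex.add_re] at k2
  linarith

end Tests

/-! ### From projections to a POVM -/

section HayashiNagaoka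
open scoped MatrixOrder Matrix.Norms.L2Operator

variable {ι : Type*} [Fintype ι] [DecidableEq ι]

/-- A square root and an inverse square root of `S + η` for a positive semidefinite `S`. -/
theorem exists_sqrt_inv {S : Matrix ι ι ℂ} (hS : S.PosSemidef) {η : ℝ} (hη : 0 < η) :
    ∃ Q W : Matrix ι ι ℂ, Q.PosSemidef ∧ W.PosSemidef ∧ Q * Q = S + (η : ℂ) • 1 ∧
      W * Q = 1 ∧ Q * W = 1 ∧ ∀ T, IsProj T → (S + (η : ℂ) • 1 - T).PosSemidef →
        (Q - T).PosSemidef := by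
  obtain ⟨U, d, hU, hd, rfl⟩ := exists_conjDiag_nonneg hS
  have hpos : ∀ i, 0 < d i + η := fun i => add_pos_of_nonneg_of_pos (hd i) hη
  have hS' : conjDiag U d + (η : ℂ) • 1 = conjDiag U (fun i => d i + η) := by
    rw [← conjDiag_const hU, conjDiag_add]
  have hsq : ∀ i, (d i + η) ^ (1 / 2 : ℝ) * (d i + η) ^ (1 / 2 : ℝ) = d i + η := fun i => by
    rw [← Real.rpow_add (hpos i)]; norm_num
  have h1 : conjDiag U (fun _ => 1) = 1 := by simpa using conjDiag_const hU 1
  refine ⟨conjDiag U fun i => (d i + η) ^ (1 / 2 : ℝ),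
    conjDiag U fun i => ((d i + η) ^ (1 / 2 : ℝ))⁻¹,
    conjDiag_posSemidef U fun i => Real.rpow_nonneg (hpos i).le _,
    conjDiag_posSemidef U fun i => inv_nonneg.mpr (Real.rpow_nonneg (hpos i).le _), ?_, ?_, ?_, ?_⟩
  · rw [conjDiag_mul hU, hS']; congr 1; funext i; exact hsq i
  · rw [conjDiag_mul hU, ← h1]; congr 1; funext i
    exact inv_mul_cancel₀ (Real.rpow_pos_of_pos (hpos i) _).ne'
  · rw [conjDiag_mul hU, ← h1]; congr 1; funext i
    exact mul_inv_cancel₀ (Real.rpow_pos_of_pos (hpos i) _).ne'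
  · intro T hT hTS
    rw [hS'] at hTS
    have := mpow_sub_posSemidef hT.posSemidef (conjDiag_posSemidef U fun i => (hpos i).le) hTS
      (s := 1 / 2) (by norm_num) (by norm_num)
    rw [mpow_conjDiag hU] at this
    -- A projection is its own square root; this is why the tests have to be projections.
    have hTT : mpow T (1 / 2) = T := by
      rw [mpow_eq_rpow hT.posSemidef, ← CFC.sqrt_eq_rpow]
      exact CFC.sqrt_unique hT.mul_self hT.posSemidef.nonneg
    rwa [hTT] at this

/-- Hayashi-Nagaoka: a family of projections yields a POVM. -/
theorem exists_povm {κ : Type*} [Fintype κ] [DecidableEq κ] [Nonempty κ] (T : κ → Matrix ι ι ℂ)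
    (hT : ∀ k, IsProj (T k)) {η : ℝ} (hη : 0 < η) :
    ∃ Λ : POVM κ ι, ∀ k,
      ((2 : ℂ) • (1 - T k) + (4 : ℂ) • (∑ l ∈ Finset.univ.erase k, T l + (η : ℂ) • 1)
        - (1 - Λ.op k)).PosSemidef := by
  classical
  have hS : (∑ l, T l).PosSemidef := posSemidef_sum _ fun l _ => (hT l).posSemidef
  obtain ⟨Q, W, hQ, hW, hQQ, hWQ, hQW, hmono⟩ := exists_sqrt_inv hS hη
  set S' := ∑ l, T l + (η : ℂ) • (1 : Matrix ι ι ℂ) with hS'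
  have hN : (0 : ℝ) < (Fintype.card κ : ℝ) := by exact_mod_cast Fintype.card_pos
  have hη1 : ((η : ℂ) • (1 : Matrix ι ι ℂ)).PosSemidef :=
    PosSemidef.one.smul (by exact_mod_cast hη.le)
  have hr : ((((η / Fintype.card κ : ℝ)) : ℂ) • (W * W)).PosSemidef := by
    refine PosSemidef.smul ?_ (by exact_mod_cast (div_pos hη hN).le)
    have := posSemidef_conjTranspose_mul_self W
    rwa [hW.1] at this
  have hconj : ∀ {X : Matrix ι ι ℂ}, X.PosSemidef → (W * X * W).PosSemidef := fun {X} hX => by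
    have := hX.mul_mul_conjTranspose_same W
    rwa [hW.1] at this
  have hWSW : W * S' * W = 1 := by
    rw [← hQQ, ← Matrix.mul_assoc, hWQ, Matrix.one_mul, hQW]
  -- The effects `W * T k * W` add up to 1 - η W²; the defect is shared equally among the outcomes.
  refine ⟨⟨fun k => W * T k * W + ((η / Fintype.card κ : ℝ) : ℂ) • (W * W),
    fun k => (hconj (hT k).posSemidef).add hr, ?_⟩, fun k => ?_⟩
  · rw [Finset.sum_add_distrib, ← Finset.sum_mul, ← Finset.mul_sum, Finset.sum_const,
      Finset.card_univ, ← Nat.cast_smul_eq_nsmul ℂ, smul_smul]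
    have : (Fintype.card κ : ℂ) * ((η / Fintype.card κ : ℝ) : ℂ) = η := by
      push_cast
      rw [mul_div_cancel₀]
      exact_mod_cast hN.ne'
    rw [this, ← hWSW, hS', Matrix.mul_add, Matrix.add_mul]
    simp
  · set B := ∑ l ∈ Finset.univ.erase k, T l + (η : ℂ) • (1 : Matrix ι ι ℂ) with hB
    have hBT : S' = T k + B := by
      rw [hS', hB, ← Finset.add_sum_erase _ _ (Finset.mem_univ k), add_assoc]
    have hBpos : B.PosSemidef := (posSemidef_sum _ fun l _ => (hT l).posSemidef).add hη1
    have hQT := hmono (T k) (hT k) (by rw [hBT]; convert hBpos using 1; abel)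
    have hVB : ((W - 1 - 1) * B * (W - 1 - 1)).PosSemidef := by
      have := hBpos.mul_mul_conjTranspose_same (W - 1 - 1)
      rwa [conjTranspose_sub, conjTranspose_sub, conjTranspose_one, hW.1] at this
    have hVT : ((W - 1) * T k * (W - 1)).PosSemidef := by
      have := (hT k).posSemidef.mul_mul_conjTranspose_same (W - 1)
      rwa [conjTranspose_sub, conjTranspose_one, hW.1] at this
    have hVS : (W - 1) * S' * (W - 1) = 1 - (2 : ℂ) • Q + S' := by
      rw [← hQQ]
      calc (W - 1) * (Q * Q) * (W - 1) = (W * Q - Q) * (Q * W - Q) := by noncomm_ring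
        _ = (1 - Q) * (1 - Q) := by rw [hWQ, hQW]
        _ = _ := by rw [two_smul]; noncomm_ring
    have h1 : 1 - W * T k * W = W * B * W := by
      rw [← hWSW, hBT]; noncomm_ring
    -- The excess is written as a sum of four positive terms. The positivity of Q - T k comes from T
    -- k ≤ S' by taking square roots.
    have key : (2 : ℂ) • (1 - T k) + (4 : ℂ) • B
        - (1 - (W * T k * W + ((η / Fintype.card κ : ℝ) : ℂ) • (W * W)))
        = ((W - 1 - 1) * B * (W - 1 - 1)) + (2 : ℂ) • ((W - 1) * T k * (W - 1))
          + (4 : ℂ) • (Q - T k) + ((η / Fintype.card κ : ℝ) : ℂ) • (W * W) := by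
      have e1 : (W - 1 - 1) * B * (W - 1 - 1)
          = (2 : ℂ) • B + (2 : ℂ) • ((W - 1) * B * (W - 1)) - W * B * W := by
        rw [two_smul, two_smul]; noncomm_ring
      have e2 : (W - 1) * T k * (W - 1) = 1 - (2 : ℂ) • Q + S' - (W - 1) * B * (W - 1) := by
        rw [← hVS, hBT]; noncomm_ring
      rw [e1, e2, ← sub_sub 1 (W * T k * W), h1, hBT]
      module
    rw [key]
    exact ((hVB.add (hVT.smul (by norm_num))).add (hQT.smul (by norm_num))).add hr

end HayashiNagaoka

/-! ### Tensor powers and multiplicativity of the Chernoff quantity -/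

section Tensor
open scoped Kronecker

variable {N β γ : Type*} [Fintype N] [Fintype β] [Fintype γ]

/-- The tensor product of a family of matrices. -/
def piKron (A : N → Matrix β β ℂ) : Matrix (N → β) (N → β) ℂ :=
  Matrix.of fun s t => ∏ i, A i (s i) (t i)

omit [Fintype β] in
theorem piKron_apply (A : N → Matrix β β ℂ) (s t : N → β) :
    piKron A s t = ∏ i, A i (s i) (t i) := rfl

variable [DecidableEq N]

theorem piKron_mul (A A' : N → Matrix β β ℂ) :
    piKron A * piKron A' = piKron fun i => A i * A' i := by
  ext s t
  simp only [Matrix.mul_apply, piKron_apply, ← Finset.prod_mul_distrib]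
  rw [Fintype.prod_sum]

theorem trace_piKron (A : N → Matrix β β ℂ) : (piKron A).trace = ∏ i, (A i).trace := by
  simp only [Matrix.trace, diag_apply, piKron_apply]
  rw [Fintype.prod_sum]

omit [Fintype β] [DecidableEq N] in
theorem conjTranspose_piKron (A : N → Matrix β β ℂ) :
    (piKron A)ᴴ = piKron fun i => (A i)ᴴ := by
  ext s t
  simp [piKron_apply, conjTranspose_apply]

omit [Fintype β] in
theorem piKron_sum {X : Type*} [Fintype X] (c : N → X → ℂ) (A : N → X → Matrix β β ℂ) :
    ∑ x : N → X, (∏ i, c i (x i)) • piKron (fun i => A i (x i))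
      = piKron fun i => ∑ x, c i x • A i x := by
  ext s t
  simp only [Matrix.sum_apply, Matrix.smul_apply, piKron_apply, smul_eq_mul,
    ← Finset.prod_mul_distrib]
  rw [Fintype.prod_sum]

variable [DecidableEq β] [DecidableEq γ]

omit [DecidableEq N] [Fintype β] in
theorem piKron_diagonal (d : N → β → ℂ) :
    piKron (fun i => diagonal (d i)) = diagonal fun s => ∏ i, d i (s i) := by
  ext s t
  rw [piKron_apply, diagonal_apply]
  split_ifs with h
  · subst h; simp only [diagonal_apply_eq]
  · obtain ⟨i, hi⟩ := Function.ne_iff.mp h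
    exact Finset.prod_eq_zero (Finset.mem_univ i) (diagonal_apply_ne _ hi)

omit [DecidableEq N] [Fintype β] in
theorem piKron_one : piKron (fun _ : N => (1 : Matrix β β ℂ)) = 1 := by
  have := piKron_diagonal (fun (_ : N) (_ : β) => (1 : ℂ))
  simpa using this

theorem piKron_conjDiag (U : N → Matrix β β ℂ) (d : N → β → ℝ) :
    piKron (fun i => conjDiag (U i) (d i)) = conjDiag (piKron U) fun s => ∏ i, d i (s i) := by
  simp only [conjDiag]
  rw [conjTranspose_piKron, ← piKron_mul, ← piKron_mul, piKron_diagonal]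
  simp

theorem piKron_unitary {U : N → Matrix β β ℂ} (hU : ∀ i, (U i)ᴴ * U i = 1) :
    (piKron U)ᴴ * piKron U = 1 := by
  rw [conjTranspose_piKron, piKron_mul]
  simp only [hU, piKron_one]

theorem piKron_posSemidef {A : N → Matrix β β ℂ} (hA : ∀ i, (A i).PosSemidef) :
    (piKron A).PosSemidef := by
  choose U d hU hd h using fun i => exists_conjDiag_nonneg (hA i)
  obtain rfl : A = fun i => conjDiag (U i) (d i) := funext h
  rw [piKron_conjDiag]
  exact conjDiag_posSemidef _ fun s => Finset.prod_nonneg fun i _ => hd i _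

/-- Tensoring the diagonalizations of the factors diagonalizes the product, with products of
eigenvalues. -/
theorem mpow_piKron {A : N → Matrix β β ℂ} (hA : ∀ i, (A i).PosSemidef) (s : ℝ) :
    mpow (piKron A) s = piKron fun i => mpow (A i) s := by
  choose U d hU hd h using fun i => exists_conjDiag_nonneg (hA i)
  obtain rfl : A = fun i => conjDiag (U i) (d i) := funext h
  simp only [mpow_conjDiag (hU _), piKron_conjDiag]
  rw [mpow_conjDiag (piKron_unitary hU)]
  congr 1; funext t
  rw [Real.finsetProd_rpow _ _ fun i _ => hd i _]

theorem conjDiag_kronecker (U : Matrix β β ℂ) (V : Matrix γ γ ℂ) (d : β → ℝ) (e : γ → ℝ) :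
    conjDiag U d ⊗ₖ conjDiag V e = conjDiag (U ⊗ₖ V) fun k => d k.1 * e k.2 := by
  simp only [conjDiag]
  rw [conjTranspose_kronecker, mul_kronecker_mul, mul_kronecker_mul, diagonal_kronecker_diagonal]
  simp

theorem mpow_kronecker {A : Matrix β β ℂ} {B : Matrix γ γ ℂ} (hA : A.PosSemidef)
    (hB : B.PosSemidef) (s : ℝ) : mpow (A ⊗ₖ B) s = mpow A s ⊗ₖ mpow B s := by
  obtain ⟨U, d, hU, hd, rfl⟩ := exists_conjDiag_nonneg hA
  obtain ⟨V, e, hV, he, rfl⟩ := exists_conjDiag_nonneg hB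
  have hUV : (U ⊗ₖ V)ᴴ * (U ⊗ₖ V) = 1 := by
    rw [conjTranspose_kronecker, ← mul_kronecker_mul, hU, hV, one_kronecker_one]
  rw [mpow_conjDiag hU, mpow_conjDiag hV, conjDiag_kronecker, conjDiag_kronecker,
    mpow_conjDiag hUV]
  congr 1; funext t
  rw [Real.mul_rpow (hd _) (he _)]

/-- The quantity `Tr A^{1-s} B^s`. -/
def chernoff (A B : Matrix β β ℂ) (s : ℝ) : ℝ := (mpow A (1 - s) * mpow B s).trace.re

theorem chernoff_nonneg {A B : Matrix β β ℂ} (hA : A.PosSemidef) (hB : B.PosSemidef) (s : ℝ) :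
    0 ≤ chernoff A B s :=
  re_trace_mul_nonneg (mpow_posSemidef hA _) (mpow_posSemidef hB _)

/-- The product need not be Hermitian, but its trace equals its conjugate by cyclicity. Being real
is what lets the real part of a product of traces split below. -/
theorem trace_mpow_mul_mpow {A B : Matrix β β ℂ} (hA : A.PosSemidef) (hB : B.PosSemidef) (s : ℝ) :
    (mpow A (1 - s) * mpow B s).trace = chernoff A B s := by
  rw [chernoff]
  refine Complex.ext rfl ?_
  rw [Complex.ofReal_im, ← Complex.conj_eq_iff_im, ← Complex.star_def, ← trace_conjTranspose,
    conjTranspose_mul, (mpow_posSemidef hA _).1, (mpow_posSemidef hB _).1, Matrix.trace_mul_comm]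

theorem chernoff_smul {A B : Matrix β β ℂ} (hB : B.PosSemidef) {c : ℝ} (hc : 0 ≤ c) (s : ℝ) :
    chernoff A ((c : ℂ) • B) s = c ^ s * chernoff A B s := by
  rw [chernoff, mpow_smul hB hc, Matrix.mul_smul, Matrix.trace_smul, smul_eq_mul,
    Complex.re_ofReal_mul, chernoff]

/-- This makes the one-shot bound for words of length n an n-th power after averaging over the
letters. -/
theorem chernoff_piKron {A B : N → Matrix β β ℂ} (hA : ∀ i, (A i).PosSemidef)
    (hB : ∀ i, (B i).PosSemidef) (s : ℝ) :
    chernoff (piKron A) (piKron B) s = ∏ i, chernoff (A i) (B i) s := by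
  rw [chernoff, mpow_piKron hA, mpow_piKron hB, piKron_mul, trace_piKron]
  simp only [trace_mpow_mul_mpow (hA _) (hB _)]
  norm_cast

theorem chernoff_kronecker {A A' : Matrix β β ℂ} {B B' : Matrix γ γ ℂ} (hA : A.PosSemidef)
    (hA' : A'.PosSemidef) (hB : B.PosSemidef) (hB' : B'.PosSemidef) (s : ℝ) :
    chernoff (A ⊗ₖ B) (A' ⊗ₖ B') s = chernoff A A' s * chernoff B B' s := by
  rw [chernoff, mpow_kronecker hA hB, mpow_kronecker hA' hB', ← mul_kronecker_mul,
    trace_kronecker, trace_mpow_mul_mpow hA hA', trace_mpow_mul_mpow hB hB', ← Complex.ofReal_mul,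
    Complex.ofReal_re]

end Tensor

/-! ### The Chernoff quantity near s = 0 -/

section Derivative

variable {ι : Type*} [Fintype ι] [DecidableEq ι]

/-- The squared overlaps of the two eigenbases reduce a pair of noncommuting matrices to a classical
double sum. -/
theorem re_trace_conjDiag_mul_conjDiag (U V : Matrix ι ι ℂ) (d e : ι → ℝ) :
    (conjDiag U d * conjDiag V e).trace.re
      = ∑ i, ∑ j, Complex.normSq ((Uᴴ * V) i j) * d i * e j := by
  have : (conjDiag U d * conjDiag V e).trace
      = (diagonal (fun i => (d i : ℂ)) * (Uᴴ * V) * diagonal (fun i => (e i : ℂ))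
          * (Uᴴ * V)ᴴ).trace := by
    rw [conjTranspose_mul, conjTranspose_conjTranspose, conjDiag, conjDiag]
    simp only [Matrix.mul_assoc]
    rw [Matrix.trace_mul_comm]
    simp only [Matrix.mul_assoc]
  rw [this, Matrix.trace, Complex.re_sum]
  refine Finset.sum_congr rfl fun i _ => ?_
  rw [diag_apply, Matrix.mul_apply, Complex.re_sum]
  refine Finset.sum_congr rfl fun j _ => ?_
  rw [mul_diagonal, diagonal_mul, conjTranspose_apply, Complex.star_def,
    show (d i : ℂ) * (Uᴴ * V) i j * (e j : ℂ) * (starRingEnd ℂ) ((Uᴴ * V) i j)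
      = ((Uᴴ * V) i j * (starRingEnd ℂ) ((Uᴴ * V) i j)) * ((d i * e j : ℝ) : ℂ) by
        push_cast; ring, Complex.mul_conj, ← Complex.ofReal_mul, Complex.ofReal_re]
  ring

/-- The natural logarithm of a positive semidefinite matrix, with `log 0 = 0`. -/
def mlog (A : Matrix ι ι ℂ) : Matrix ι ι ℂ := cfc Real.log A

theorem mlog_conjDiag {U : Matrix ι ι ℂ} (hU : Uᴴ * U = 1) (d : ι → ℝ) :
    mlog (conjDiag U d) = conjDiag U (fun i => Real.log (d i)) :=
  cfc_conjDiag hU d _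

theorem re_trace_mul_mlog {A : Matrix ι ι ℂ} (hA : A.IsHermitian) :
    (A * mlog A).trace.re = - (entropy A * Real.log 2) := by
  obtain ⟨U, hU, h⟩ := exists_conjDiag hA
  rw [h, mlog_conjDiag hU, conjDiag_mul hU, trace_conjDiag hU, entropy_conjDiag hU,
    div_mul_cancel₀ _ (Real.log_pos (by norm_num : (1:ℝ) < 2)).ne', Complex.ofReal_re,
    ← Finset.sum_neg_distrib]
  exact Finset.sum_congr rfl fun i _ => by rw [Real.negMulLog]; ring

/-- Derivative at `s = 0` of `Tr A^{1-s} B^s`, for `A` supported in the support of `B`. -/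
theorem exists_hasDerivAt_chernoff {A B : Matrix ι ι ℂ} (hA : A.PosSemidef) (hB : B.PosSemidef)
    {c : ℝ} (hAB : (B - (c : ℂ) • A).PosSemidef) (hc : 0 < c) :
    ∃ F : ℝ → ℝ, (∀ s ∈ Set.Ioo (0 : ℝ) 1, F s = chernoff A B s) ∧ F 0 = A.trace.re ∧
      HasDerivAt F ((A * mlog B).trace.re - (A * mlog A).trace.re) 0 := by
  obtain ⟨U, d, hU, hd, rfl⟩ := exists_conjDiag_nonneg hA
  obtain ⟨V, e, hV, he, rfl⟩ := exists_conjDiag_nonneg hB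
  set w : ι → ι → ℝ := fun i j => Complex.normSq ((Uᴴ * V) i j) with hw
  have hw0 : ∀ i j, 0 ≤ w i j := fun i j => Complex.normSq_nonneg _
  -- Pairing B - cA ≥ 0 with the eigenprojection of B for the index j gives c ∑ₖ w k j d k ≤ e j =
  -- 0.
  have hsupp : ∀ i j, d i ≠ 0 → e j = 0 → w i j = 0 := by
    intro i j hdi hej
    have h1 := re_trace_mul_nonneg hAB
      (conjDiag_posSemidef V (d := Pi.single j 1) (fun k => by
        by_cases h : k = j
        · subst h; simp
        · simp [h]))
    rw [Matrix.sub_mul, Matrix.trace_sub, Complex.sub_re, conjDiag_mul hV, trace_conjDiag hV,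
      Complex.ofReal_re, Matrix.smul_mul, Matrix.trace_smul, smul_eq_mul, Complex.re_ofReal_mul,
      re_trace_conjDiag_mul_conjDiag] at h1
    have h2 : ∑ x, e x * (Pi.single j 1 : ι → ℝ) x = 0 := by
      simp [Pi.single_apply, hej]
    have h3 : ∀ k, ∑ l, w k l * d k * (Pi.single j 1 : ι → ℝ) l = w k j * d k := by
      intro k; simp [Pi.single_apply]
    rw [h2] at h1
    have h4 : ∑ k, w k j * d k = ∑ k, ∑ l, w k l * d k * (Pi.single j 1 : ι → ℝ) l :=
      Finset.sum_congr rfl fun k _ => (h3 k).symm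
    have h5 : w i j * d i ≤ ∑ k, w k j * d k :=
      Finset.single_le_sum (f := fun k => w k j * d k)
        (fun k _ => mul_nonneg (hw0 k j) (hd k)) (Finset.mem_univ i)
    have h6 : ∑ k, w k j * d k ≤ 0 := by
      rw [h4]; nlinarith
    have h7 : w i j * d i = 0 := le_antisymm (h5.trans h6) (mul_nonneg (hw0 i j) (hd i))
    exact (mul_eq_zero.mp h7).resolve_right hdi
  have h1 : conjDiag V (fun _ => 1) = 1 := by simpa using conjDiag_const hV 1
  have hrow : ∀ f : ι → ℝ, (conjDiag U f).trace.re = ∑ i, ∑ j, w i j * f i := by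
    intro f
    have := re_trace_conjDiag_mul_conjDiag U V f (fun _ => 1)
    rw [h1, Matrix.mul_one] at this
    rw [this]; simp [hw]
  -- Writing the powers as exponentials gives a function that is smooth at 0. The value `log 0 = 0`
  -- is harmless, since the terms with a zero eigenvalue have coefficient 0 by `hsupp`.
  refine ⟨fun s => ∑ i, ∑ j, w i j * d i * Real.exp (s * (Real.log (e j) - Real.log (d i))),
    ?_, ?_, ?_⟩
  · intro s hs
    rw [chernoff, mpow_conjDiag hU, mpow_conjDiag hV, re_trace_conjDiag_mul_conjDiag]
    refine Finset.sum_congr rfl fun i _ => Finset.sum_congr rfl fun j _ => ?_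
    change _ = w i j * _ * _
    rcases (hd i).eq_or_lt with h | h
    · rw [← h, Real.zero_rpow (by linarith [hs.2])]; simp
    rcases (he j).eq_or_lt with h' | h'
    · rw [hsupp i j h.ne' h'.symm]; simp
    rw [mul_sub, Real.exp_sub, Real.rpow_sub h, Real.rpow_one, mul_comm s, mul_comm s,
      ← Real.rpow_def_of_pos h, ← Real.rpow_def_of_pos h']
    ring
  · simp only [zero_mul, Real.exp_zero, mul_one]
    rw [hrow]
  · rw [mlog_conjDiag hU, mlog_conjDiag hV, re_trace_conjDiag_mul_conjDiag, conjDiag_mul hU, hrow,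
      ← Finset.sum_sub_distrib]
    refine HasDerivAt.fun_sum fun i _ => ?_
    rw [← Finset.sum_sub_distrib]
    refine HasDerivAt.fun_sum fun j _ => ?_
    have := (((hasDerivAt_id (0 : ℝ)).mul_const
      (Real.log (e j) - Real.log (d i))).exp).const_mul (w i j * d i)
    refine this.congr_deriv ?_
    simp only [hw, id, zero_mul, Real.exp_zero, one_mul]
    ring

end Derivative

/-! ### Error exponents below the Holevo information -/

section Exponent
open Filter Topology

variable {ι : Type*} [Fintype ι] [DecidableEq ι]

theorem eventually_lt_right_of_hasDerivAt {G : ℝ → ℝ} {g x : ℝ} (h : HasDerivAt G g x) (hg : g < 0) :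
    ∀ᶠ s in 𝓝[>] x, G s < G x := by
  have h1 := (hasDerivAt_iff_tendsto_slope.mp h).eventually_lt_const hg
  have h2 : ∀ᶠ s in 𝓝[>] x, slope G x s < 0 :=
    h1.filter_mono (nhdsWithin_mono _ fun y hy => ne_of_gt hy)
  filter_upwards [h2, self_mem_nhdsWithin] with s hs hx
  rw [slope_def_field, div_neg_iff] at hs
  have : x < s := hx
  rcases hs with hs | hs <;> linarith [hs.1, hs.2]

/-- The mixture of the states `A w` with weights `k w`. -/
def mix {ι W : Type*} [Fintype W] (k : W → ℝ) (A : W → Matrix ι ι ℂ) : Matrix ι ι ℂ :=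
  ∑ w, (k w : ℂ) • A w

omit [Fintype ι] [DecidableEq ι] in
theorem mix_posSemidef {W : Type*} [Fintype W] {k : W → ℝ} (hk : ∀ w, 0 ≤ k w)
    {A : W → Matrix ι ι ℂ} (hA : ∀ w, (A w).PosSemidef) :
    (mix k A).PosSemidef :=
  posSemidef_sum _ fun w _ => (hA w).smul (by exact_mod_cast hk w)

omit [DecidableEq ι] in
theorem mix_trace {W : Type*} [Fintype W] {k : W → ℝ} (hk : k ∈ stdSimplex ℝ W)
    {A : W → Matrix ι ι ℂ} (hA : ∀ w, (A w).trace = 1) :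
    (mix k A).trace = 1 := by
  rw [mix, Matrix.trace_sum]
  simp only [Matrix.trace_smul, hA, smul_eq_mul, mul_one]
  exact_mod_cast hk.2

omit [DecidableEq ι] in
theorem re_trace_mix_mul {W : Type*} [Fintype W] (k : W → ℝ) (A : W → Matrix ι ι ℂ)
    (T : Matrix ι ι ℂ) : (mix k A * T).trace.re = ∑ w, k w * (A w * T).trace.re := by
  rw [mix, Finset.sum_mul, Matrix.trace_sum, Complex.re_sum]
  refine Finset.sum_congr rfl fun w _ => ?_
  rw [Matrix.smul_mul, Matrix.trace_smul, smul_eq_mul, Complex.re_ofReal_mul]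

/-- For rates below the Holevo information, the Chernoff-type exponent is positive. -/
theorem eventually_exponent {C W : Type*} [Fintype C] [Fintype W] {q : C → ℝ}
    (hq : q ∈ stdSimplex ℝ C) {k : C → W → ℝ} (hk : ∀ c, k c ∈ stdSimplex ℝ W)
    {A : C → W → Matrix ι ι ℂ} (hA : ∀ c w, (A c w).PosSemidef) (hA1 : ∀ c w, (A c w).trace = 1)
    {R : ℝ} (hR : R < ∑ c, q c * (entropy (mix (k c) (A c))
      - ∑ w, k c w * entropy (A c w))) :
    ∀ᶠ s in 𝓝[>] (0 : ℝ),
      (2 : ℝ) ^ (R * s) * ∑ c, q c * ∑ w, k c w * chernoff (A c w) (mix (k c) (A c)) s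
        < 1 := by
  classical
  have hl2 : 0 < Real.log 2 := Real.log_pos (by norm_num)
  set σ : C → Matrix ι ι ℂ := fun c => mix (k c) (A c) with hσ
  have hσp : ∀ c, (σ c).PosSemidef := fun c => mix_posSemidef (hk c).1 (hA c)
  have hF : ∀ c w, ∃ F : ℝ → ℝ,
      (∀ s ∈ Set.Ioo (0 : ℝ) 1, k c w * F s = k c w * chernoff (A c w) (σ c) s) ∧
      F 0 = 1 ∧ ∃ D, HasDerivAt F D 0 ∧
        k c w * D = k c w * ((A c w * mlog (σ c)).trace.re - (A c w * mlog (A c w)).trace.re) := by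
    intro c w
    -- A letter of weight 0 need not be supported in the mixture, so it gets a constant dummy
    -- function. For positive weight, the mixture dominates that multiple of the letter's state.
    rcases ((hk c).1 w).eq_or_lt with h | h
    · exact ⟨fun _ => 1, fun s _ => by rw [← h, zero_mul, zero_mul], rfl, 0, hasDerivAt_const _ _,
        by rw [← h, zero_mul, zero_mul]⟩
    · have : (σ c - (k c w : ℂ) • A c w).PosSemidef := by
        rw [hσ]
        simp only [mix]
        rw [← Finset.add_sum_erase _ _ (Finset.mem_univ w), add_sub_cancel_left]
        exact posSemidef_sum _ fun w _ => (hA c w).smul (by exact_mod_cast (hk c).1 w)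
      obtain ⟨F, h1, h2, h3⟩ := exists_hasDerivAt_chernoff (hA c w) (hσp c) this h
      exact ⟨F, fun s hs => by rw [h1 s hs], by rw [h2, hA1, Complex.one_re], _, h3, rfl⟩
  choose F h1 h2 D h3 h4 using hF
  -- At 0 this function has the value 1, because the states have trace 1, and its derivative is (R -
  -- Holevo information) log 2.
  have hG : HasDerivAt (fun s => Real.exp (s * (R * Real.log 2))
      * ∑ c, q c * ∑ w, k c w * F c w s)
      (R * Real.log 2 + ∑ c, q c * ∑ w, k c w * D c w) 0 := by
    have e1 : HasDerivAt (fun s => ∑ c, q c * ∑ w, k c w * F c w s)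
        (∑ c, q c * ∑ w, k c w * D c w) 0 :=
      HasDerivAt.fun_sum fun c _ => (HasDerivAt.fun_sum fun w _ =>
        (h3 c w).const_mul _).const_mul _
    have e2 := ((hasDerivAt_id (0 : ℝ)).mul_const (R * Real.log 2)).exp
    refine (e2.mul e1).congr_deriv ?_
    simp only [id, zero_mul, Real.exp_zero, one_mul, h2, mul_one, (hk _).2, hq.2]
  have hD : ∀ c, ∑ w, k c w * D c w
      = -((entropy (σ c) - ∑ w, k c w * entropy (A c w)) * Real.log 2) := by
    intro c
    simp only [h4]
    have e1 : ∑ w, k c w * (A c w * mlog (σ c)).trace.re = -(entropy (σ c) * Real.log 2) := by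
      rw [← re_trace_mul_mlog (hσp c).1]
      exact (re_trace_mix_mul (k c) (A c) (mlog (σ c))).symm
    simp only [re_trace_mul_mlog (hA c _).1, mul_sub, Finset.sum_sub_distrib, e1, sub_mul,
      Finset.sum_mul]
    have e2 : ∑ w, k c w * -(entropy (A c w) * Real.log 2)
        = -∑ w, k c w * entropy (A c w) * Real.log 2 := by
      rw [← Finset.sum_neg_distrib]
      exact Finset.sum_congr rfl fun w _ => by ring
    rw [e2]
    ring
  have hneg : R * Real.log 2 + ∑ c, q c * ∑ w, k c w * D c w < 0 := by
    have : ∑ c, q c * ∑ w, k c w * D c w = -((∑ c, q c * (entropy (σ c)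
        - ∑ w, k c w * entropy (A c w))) * Real.log 2) := by
      rw [Finset.sum_mul, ← Finset.sum_neg_distrib]
      exact Finset.sum_congr rfl fun c _ => by rw [hD c]; ring
    rw [this]
    nlinarith
  filter_upwards [eventually_lt_right_of_hasDerivAt hG hneg,
    Ioo_mem_nhdsGT (by norm_num : (0 : ℝ) < 1)] with s hs hs01
  simp only [zero_mul, Real.exp_zero, h2, mul_one, (hk _).2, hq.2] at hs
  rw [show (∑ c, q c * ∑ w, k c w * chernoff (A c w) (σ c) s) = ∑ c, q c * ∑ w, k c w * F c w s from
    Finset.sum_congr rfl fun c _ => by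
      rw [Finset.sum_congr rfl fun w _ => (h1 c w s hs01).symm],
    Real.rpow_def_of_pos (by norm_num)]
  rwa [show Real.log 2 * (R * s) = s * (R * Real.log 2) by ring]

end Exponent

/-! ### Entropy of classical-quantum states -/

section Entropy

variable {ι κ β : Type*} [Fintype ι] [DecidableEq ι] [Fintype κ] [DecidableEq κ] [Fintype β]
  [DecidableEq β]

theorem entropy_diagonal (p : ι → ℝ) :
    entropy (diagonal fun i => (p i : ℂ)) = (∑ i, Real.negMulLog (p i)) / Real.log 2 := by
  rw [← entropy_conjDiag (U := 1) (by simp)]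
  simp [conjDiag]

/-- The entropy of a block diagonal state. -/
theorem entropy_blockDiagonal (e : ι ≃ β × κ) {M : κ → Matrix β β ℂ}
    (hM : ∀ k, (M k).IsHermitian) :
    entropy ((blockDiagonal M).submatrix e e) = ∑ k, entropy (M k) := by
  choose U hU h using fun k => exists_conjDiag (hM k)
  set d : κ → β → ℝ := fun k => (hM k).eigenvalues with hd
  have e1 : M = fun k => U k * diagonal (fun i => (d k i : ℂ)) * (U k)ᴴ := funext h
  set V := (blockDiagonal U).submatrix e e with hV
  have hVV : Vᴴ * V = 1 := by
    rw [hV, conjTranspose_submatrix, submatrix_mul_equiv, blockDiagonal_conjTranspose,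
      ← blockDiagonal_mul]
    simp only [hU]
    rw [show (fun _ : κ => (1 : Matrix β β ℂ)) = 1 from rfl, blockDiagonal_one, submatrix_one_equiv]
  have hθ : (blockDiagonal M).submatrix e e = conjDiag V fun i => d (e i).2 (e i).1 := by
    rw [conjDiag, hV, conjTranspose_submatrix, blockDiagonal_conjTranspose]
    have : diagonal (fun i => (d (e i).2 (e i).1 : ℂ))
        = (blockDiagonal fun k => diagonal (fun i => (d k i : ℂ))).submatrix e e := by
      rw [blockDiagonal_diagonal, submatrix_diagonal_equiv]; rfl
    rw [this, submatrix_mul_equiv, submatrix_mul_equiv, ← blockDiagonal_mul, ← blockDiagonal_mul,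
      ← e1]
  rw [hθ, entropy_conjDiag hVV]
  have : ∀ k, entropy (M k) = (∑ i, Real.negMulLog (d k i)) / Real.log 2 := fun k => by
    conv_lhs => rw [h k]
    rw [entropy_conjDiag (hU k)]
  simp only [this]
  rw [← Finset.sum_div, Equiv.sum_comp e (fun k => Real.negMulLog (d k.2 k.1)),
    Fintype.sum_prod_type_right]

theorem entropy_smul {ρ : Matrix ι ι ℂ} (hρ : ρ.IsHermitian) (h1 : ρ.trace = 1) (c : ℝ) :
    entropy ((c : ℂ) • ρ) = Real.negMulLog c / Real.log 2 + c * entropy ρ := by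
  obtain ⟨U, hU, h⟩ := exists_conjDiag hρ
  set d := hρ.eigenvalues
  have e1 : (c : ℂ) • ρ = conjDiag U (fun i => c * d i) := by
    rw [h, ← conjDiag_mul hU (fun _ => c) d, conjDiag_const hU, Matrix.smul_mul, Matrix.one_mul]
  have e2 : ∑ i, d i = 1 := by
    rw [h, trace_conjDiag hU] at h1
    exact_mod_cast h1
  rw [e1, h, entropy_conjDiag hU, entropy_conjDiag hU]
  simp only [Real.negMulLog_mul, Finset.sum_add_distrib, ← Finset.sum_mul, ← Finset.mul_sum, e2]
  ring

/-- The entropy of a classical-quantum state. -/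
theorem entropy_cq (e : ι ≃ β × κ) {M : κ → Matrix β β ℂ} (hM : ∀ k, (M k).IsHermitian)
    (h1 : ∀ k, (M k).trace = 1) (p : κ → ℝ) {θ : Matrix ι ι ℂ}
    (hθ : ∀ i j, θ i j = if (e i).2 = (e j).2 then (p (e i).2 : ℂ) * M (e i).2 (e i).1 (e j).1
      else 0) :
    entropy θ = (∑ k, Real.negMulLog (p k)) / Real.log 2 + ∑ k, p k * entropy (M k) := by
  have : θ = (blockDiagonal fun k => (p k : ℂ) • M k).submatrix e e := by
    ext i j
    rw [hθ, submatrix_apply, blockDiagonal_apply]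
    rfl
  rw [this, entropy_blockDiagonal e fun k => (hM k).smul (by simp [IsSelfAdjoint])]
  simp only [entropy_smul (hM _) (h1 _), Finset.sum_add_distrib, Finset.sum_div]

end Entropy

/-! ### The information quantities as Holevo quantities -/

section Information

theorem reduce_posSemidef {ι κ μ : Type*} [Fintype μ] (f : κ → μ → ι) {θ : Matrix ι ι ℂ}
    (hθ : θ.PosSemidef) : (reduce f θ).PosSemidef := by
  have : reduce f θ = ∑ m, θ.submatrix (fun k => f k m) (fun k => f k m) := by
    ext i j
    simp [reduce, Matrix.sum_apply]
  rw [this]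
  exact posSemidef_sum _ fun m _ => hθ.submatrix _

theorem trace_reduce_fst {κ μ : Type*} [Fintype κ] [Fintype μ] (θ : Matrix (κ × μ) (κ × μ) ℂ) :
    (reduce (fun (k : κ) (m : μ) => (k, m)) θ).trace = θ.trace := by
  simp [Matrix.trace, reduce, Fintype.sum_prod_type]

theorem trace_reduce_snd {κ μ : Type*} [Fintype κ] [Fintype μ] (θ : Matrix (μ × κ) (μ × κ) ℂ) :
    (reduce (fun (k : κ) (m : μ) => (m, k)) θ).trace = θ.trace := by
  simp [Matrix.trace, reduce, Fintype.sum_prod_type_right]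

/-- The conditional mutual information between classical and quantum systems `A`, `B`, conditioned
on a classical system `C`. -/
theorem condMutualInfo_cq {A B C : Type*} [Fintype A] [Fintype B] [Fintype C]
    [DecidableEq A] [DecidableEq B] [DecidableEq C] {q : C → ℝ} {k : C → A → ℝ}
    (hk : ∀ c, k c ∈ stdSimplex ℝ A) {M : C → A → Matrix B B ℂ}
    (hM : ∀ c a, (M c a).PosSemidef) (hM1 : ∀ c a, (M c a).trace = 1)
    {θ : Matrix (A × B × C) (A × B × C) ℂ}
    (hθ : ∀ i j, θ i j = if i.1 = j.1 ∧ i.2.2 = j.2.2 then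
      ((q i.2.2 * k i.2.2 i.1 : ℝ) : ℂ) * M i.2.2 i.1 i.2.1 j.2.1 else 0) :
    condMutualInfo θ = ∑ c, q c * (entropy (mix (k c) (M c)) - ∑ a, k c a * entropy (M c a)) := by
  have hM1' : ∀ c a, ∑ b, M c a b b = 1 := hM1
  have e4 := entropy_cq (ι := A × B × C) (β := B) (κ := A × C)
    ⟨fun i => (i.2.1, i.1, i.2.2), fun i => (i.2.1, i.1, i.2.2), fun _ => rfl, fun _ => rfl⟩
    (M := fun k => M k.2 k.1) (fun k => (hM _ _).1) (fun k => hM1 _ _)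
    (fun l => q l.2 * k l.2 l.1) (θ := θ) (fun i j => by simp only [hθ, Equiv.coe_fn_mk,
      Prod.mk.injEq])
  have e2 := entropy_cq (ι := B × C) (Equiv.refl _)
    (M := fun c => mix (k c) (M c)) (fun c => (mix_posSemidef (hk c).1 (hM c)).1)
    (fun c => mix_trace (hk c) (hM1 c)) q
    (θ := reduce (fun (k : B × C) (a : A) => (a, k.1, k.2)) θ) (by
      rintro ⟨b, c⟩ ⟨b', c'⟩
      by_cases h : c = c'
      · subst h
        simp only [reduce, of_apply, hθ, and_self, if_true, Equiv.refl_apply, mix,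
          Matrix.sum_apply, Matrix.smul_apply, smul_eq_mul, Finset.mul_sum]
        refine Finset.sum_congr rfl fun u _ => ?_
        push_cast; ring
      · simp [reduce, hθ, h])
  have e1 : reduce (fun (k : A × C) (b : B) => (k.1, b, k.2)) θ
      = diagonal fun l : A × C => ((q l.2 * k l.2 l.1 : ℝ) : ℂ) := by
    ext ⟨a, c⟩ ⟨a', c'⟩
    simp only [reduce, of_apply, hθ, diagonal_apply, Prod.mk.injEq]
    split_ifs with h
    · obtain ⟨rfl, rfl⟩ := h
      rw [← Finset.mul_sum, hM1', mul_one]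
    · simp
  have e3 : reduce (fun (c : C) (k : A × B) => (k.1, k.2, c)) θ
      = diagonal fun c : C => ((q c : ℝ) : ℂ) := by
    ext c c'
    simp only [reduce, of_apply, hθ, diagonal_apply, true_and, Fintype.sum_prod_type]
    split_ifs with h
    · subst h
      simp only [← Finset.mul_sum, hM1', mul_one]
      rw [← Complex.ofReal_sum, ← Finset.mul_sum, (hk c).2, mul_one]
    · simp
  rw [condMutualInfo, e4, e2, e1, e3, entropy_diagonal, entropy_diagonal]
  simp only [mul_sub, Finset.sum_sub_distrib, Finset.mul_sum, Fintype.sum_prod_type_right]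
  simp only [mul_assoc]
  ring

/-- The mutual information between a classical and a quantum system. -/
theorem mutualInfo_cq {A B : Type*} [Fintype A] [Fintype B]
    [DecidableEq A] [DecidableEq B] {k : A → ℝ} {M : A → Matrix B B ℂ}
    (hM : ∀ a, (M a).PosSemidef) (hM1 : ∀ a, (M a).trace = 1)
    {θ : Matrix (A × B) (A × B) ℂ}
    (hθ : ∀ i j, θ i j = if i.1 = j.1 then (k i.1 : ℂ) * M i.1 i.2 j.2 else 0) :
    mutualInfo θ = entropy (mix k M) - ∑ a, k a * entropy (M a) := by
  have hM1' : ∀ a, ∑ b, M a b b = 1 := hM1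
  have e3 := entropy_cq (ι := A × B) (Equiv.prodComm A B) (M := M)
    (fun a => (hM a).1) hM1 k (θ := θ) (fun i j => hθ i j)
  have e1 : reduce (fun (a : A) (b : B) => (a, b)) θ = diagonal fun a => (k a : ℂ) := by
    ext a a'
    simp only [reduce, of_apply, hθ, diagonal_apply]
    split_ifs with h
    · subst h
      rw [← Finset.mul_sum, hM1', mul_one]
    · simp
  have e2 : reduce (fun (b : B) (a : A) => (a, b)) θ = mix k M := by
    ext b b'
    simp [reduce, hθ, mix, Matrix.sum_apply]
  rw [mutualInfo, e1, e2, e3, entropy_diagonal]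
  ring

variable {X X₁ B₁ B U : Type*} [Fintype X] [Fintype X₁] [Fintype B₁] [Fintype B] [Fintype U]
  [DecidableEq X] [DecidableEq X₁] [DecidableEq B₁] [DecidableEq B] [DecidableEq U]

/-- The output state at the relay. -/
def RelayChannel.relayOut (𝒩 : RelayChannel X X₁ B₁ B) (x₁ : X₁) (x : X) : Matrix B₁ B₁ ℂ :=
  reduce (fun (k : B₁) (m : B) => (k, m)) (𝒩.state x x₁)

/-- The output state at the destination. -/
def RelayChannel.destOut (𝒩 : RelayChannel X X₁ B₁ B) (x₁ : X₁) (x : X) : Matrix B B ℂ :=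
  reduce (fun (k : B) (m : B₁) => (m, k)) (𝒩.state x x₁)

section
omit [Fintype X] [Fintype X₁] [DecidableEq X] [DecidableEq X₁] [DecidableEq B₁] [DecidableEq B]

theorem RelayChannel.relayOut_posSemidef (𝒩 : RelayChannel X X₁ B₁ B) (x₁ : X₁) (x : X) :
    (𝒩.relayOut x₁ x).PosSemidef := reduce_posSemidef _ (𝒩.posSemidef x x₁)

theorem RelayChannel.destOut_posSemidef (𝒩 : RelayChannel X X₁ B₁ B) (x₁ : X₁) (x : X) :
    (𝒩.destOut x₁ x).PosSemidef := reduce_posSemidef _ (𝒩.posSemidef x x₁)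

theorem RelayChannel.trace_relayOut (𝒩 : RelayChannel X X₁ B₁ B) (x₁ : X₁) (x : X) :
    (𝒩.relayOut x₁ x).trace = 1 := by rw [relayOut, trace_reduce_fst, 𝒩.trace_eq_one]

theorem RelayChannel.trace_destOut (𝒩 : RelayChannel X X₁ B₁ B) (x₁ : X₁) (x : X) :
    (𝒩.destOut x₁ x).trace = 1 := by rw [destOut, trace_reduce_snd, 𝒩.trace_eq_one]
end

variable {p₁ : X₁ → ℝ} {p₂ : X₁ → U → ℝ} {p₃ : X₁ → U → X → ℝ}

omit [DecidableEq B] in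
theorem infoUB₁X₁_eq (𝒩 : RelayChannel X X₁ B₁ B) {p : U × X × X₁ → ℝ}
    (h₂ : ∀ x₁, p₂ x₁ ∈ stdSimplex ℝ U) (h₃ : ∀ x₁ u, p₃ x₁ u ∈ stdSimplex ℝ X)
    (hp : ∀ u x x₁, p (u, x, x₁) = p₁ x₁ * p₂ x₁ u * p₃ x₁ u x) :
    infoUB₁X₁ 𝒩 p = ∑ x₁, p₁ x₁ *
      (entropy (mix (p₂ x₁) fun u => mix (p₃ x₁ u) (𝒩.relayOut x₁))
        - ∑ u, p₂ x₁ u * entropy (mix (p₃ x₁ u) (𝒩.relayOut x₁))) := by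
  refine condMutualInfo_cq h₂ (M := fun x₁ u => mix (p₃ x₁ u) (𝒩.relayOut x₁))
    (fun x₁ u => mix_posSemidef (h₃ x₁ u).1 (𝒩.relayOut_posSemidef x₁))
    (fun x₁ u => mix_trace (h₃ x₁ u) (𝒩.trace_relayOut x₁)) ?_
  rintro ⟨u, b, x₁⟩ ⟨u', b', x₁'⟩
  simp only [reduce, codeState, of_apply, Fintype.sum_prod_type, hp, mix, true_and]
  split_ifs with h
  · simp only [Matrix.sum_apply, Matrix.smul_apply, RelayChannel.relayOut, reduce, of_apply,
      smul_eq_mul, Finset.mul_sum]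
    refine Finset.sum_congr rfl fun x _ => Finset.sum_congr rfl fun c _ => ?_
    push_cast
    ring
  · simp

omit [DecidableEq B₁] in
theorem infoXBX₁U_eq (𝒩 : RelayChannel X X₁ B₁ B) {p : U × X × X₁ → ℝ}
    (h₃ : ∀ x₁ u, p₃ x₁ u ∈ stdSimplex ℝ X)
    (hp : ∀ u x x₁, p (u, x, x₁) = p₁ x₁ * p₂ x₁ u * p₃ x₁ u x) :
    infoXBX₁U 𝒩 p = ∑ x₁, p₁ x₁ * ∑ u, p₂ x₁ u *
      (entropy (mix (p₃ x₁ u) (𝒩.destOut x₁)) - ∑ x, p₃ x₁ u x * entropy (𝒩.destOut x₁ x)) := by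
  rw [infoXBX₁U, condMutualInfo_cq (q := fun c : X₁ × U => p₁ c.1 * p₂ c.1 c.2)
    (k := fun c => p₃ c.1 c.2) (fun c => h₃ c.1 c.2) (M := fun c x => 𝒩.destOut c.1 x)
    (fun c x => 𝒩.destOut_posSemidef c.1 x) (fun c x => 𝒩.trace_destOut c.1 x)]
  · simp only [Fintype.sum_prod_type, Finset.mul_sum, mul_assoc]
  · rintro ⟨x, b, x₁, u⟩ ⟨x', b', x₁', u'⟩
    simp only [reduce, codeState, of_apply, hp, Prod.mk.injEq]
    by_cases h : x = x' ∧ x₁ = x₁' ∧ u = u'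
    · obtain ⟨rfl, rfl, rfl⟩ := h
      simp [RelayChannel.destOut, reduce, Finset.mul_sum]
    · rw [if_neg h]
      refine Finset.sum_eq_zero fun c _ => if_neg fun h' => h ⟨h'.2.1, h'.2.2, h'.1⟩

-- The chain rule I(XX₁;B) = I(X₁;B) + I(U;B|X₁) + I(X;B|X₁U). The auxiliary `U` is free here
-- because the output depends on (x,x₁) only, so averaging over `U` does not change the left side.
omit [DecidableEq B₁] in
theorem infoXX₁B_eq (𝒩 : RelayChannel X X₁ B₁ B) {p : U × X × X₁ → ℝ}
    (h₃ : ∀ x₁ u, p₃ x₁ u ∈ stdSimplex ℝ X)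
    (hp : ∀ u x x₁, p (u, x, x₁) = p₁ x₁ * p₂ x₁ u * p₃ x₁ u x) :
    infoXX₁B 𝒩 p =
      (entropy (mix p₁ fun x₁ => mix (p₂ x₁) fun u => mix (p₃ x₁ u) (𝒩.destOut x₁))
        - ∑ x₁, p₁ x₁ * entropy (mix (p₂ x₁) fun u => mix (p₃ x₁ u) (𝒩.destOut x₁)))
      + (∑ x₁, p₁ x₁ * (entropy (mix (p₂ x₁) fun u => mix (p₃ x₁ u) (𝒩.destOut x₁))
        - ∑ u, p₂ x₁ u * entropy (mix (p₃ x₁ u) (𝒩.destOut x₁))))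
      + infoXBX₁U 𝒩 p := by
  have hmix : (mix (fun k : X × X₁ => ∑ u, p (u, k.1, k.2)) fun k => 𝒩.destOut k.2 k.1)
      = mix p₁ fun x₁ => mix (p₂ x₁) fun u => mix (p₃ x₁ u) (𝒩.destOut x₁) := by
    simp only [mix, Fintype.sum_prod_type_right, hp, Finset.smul_sum, smul_smul, Complex.ofReal_sum,
      Complex.ofReal_mul, Finset.sum_smul]
    refine Finset.sum_congr rfl fun x₁ _ => ?_
    rw [Finset.sum_comm]
    simp only [mul_assoc]
  rw [infoXX₁B, mutualInfo_cq (k := fun k : X × X₁ => ∑ u, p (u, k.1, k.2))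
    (M := fun k => 𝒩.destOut k.2 k.1) (fun k => 𝒩.destOut_posSemidef _ _)
    (fun k => 𝒩.trace_destOut _ _), hmix, infoXBX₁U_eq 𝒩 h₃ hp]
  · have : ∑ k : X × X₁, (∑ u, p (u, k.1, k.2)) * entropy (𝒩.destOut k.2 k.1)
        = ∑ x₁, p₁ x₁ * ∑ u, p₂ x₁ u * ∑ x, p₃ x₁ u x * entropy (𝒩.destOut x₁ x) := by
      simp only [Fintype.sum_prod_type_right, hp, Finset.sum_mul, Finset.mul_sum]
      refine Finset.sum_congr rfl fun x₁ _ => ?_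
      rw [Finset.sum_comm]
      simp only [mul_assoc]
    rw [this]
    simp only [mul_sub, Finset.sum_sub_distrib]
    ring
  · rintro ⟨⟨x, x₁⟩, b⟩ ⟨⟨x', x₁'⟩, b'⟩
    simp only [reduce, codeState, of_apply, Prod.mk.injEq, true_and, Fintype.sum_prod_type]
    split_ifs with h
    · simp only [RelayChannel.destOut, reduce, of_apply, Complex.ofReal_sum, Finset.mul_sum,
        Finset.sum_mul]
      rw [Finset.sum_comm]
    · simp

end Information

/-! ### Finite expectations and product laws -/

section Laws

/-- The expectation of `f` with respect to the weights `μ`. -/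
def expect {Ω : Type*} [Fintype Ω] (μ f : Ω → ℝ) : ℝ := ∑ ω, μ ω * f ω

variable {Ω : Type*} [Fintype Ω] {μ : Ω → ℝ}

theorem expect_mono (hμ : ∀ ω, 0 ≤ μ ω) {f g : Ω → ℝ} (h : ∀ ω, f ω ≤ g ω) :
    expect μ f ≤ expect μ g :=
  Finset.sum_le_sum fun ω _ => mul_le_mul_of_nonneg_left (h ω) (hμ ω)

theorem expect_add (f g : Ω → ℝ) :
    expect μ (fun ω => f ω + g ω) = expect μ f + expect μ g := by
  simp [expect, mul_add, Finset.sum_add_distrib]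

theorem expect_mul_left (c : ℝ) (f : Ω → ℝ) :
    expect μ (fun ω => c * f ω) = c * expect μ f := by
  simp only [expect, Finset.mul_sum]
  exact Finset.sum_congr rfl fun ω _ => by ring

theorem expect_sum {κ : Type*} (s : Finset κ) (f : κ → Ω → ℝ) :
    expect μ (fun ω => ∑ k ∈ s, f k ω) = ∑ k ∈ s, expect μ (f k) := by
  simp only [expect, Finset.mul_sum]
  exact Finset.sum_comm

theorem expect_const (hμ : μ ∈ stdSimplex ℝ Ω) (c : ℝ) : expect μ (fun _ => c) = c := by
  rw [expect, ← Finset.sum_mul, hμ.2, one_mul]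

theorem expect_nonneg (hμ : ∀ ω, 0 ≤ μ ω) {f : Ω → ℝ} (h : ∀ ω, 0 ≤ f ω) : 0 ≤ expect μ f :=
  Finset.sum_nonneg fun ω _ => mul_nonneg (hμ ω) (h ω)

/-- The derandomization step: some codebook is at least as good as the average. -/
theorem exists_le_expect (hμ : μ ∈ stdSimplex ℝ Ω) (f : Ω → ℝ) : ∃ ω, f ω ≤ expect μ f := by
  by_contra! h
  have h1 : expect μ (fun _ => expect μ f) ≤ expect μ f := expect_mono hμ.1 fun ω => (h ω).le
  obtain ⟨ω₀, h0⟩ : ∃ ω, 0 < μ ω := by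
    by_contra! h'
    have : ∑ ω, μ ω ≤ 0 := Finset.sum_nonpos fun ω _ => h' ω
    rw [hμ.2] at this
    linarith
  have h2 : expect μ (fun _ => expect μ f) < expect μ f :=
    Finset.sum_lt_sum (fun ω _ => mul_le_mul_of_nonneg_left (h ω).le (hμ.1 ω))
      ⟨ω₀, Finset.mem_univ _, mul_lt_mul_of_pos_left (h ω₀) h0⟩
  rw [expect_const hμ] at h2
  exact lt_irrefl _ h2

theorem expect_comm {Ω' : Type*} [Fintype Ω'] {μ' : Ω' → ℝ} (f : Ω → Ω' → ℝ) :
    expect μ (fun ω => expect μ' (f ω)) = expect μ' fun ω' => expect μ fun ω => f ω ω' := by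
  simp only [expect, Finset.mul_sum]
  rw [Finset.sum_comm]
  exact Finset.sum_congr rfl fun _ _ => Finset.sum_congr rfl fun _ _ => by ring

theorem re_trace_mul_mix {ι : Type*} [Fintype ι] (k : Ω → ℝ) (A : Ω → Matrix ι ι ℂ)
    (T : Matrix ι ι ℂ) : (T * mix k A).trace.re = expect k fun ω => (T * A ω).trace.re := by
  rw [Matrix.trace_mul_comm, re_trace_mix_mul]
  simp only [Matrix.trace_mul_comm T, expect]

open scoped Kronecker in
theorem mix_kronecker {ι κ : Type*} (k : Ω → ℝ) (A : Ω → Matrix ι ι ℂ) (C : Matrix κ κ ℂ) :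
    mix k A ⊗ₖ C = mix k fun ω => A ω ⊗ₖ C := by
  ext i j
  simp [mix, Matrix.sum_apply, Finset.sum_mul, mul_assoc]

open scoped Kronecker in
theorem kronecker_mix {ι κ : Type*} (k : Ω → ℝ) (A : Ω → Matrix ι ι ℂ) (C : Matrix κ κ ℂ) :
    C ⊗ₖ mix k A = mix k fun ω => C ⊗ₖ A ω := by
  ext i j
  simp only [mix, kroneckerMap_apply, Matrix.sum_apply, Matrix.smul_apply, smul_eq_mul,
    Finset.mul_sum]
  exact Finset.sum_congr rfl fun _ _ => by ring

variable {K S : Type*} [Fintype K] [DecidableEq K] [Fintype S]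

/-- The law of independent variables with laws `Q k`. -/
def prodLaw (Q : K → S → ℝ) (ω : K → S) : ℝ := ∏ k, Q k (ω k)

theorem prodLaw_mem {Q : K → S → ℝ} (hQ : ∀ k, Q k ∈ stdSimplex ℝ S) :
    prodLaw Q ∈ stdSimplex ℝ (K → S) := by
  refine ⟨fun ω => Finset.prod_nonneg fun k _ => (hQ k).1 _, ?_⟩
  simp only [prodLaw, ← Fintype.prod_sum, (hQ _).2, Finset.prod_const_one]

theorem expect_prodLaw_prod (Q f : K → S → ℝ) :
    expect (prodLaw Q) (fun ω => ∏ k, f k (ω k)) = ∏ k, expect (Q k) (f k) := by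
  simp only [expect, prodLaw, ← Finset.prod_mul_distrib, Fintype.prod_sum]

theorem expect_prodLaw_apply {Q : K → S → ℝ} (hQ : ∀ k, Q k ∈ stdSimplex ℝ S) (a : K)
    (g : S → ℝ) : expect (prodLaw Q) (fun ω => g (ω a)) = expect (Q a) g := by
  have := expect_prodLaw_prod Q fun k s => if k = a then g s else 1
  rw [Finset.prod_eq_single a (fun k _ hk => by simp [hk, expect_const (hQ k)]) (by simp)] at this
  simpa using this

/-- Pairwise independence is all that is needed of the codebook, since the Hayashi-Nagaoka bound is
linear in the wrong tests. -/
theorem expect_prodLaw_apply₂ {Q : K → S → ℝ} (hQ : ∀ k, Q k ∈ stdSimplex ℝ S) {a b : K}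
    (hab : a ≠ b) (g : S → S → ℝ) :
    expect (prodLaw Q) (fun ω => g (ω a) (ω b))
      = expect (Q a) fun s => expect (Q b) (g s) := by
  classical
  have key : ∀ f h : S → ℝ, expect (prodLaw Q) (fun ω => f (ω a) * h (ω b))
      = expect (Q a) f * expect (Q b) h := by
    intro f h
    have := expect_prodLaw_prod Q fun k s => if k = a then f s else if k = b then h s else 1
    rw [← Finset.mul_prod_erase _ _ (Finset.mem_univ a),
      ← Finset.mul_prod_erase _ _ (Finset.mem_erase.mpr ⟨hab.symm, Finset.mem_univ b⟩),
      Finset.prod_eq_one (s := (Finset.univ.erase a).erase b) fun k hk => by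
        simp only [Finset.mem_erase] at hk
        simp [hk.1, hk.2.1, expect_const (hQ k)]] at this
    simp only [if_true, hab.symm, if_false, mul_one] at this
    rw [← this]
    congr 1; funext ω
    rw [← Finset.mul_prod_erase _ _ (Finset.mem_univ a),
      ← Finset.mul_prod_erase _ _ (Finset.mem_erase.mpr ⟨hab.symm, Finset.mem_univ b⟩),
      Finset.prod_eq_one (s := (Finset.univ.erase a).erase b) fun k hk => by
        simp only [Finset.mem_erase] at hk
        simp [hk.1, hk.2.1]]
    simp [hab.symm]
  -- Indicators of the first argument turn `g` into a sum of products, to which `key` applies.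
  have hg : ∀ s t, g s t = ∑ s', (if s = s' then 1 else 0) * g s' t := by
    intro s t; simp
  calc expect (prodLaw Q) (fun ω => g (ω a) (ω b))
      = expect (prodLaw Q) (fun ω => ∑ s', (if ω a = s' then 1 else 0) * g s' (ω b)) := by
        congr 1; funext ω; exact hg _ _
    _ = ∑ s', expect (Q a) (fun s => if s = s' then 1 else 0) * expect (Q b) (g s') := by
        rw [expect_sum]
        exact Finset.sum_congr rfl fun s' _ => key (fun s => if s = s' then 1 else 0) (g s')
    _ = _ := by
        simp [expect]

end Laws

/-! ### Random superposition codebooks -/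

section Codebook

variable {M L 𝒜 𝒰 𝒳 : Type*} [Fintype M] [DecidableEq M] [Fintype L] [DecidableEq L]
  [Fintype 𝒜] [Fintype 𝒰] [Fintype 𝒳]

/-- The random codewords of a block: `x₁(ℓ')`, `u(ℓ, ℓ')` and `x(m, ℓ, ℓ')`. -/
abbrev Codebook (M L 𝒜 𝒰 𝒳 : Type*) : Type _ :=
  (L → 𝒜) × (L × L → 𝒰) × (M × L × L → 𝒳)

/-- The law of a random codebook by superposition coding. -/
def codebookLaw (p₁ : 𝒜 → ℝ) (p₂ : 𝒜 → 𝒰 → ℝ) (p₃ : 𝒜 → 𝒰 → 𝒳 → ℝ) :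
    Codebook M L 𝒜 𝒰 𝒳 → ℝ := fun c =>
  prodLaw (fun _ => p₁) c.1 * (prodLaw (fun k : L × L => p₂ (c.1 k.2)) c.2.1
    * prodLaw (fun k : M × L × L => p₃ (c.1 k.2.2) (c.2.1 k.2)) c.2.2)

variable {p₁ : 𝒜 → ℝ} {p₂ : 𝒜 → 𝒰 → ℝ} {p₃ : 𝒜 → 𝒰 → 𝒳 → ℝ}

theorem expect_codebookLaw (F : Codebook M L 𝒜 𝒰 𝒳 → ℝ) :
    expect (codebookLaw p₁ p₂ p₃) F
      = expect (prodLaw fun _ => p₁) fun a => expect (prodLaw fun k : L × L => p₂ (a k.2)) fun u =>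
          expect (prodLaw fun k : M × L × L => p₃ (a k.2.2) (u k.2)) fun x => F (a, u, x) := by
  simp only [expect, codebookLaw, Fintype.sum_prod_type, Finset.mul_sum, mul_assoc]

variable (h₁ : p₁ ∈ stdSimplex ℝ 𝒜) (h₂ : ∀ a, p₂ a ∈ stdSimplex ℝ 𝒰)
  (h₃ : ∀ a u, p₃ a u ∈ stdSimplex ℝ 𝒳)
include h₁ h₂ h₃

theorem codebookLaw_mem :
    (codebookLaw p₁ p₂ p₃ : Codebook M L 𝒜 𝒰 𝒳 → ℝ) ∈ stdSimplex ℝ _ := by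
  refine ⟨fun c => mul_nonneg ((prodLaw_mem fun _ => h₁).1 _)
    (mul_nonneg ((prodLaw_mem fun _ => h₂ _).1 _) ((prodLaw_mem fun _ => h₃ _ _).1 _)), ?_⟩
  have := expect_codebookLaw (p₁ := p₁) (p₂ := p₂) (p₃ := p₃)
    (fun _ : Codebook M L 𝒜 𝒰 𝒳 => 1)
  simp only [expect_const (prodLaw_mem fun _ => h₃ _ _), expect_const (prodLaw_mem fun _ => h₂ _),
    expect_const (prodLaw_mem fun _ => h₁)] at this
  simpa [expect] using this

theorem expect_codebook (m : M) (l l' : L) (G : 𝒜 → 𝒰 → 𝒳 → ℝ) :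
    expect (codebookLaw p₁ p₂ p₃)
        (fun c : Codebook M L 𝒜 𝒰 𝒳 => G (c.1 l') (c.2.1 (l, l')) (c.2.2 (m, l, l')))
      = expect p₁ fun a => expect (p₂ a) fun u => expect (p₃ a u) (G a u) := by
  rw [expect_codebookLaw]
  calc _ = expect (prodLaw fun _ => p₁) fun a => expect (prodLaw fun k : L × L => p₂ (a k.2))
        fun u => expect (p₃ (a l') (u (l, l'))) (G (a l') (u (l, l'))) := by
        congr 1; funext a; congr 1; funext u
        exact expect_prodLaw_apply (fun _ => h₃ _ _) (m, l, l') (G (a l') (u (l, l')))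
    _ = expect (prodLaw fun _ => p₁) fun a => expect (p₂ (a l')) fun u =>
          expect (p₃ (a l') u) (G (a l') u) := by
        congr 1; funext a
        exact expect_prodLaw_apply (fun _ => h₂ _) (l, l')
          fun u => expect (p₃ (a l') u) (G (a l') u)
    _ = _ := expect_prodLaw_apply (fun _ => h₁) l'
          fun a => expect (p₂ a) fun u => expect (p₃ a u) (G a u)

/-- Given x₁ and u, the words of different m are independent, so a test for a wrong m meets the
state averaged over x. -/
theorem expect_codebook_source (m : M) {m₂ : M} (l l' : L) (hm : m₂ ≠ m)
    (G : 𝒜 → 𝒰 → 𝒳 → 𝒳 → ℝ) :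
    expect (codebookLaw p₁ p₂ p₃)
        (fun c : Codebook M L 𝒜 𝒰 𝒳 =>
          G (c.1 l') (c.2.1 (l, l')) (c.2.2 (m₂, l, l')) (c.2.2 (m, l, l')))
      = expect p₁ fun a => expect (p₂ a) fun u => expect (p₃ a u) fun x =>
          expect (p₃ a u) (G a u x) := by
  rw [expect_codebookLaw]
  calc _ = expect (prodLaw fun _ => p₁) fun a => expect (prodLaw fun k : L × L => p₂ (a k.2))
        fun u => expect (p₃ (a l') (u (l, l'))) fun x =>
          expect (p₃ (a l') (u (l, l'))) (G (a l') (u (l, l')) x) := by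
        congr 1; funext a; congr 1; funext u
        exact expect_prodLaw_apply₂ (Q := fun k : M × L × L => p₃ (a k.2.2) (u k.2))
          (fun _ => h₃ _ _) (a := (m₂, l, l')) (b := (m, l, l')) (by simpa using hm)
          (G (a l') (u (l, l')))
    _ = expect (prodLaw fun _ => p₁) fun a => expect (p₂ (a l')) fun u =>
          expect (p₃ (a l') u) fun x => expect (p₃ (a l') u) (G (a l') u x) := by
        congr 1; funext a
        exact expect_prodLaw_apply (fun _ => h₂ _) (l, l')
          fun u => expect (p₃ (a l') u) fun x => expect (p₃ (a l') u) (G (a l') u x)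
    _ = _ := expect_prodLaw_apply (fun _ => h₁) l'
          fun a => expect (p₂ a) fun u => expect (p₃ a u) fun x => expect (p₃ a u) (G a u x)

/-- Given x₁ alone, the word u of a wrong ℓ is independent of the transmitted u and x, so its test
meets the state averaged over both. -/
theorem expect_codebook_cloud (m : M) {l l₂ : L} (l' : L) (hl : l₂ ≠ l)
    (G : 𝒜 → 𝒰 → 𝒰 → 𝒳 → ℝ) :
    expect (codebookLaw p₁ p₂ p₃)
        (fun c : Codebook M L 𝒜 𝒰 𝒳 =>
          G (c.1 l') (c.2.1 (l₂, l')) (c.2.1 (l, l')) (c.2.2 (m, l, l')))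
      = expect p₁ fun a => expect (p₂ a) fun v => expect (p₂ a) fun u =>
          expect (p₃ a u) (G a v u) := by
  rw [expect_codebookLaw]
  calc _ = expect (prodLaw fun _ => p₁) fun a => expect (prodLaw fun k : L × L => p₂ (a k.2))
        fun u => expect (p₃ (a l') (u (l, l'))) (G (a l') (u (l₂, l')) (u (l, l'))) := by
        congr 1; funext a; congr 1; funext u
        exact expect_prodLaw_apply (fun _ => h₃ _ _) (m, l, l')
          (G (a l') (u (l₂, l')) (u (l, l')))
    _ = expect (prodLaw fun _ => p₁) fun a => expect (p₂ (a l')) fun v => expect (p₂ (a l'))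
          fun u => expect (p₃ (a l') u) (G (a l') v u) := by
        congr 1; funext a
        exact expect_prodLaw_apply₂ (Q := fun k : L × L => p₂ (a k.2)) (fun _ => h₂ _)
          (a := (l₂, l')) (b := (l, l')) (by simpa using hl)
          fun v u => expect (p₃ (a l') u) (G (a l') v u)
    _ = _ := expect_prodLaw_apply (fun _ => h₁) l'
          fun a => expect (p₂ a) fun v => expect (p₂ a) fun u => expect (p₃ a u) (G a v u)

/-- In the next block ℓ is carried by the relay's word, and a wrong one is independent of everything
sent, so its test meets the mean state. -/
theorem expect_codebook_relay (m : M) {l l₂ : L} (k : L) (hl : l₂ ≠ l)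
    (G : 𝒜 → 𝒜 → 𝒳 → ℝ) :
    expect (codebookLaw p₁ p₂ p₃)
        (fun c : Codebook M L 𝒜 𝒰 𝒳 => G (c.1 l₂) (c.1 l) (c.2.2 (m, k, l)))
      = expect p₁ fun a₂ => expect p₁ fun a => expect (p₂ a) fun u =>
          expect (p₃ a u) (G a₂ a) := by
  rw [expect_codebookLaw]
  calc _ = expect (prodLaw fun _ => p₁) fun a => expect (prodLaw fun k : L × L => p₂ (a k.2))
        fun u => expect (p₃ (a l) (u (k, l))) (G (a l₂) (a l)) := by
        congr 1; funext a; congr 1; funext u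
        exact expect_prodLaw_apply (fun _ => h₃ _ _) (m, k, l) (G (a l₂) (a l))
    _ = expect (prodLaw fun _ => p₁) fun a => expect (p₂ (a l)) fun u =>
          expect (p₃ (a l) u) (G (a l₂) (a l)) := by
        congr 1; funext a
        exact expect_prodLaw_apply (fun _ => h₂ _) (k, l)
          fun u => expect (p₃ (a l) u) (G (a l₂) (a l))
    _ = _ := expect_prodLaw_apply₂ (fun _ => h₁) hl
          fun a₂ a => expect (p₂ a) fun u => expect (p₃ a u) (G a₂ a)

end Codebook

/-! ### The error of a random code in terms of its tests -/

section Packing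

/-- The probability that the outcome of the effect `Λ` does not occur. -/
def failure {ι : Type*} [Fintype ι] [DecidableEq ι] (Λ ρ : Matrix ι ι ℂ) : ℝ :=
  ((1 - Λ) * ρ).trace.re

theorem failure_mix {ι Ω : Type*} [Fintype ι] [DecidableEq ι] [Fintype Ω] (k : Ω → ℝ)
    (A : Ω → Matrix ι ι ℂ) (Λ : Matrix ι ι ℂ) :
    failure Λ (mix k A) = expect k fun ω => failure Λ (A ω) :=
  re_trace_mul_mix k A _

variable {ι : Type*} [Fintype ι] [DecidableEq ι]

theorem failure_povm_le {κ : Type*} [Fintype κ] [DecidableEq κ] {Λ : POVM κ ι}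
    {T : κ → Matrix ι ι ℂ} {η : ℝ} {k : κ}
    (hΛ : ((2 : ℂ) • (1 - T k) + (4 : ℂ) • (∑ l ∈ Finset.univ.erase k, T l + (η : ℂ) • 1)
        - (1 - Λ.op k)).PosSemidef)
    {ρ : Matrix ι ι ℂ} (hρ : ρ.PosSemidef) (hρ1 : ρ.trace = 1) :
    failure (Λ.op k) ρ ≤ 2 * failure (T k) ρ
      + 4 * (∑ l ∈ Finset.univ.erase k, (T l * ρ).trace.re + η) := by
  refine (re_trace_mul_le_left hΛ hρ).trans_eq ?_
  rw [Matrix.add_mul, Matrix.smul_mul, Matrix.smul_mul, Matrix.add_mul, Matrix.smul_mul,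
    Matrix.one_mul, Finset.sum_mul, Matrix.trace_add, Matrix.trace_smul, Matrix.trace_smul,
    Matrix.trace_add, Matrix.trace_smul, hρ1, Matrix.trace_sum, failure]
  simp

/-- The average error of a random code in terms of its tests. -/
theorem expect_failure_le {Ω κ : Type*} [Fintype Ω] [Fintype κ] [DecidableEq κ] {μ : Ω → ℝ}
    (hμ : μ ∈ stdSimplex ℝ Ω) {T : Ω → κ → Matrix ι ι ℂ} (hT : ∀ ω k, IsProj (T ω k))
    {η : ℝ} {Λ : Ω → POVM κ ι} {k : κ}
    (hΛ : ∀ ω, ((2 : ℂ) • (1 - T ω k)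
      + (4 : ℂ) • (∑ l ∈ Finset.univ.erase k, T ω l + (η : ℂ) • 1)
        - (1 - (Λ ω).op k)).PosSemidef)
    {ρ : Ω → Matrix ι ι ℂ} (hρ : ∀ ω, (ρ ω).PosSemidef) (hρ1 : ∀ ω, (ρ ω).trace = 1)
    {α β γ : ℝ} (hα : expect μ (fun ω => failure (T ω k) (ρ ω)) = α)
    (hβ : ∀ l, l ≠ k → expect μ (fun ω => (T ω l * ρ ω).trace.re) = β)
    (hγ : α + (Fintype.card κ - 1) * β ≤ γ) :
    expect μ (fun ω => failure ((Λ ω).op k) (ρ ω)) ≤ 4 * (γ + η) := by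
  -- Nonnegativity of α lets its Hayashi-Nagaoka coefficient 2 be raised to the common value 4.
  have h0 : 0 ≤ α := hα ▸ expect_nonneg hμ.1 fun ω =>
    re_trace_mul_nonneg (hT ω k).one_sub.posSemidef (hρ ω)
  have h1 := expect_mono hμ.1 fun ω => failure_povm_le (hΛ ω) (hρ ω) (hρ1 ω)
  have h2 : ∑ l ∈ Finset.univ.erase k, expect μ (fun ω => (T ω l * ρ ω).trace.re)
      = (Fintype.card κ - 1) * β := by
    rw [Finset.sum_congr rfl fun l hl => hβ l (Finset.ne_of_mem_erase hl), Finset.sum_const,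
      Finset.card_erase_of_mem (Finset.mem_univ k), Finset.card_univ, nsmul_eq_mul,
      Nat.cast_sub (Fintype.card_pos_iff.mpr ⟨k⟩), Nat.cast_one]
  simp only [expect_add, expect_mul_left, expect_sum, expect_const hμ, h2, hα] at h1
  linarith

/-- The Chernoff bound for A against c B; below, c is the number of wrong messages, so that the
union bound over them is built into the test. -/
theorem exists_test_mul {A B : Matrix ι ι ℂ} (hA : A.PosSemidef) (hB : B.PosSemidef) {s : ℝ}
    (hs : s ∈ Set.Ioo (0 : ℝ) 1) {c : ℝ} (hc : 0 ≤ c) :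
    ∃ T : Matrix ι ι ℂ, IsProj T ∧
      failure T A + c * (T * B).trace.re ≤ c ^ s * chernoff A B s := by
  obtain ⟨T, hT, h⟩ := exists_test hA (hB.smul (a := (c : ℂ)) (by exact_mod_cast hc)) hs.1 hs.2
  refine ⟨T, hT, ?_⟩
  rw [Matrix.mul_smul, Matrix.trace_smul, smul_eq_mul, Complex.re_ofReal_mul] at h
  exact h.trans_eq (chernoff_smul hB hc s)

theorem card_sub_one_nonneg (M : Type*) [Fintype M] [Nonempty M] :
    (0 : ℝ) ≤ Fintype.card M - 1 :=
  sub_nonneg.mpr (by exact_mod_cast Fintype.card_pos)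

end Packing

/-! ### The three decoders: relay, two-block window, source word -/

section Decoders
open scoped Kronecker

variable {M L 𝒜 𝒰 𝒳 ι : Type*} [Fintype M] [DecidableEq M] [Fintype L] [DecidableEq L]
  [Nonempty M] [Nonempty L] [Fintype 𝒜] [Fintype 𝒰] [Fintype 𝒳] [Fintype ι] [DecidableEq ι]
  {p₁ : 𝒜 → ℝ} {p₂ : 𝒜 → 𝒰 → ℝ} {p₃ : 𝒜 → 𝒰 → 𝒳 → ℝ}
  (h₁ : p₁ ∈ stdSimplex ℝ 𝒜) (h₂ : ∀ a, p₂ a ∈ stdSimplex ℝ 𝒰)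
  (h₃ : ∀ a u, p₃ a u ∈ stdSimplex ℝ 𝒳)
  {σ : 𝒜 → 𝒳 → Matrix ι ι ℂ} (hσ : ∀ a x, (σ a x).PosSemidef) (hσ1 : ∀ a x, (σ a x).trace = 1)
  {s η : ℝ} (hs : s ∈ Set.Ioo (0 : ℝ) 1) (hη : 0 < η)

/-- The state given the codewords `x₁` and `u`. -/
abbrev cloudState (p₃ : 𝒜 → 𝒰 → 𝒳 → ℝ) (σ : 𝒜 → 𝒳 → Matrix ι ι ℂ) (a : 𝒜) (u : 𝒰) :
    Matrix ι ι ℂ := mix (p₃ a u) (σ a)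

/-- The state given the codeword `x₁`. -/
abbrev relayWordState (p₂ : 𝒜 → 𝒰 → ℝ) (p₃ : 𝒜 → 𝒰 → 𝒳 → ℝ) (σ : 𝒜 → 𝒳 → Matrix ι ι ℂ)
    (a : 𝒜) : Matrix ι ι ℂ := mix (p₂ a) (cloudState p₃ σ a)

/-- The average state. -/
abbrev meanState (p₁ : 𝒜 → ℝ) (p₂ : 𝒜 → 𝒰 → ℝ) (p₃ : 𝒜 → 𝒰 → 𝒳 → ℝ)
    (σ : 𝒜 → 𝒳 → Matrix ι ι ℂ) : Matrix ι ι ℂ := mix p₁ (relayWordState p₂ p₃ σ)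

variable (p₁ p₂ p₃ σ) in
/-- The Chernoff function of `u` given `x₁`. -/
def cloudChernoff (s : ℝ) : ℝ :=
  expect p₁ fun a => expect (p₂ a) fun u =>
    chernoff (cloudState p₃ σ a u) (relayWordState p₂ p₃ σ a) s

variable (p₁ p₂ p₃ σ) in
/-- The Chernoff function of `x` given `x₁` and `u`. -/
def sourceChernoff (s : ℝ) : ℝ :=
  expect p₁ fun a => expect (p₂ a) fun u => expect (p₃ a u) fun x =>
    chernoff (σ a x) (cloudState p₃ σ a u) s

variable (p₁ p₂ p₃ σ) in
/-- The Chernoff function of `x₁`. -/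
def relayWordChernoff (s : ℝ) : ℝ :=
  expect p₁ fun a => chernoff (relayWordState p₂ p₃ σ a) (meanState p₁ p₂ p₃ σ) s

include h₁ h₂ h₃ hσ hσ1 hs hη

-- The tests depend on x₁ and u only, so the state for the right ℓ is averaged over x and the state
-- seen by a wrong one over u as well. The decoder is applied below to the relay's output.
omit [Nonempty M] in
theorem exists_cloud_decoder :
    ∃ Γ : Codebook M L 𝒜 𝒰 𝒳 → L → POVM L ι, ∀ m l l',
      expect (codebookLaw p₁ p₂ p₃)
        (fun c => failure ((Γ c l').op l) (σ (c.1 l') (c.2.2 (m, l, l'))))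
      ≤ 4 * ((Fintype.card L - 1 : ℝ) ^ s * cloudChernoff p₁ p₂ p₃ σ s + η) := by
  have hA : ∀ a u, (cloudState p₃ σ a u).PosSemidef := fun a u =>
    mix_posSemidef (h₃ a u).1 (hσ a)
  have hB : ∀ a, (relayWordState p₂ p₃ σ a).PosSemidef := fun a =>
    mix_posSemidef (h₂ a).1 (hA a)
  choose T hT hT1 using fun a u =>
    exists_test_mul (hA a u) (hB a) hs (card_sub_one_nonneg L)
  choose Γ hΓ using fun (c : Codebook M L 𝒜 𝒰 𝒳) (l' : L) =>
    exists_povm (fun l => T (c.1 l') (c.2.1 (l, l'))) (fun l => hT _ _) hη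
  refine ⟨Γ, fun m l l' => ?_⟩
  refine expect_failure_le (codebookLaw_mem h₁ h₂ h₃)
    (T := fun c l => T (c.1 l') (c.2.1 (l, l'))) (fun c l => hT _ _)
    (fun c => hΓ c l' l) (fun c => hσ _ _) (fun c => hσ1 _ _)
    (expect_codebook h₁ h₂ h₃ m l l' fun a u x => failure (T a u) (σ a x))
    (fun l₂ hl => expect_codebook_cloud h₁ h₂ h₃ m l' hl
      fun a v u x => (T a v * σ a x).trace.re) ?_
  simp only [← failure_mix, ← re_trace_mul_mix, cloudChernoff, ← expect_mul_left, ← expect_add]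
  exact expect_mono h₁.1 fun a => expect_mono (h₂ a).1 fun u => hT1 a u

-- The second stage of the destination: with ℓ and ℓ' known, only the word x is uncertain, and wrong
-- words see the average over x.
omit [Nonempty L] in
theorem exists_source_decoder :
    ∃ Λ : Codebook M L 𝒜 𝒰 𝒳 → L → L → POVM M ι, ∀ m l l',
      expect (codebookLaw p₁ p₂ p₃)
        (fun c => failure ((Λ c l' l).op m) (σ (c.1 l') (c.2.2 (m, l, l'))))
      ≤ 4 * ((Fintype.card M - 1 : ℝ) ^ s * sourceChernoff p₁ p₂ p₃ σ s + η) := by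
  have hA : ∀ a u, (cloudState p₃ σ a u).PosSemidef := fun a u =>
    mix_posSemidef (h₃ a u).1 (hσ a)
  choose T hT hT1 using fun a u x =>
    exists_test_mul (hσ a x) (hA a u) hs (card_sub_one_nonneg M)
  choose Γ hΓ using fun (c : Codebook M L 𝒜 𝒰 𝒳) (l' l : L) =>
    exists_povm (fun m => T (c.1 l') (c.2.1 (l, l')) (c.2.2 (m, l, l'))) (fun l => hT _ _ _) hη
  refine ⟨Γ, fun m l l' => ?_⟩
  refine expect_failure_le (codebookLaw_mem h₁ h₂ h₃)
    (T := fun c m => T (c.1 l') (c.2.1 (l, l')) (c.2.2 (m, l, l'))) (fun c l => hT _ _ _)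
    (fun c => hΓ c l' l m) (fun c => hσ _ _) (fun c => hσ1 _ _)
    (expect_codebook h₁ h₂ h₃ m l l' fun a u x => failure (T a u x) (σ a x))
    (fun m₂ hm => expect_codebook_source h₁ h₂ h₃ m l l' hm
      fun a u y x => (T a u y * σ a x).trace.re) ?_
  simp only [← re_trace_mul_mix, sourceChernoff, ← expect_mul_left, ← expect_add]
  exact expect_mono h₁.1 fun a => expect_mono (h₂ a).1 fun u => expect_mono (h₃ a u).1 fun x =>
    hT1 a u x

-- The codebooks `c` and `c'` belong to consecutive blocks. The right ℓ fits in both factors, giving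
-- cloud state ⊗ relay-word state on average; for a wrong ℓ both factors decouple, giving relay-word
-- state ⊗ mean state. The Chernoff quantity then factors, which is why the informations of the two
-- blocks add.
omit [Nonempty M] in
theorem exists_window_decoder :
    ∃ Λ : Codebook M L 𝒜 𝒰 𝒳 → Codebook M L 𝒜 𝒰 𝒳 → L → POVM L (ι × ι), ∀ m l l' m' k,
      expect (codebookLaw p₁ p₂ p₃) (fun c => expect (codebookLaw p₁ p₂ p₃)
        (fun c' => failure ((Λ c c' l').op l)
          (σ (c.1 l') (c.2.2 (m, l, l')) ⊗ₖ σ (c'.1 l) (c'.2.2 (m', k, l)))))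
      ≤ 4 * ((Fintype.card L - 1 : ℝ) ^ s
          * (cloudChernoff p₁ p₂ p₃ σ s * relayWordChernoff p₁ p₂ p₃ σ s) + η) := by
  have hA : ∀ a u, (cloudState p₃ σ a u).PosSemidef := fun a u =>
    mix_posSemidef (h₃ a u).1 (hσ a)
  have hB : ∀ a, (relayWordState p₂ p₃ σ a).PosSemidef := fun a =>
    mix_posSemidef (h₂ a).1 (hA a)
  have hC : (meanState p₁ p₂ p₃ σ).PosSemidef := mix_posSemidef h₁.1 hB
  choose T hT hT1 using fun a u a' =>
    exists_test_mul ((hA a u).kronecker (hB a')) ((hB a).kronecker hC) hs (card_sub_one_nonneg L)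
  choose Γ hΓ using fun (c c' : Codebook M L 𝒜 𝒰 𝒳) (l' : L) =>
    exists_povm (fun l => T (c.1 l') (c.2.1 (l, l')) (c'.1 l)) (fun l => hT _ _ _) hη
  have hμ : (codebookLaw p₁ p₂ p₃ : Codebook M L 𝒜 𝒰 𝒳 → ℝ) ∈ stdSimplex ℝ _ :=
    codebookLaw_mem h₁ h₂ h₃
  refine ⟨Γ, fun m l l' m' k => ?_⟩
  set μ : Codebook M L 𝒜 𝒰 𝒳 → ℝ := codebookLaw p₁ p₂ p₃ with hμdef
  have hpair : ∀ F : Codebook M L 𝒜 𝒰 𝒳 → Codebook M L 𝒜 𝒰 𝒳 → ℝ,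
      expect (fun q : Codebook M L 𝒜 𝒰 𝒳 × Codebook M L 𝒜 𝒰 𝒳 => μ q.1 * μ q.2)
        (fun q => F q.1 q.2) = expect μ fun c => expect μ (F c) := by
    intro F
    simp only [expect, Fintype.sum_prod_type, Finset.mul_sum, mul_assoc]
  have hμμ : (fun q : Codebook M L 𝒜 𝒰 𝒳 × Codebook M L 𝒜 𝒰 𝒳 => μ q.1 * μ q.2)
      ∈ stdSimplex ℝ _ := by
    refine ⟨fun q => mul_nonneg (hμ.1 _) (hμ.1 _), ?_⟩
    have := hpair fun _ _ => 1
    simp only [expect_const hμ] at this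
    simpa [expect] using this
  have htr : ∀ a x a' x', (σ a x ⊗ₖ σ a' x').trace = 1 := fun a x a' x' => by
    rw [trace_kronecker, hσ1, hσ1, one_mul]
  rw [← hpair]
  refine expect_failure_le hμμ
    (T := fun q l => T (q.1.1 l') (q.1.2.1 (l, l')) (q.2.1 l)) (fun c l => hT _ _ _)
    (fun q => hΓ q.1 q.2 l' l) (fun c => (hσ _ _).kronecker (hσ _ _)) (fun c => htr _ _ _ _)
    (α := expect p₁ fun a => expect (p₂ a) fun u => expect p₁ fun a' =>
      failure (T a u a') (cloudState p₃ σ a u ⊗ₖ relayWordState p₂ p₃ σ a'))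
    (β := expect p₁ fun a => expect (p₂ a) fun u => expect p₁ fun a' =>
      (T a u a' * (relayWordState p₂ p₃ σ a ⊗ₖ meanState p₁ p₂ p₃ σ)).trace.re) ?_ ?_ ?_
  · rw [hpair fun c c' => failure (T (c.1 l') (c.2.1 (l, l')) (c'.1 l))
      (σ (c.1 l') (c.2.2 (m, l, l')) ⊗ₖ σ (c'.1 l) (c'.2.2 (m', k, l)))]
    have e1 : ∀ c : Codebook M L 𝒜 𝒰 𝒳, expect μ (fun c' =>
        failure (T (c.1 l') (c.2.1 (l, l')) (c'.1 l))
          (σ (c.1 l') (c.2.2 (m, l, l')) ⊗ₖ σ (c'.1 l) (c'.2.2 (m', k, l))))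
        = expect p₁ fun a' => failure (T (c.1 l') (c.2.1 (l, l')) a')
          (σ (c.1 l') (c.2.2 (m, l, l')) ⊗ₖ relayWordState p₂ p₃ σ a') := by
      intro c
      rw [expect_codebook h₁ h₂ h₃ m' k l fun a' _ x' => failure (T (c.1 l') (c.2.1 (l, l')) a')
          (σ (c.1 l') (c.2.2 (m, l, l')) ⊗ₖ σ a' x')]
      simp only [← failure_mix, ← kronecker_mix]
    simp only [e1]
    rw [expect_codebook h₁ h₂ h₃ m l l' fun a u x => expect p₁ fun a' => failure (T a u a')
          (σ a x ⊗ₖ relayWordState p₂ p₃ σ a')]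
    congr 1; funext a; congr 1; funext u
    rw [expect_comm]
    simp only [← failure_mix, ← mix_kronecker]
  · intro l₂ hl
    rw [hpair fun c c' => (T (c.1 l') (c.2.1 (l₂, l')) (c'.1 l₂) *
      (σ (c.1 l') (c.2.2 (m, l, l')) ⊗ₖ σ (c'.1 l) (c'.2.2 (m', k, l)))).trace.re]
    have e1 : ∀ c : Codebook M L 𝒜 𝒰 𝒳, expect μ (fun c' =>
        (T (c.1 l') (c.2.1 (l₂, l')) (c'.1 l₂)
          * (σ (c.1 l') (c.2.2 (m, l, l')) ⊗ₖ σ (c'.1 l) (c'.2.2 (m', k, l)))).trace.re)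
        = expect p₁ fun a' => (T (c.1 l') (c.2.1 (l₂, l')) a'
          * (σ (c.1 l') (c.2.2 (m, l, l')) ⊗ₖ meanState p₁ p₂ p₃ σ)).trace.re := by
      intro c
      rw [expect_codebook_relay h₁ h₂ h₃ m' k hl fun a₂ a' x' =>
        (T (c.1 l') (c.2.1 (l₂, l')) a₂
          * (σ (c.1 l') (c.2.2 (m, l, l')) ⊗ₖ σ a' x')).trace.re]
      simp only [← re_trace_mul_mix, ← kronecker_mix]
    simp only [e1]
    rw [expect_codebook_cloud h₁ h₂ h₃ m l' hl fun a v _ x => expect p₁ fun a' =>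
      (T a v a' * (σ a x ⊗ₖ meanState p₁ p₂ p₃ σ)).trace.re]
    congr 1; funext a; congr 1; funext v
    simp only [expect_comm (μ' := p₁)]
    simp only [← re_trace_mul_mix, ← mix_kronecker]
  · have e2 : (Fintype.card L - 1 : ℝ) ^ s
          * (cloudChernoff p₁ p₂ p₃ σ s * relayWordChernoff p₁ p₂ p₃ σ s)
        = expect p₁ fun a => expect (p₂ a) fun u => expect p₁ fun a' =>
          (Fintype.card L - 1 : ℝ) ^ s * chernoff (cloudState p₃ σ a u ⊗ₖ relayWordState p₂ p₃ σ a')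
            (relayWordState p₂ p₃ σ a ⊗ₖ meanState p₁ p₂ p₃ σ) s := by
      simp only [chernoff_kronecker (hA _ _) (hB _) (hB _) hC, expect_mul_left, cloudChernoff]
      congr 1
      change _ = expect p₁ fun a => expect (p₂ a) fun u =>
        chernoff (cloudState p₃ σ a u) (relayWordState p₂ p₃ σ a) s
          * relayWordChernoff p₁ p₂ p₃ σ s
      simp only [mul_comm _ (relayWordChernoff p₁ p₂ p₃ σ s), expect_mul_left]
    rw [e2]
    simp only [← expect_mul_left, ← expect_add]
    exact expect_mono h₁.1 fun a => expect_mono (h₂ a).1 fun u => expect_mono h₁.1 fun a' =>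
      hT1 a u a'

end Decoders

/-! ### One codebook for all blocks and messages -/

section Blocks
open scoped Kronecker

variable {M L 𝒜 𝒰 𝒳 ι κ : Type*} [Fintype M] [DecidableEq M] [Fintype L] [DecidableEq L]
  [Nonempty M] [Nonempty L] [Fintype 𝒜] [Fintype 𝒰] [Fintype 𝒳] [Fintype ι] [DecidableEq ι]
  [Fintype κ] [DecidableEq κ]
  {p₁ : 𝒜 → ℝ} {p₂ : 𝒜 → 𝒰 → ℝ} {p₃ : 𝒜 → 𝒰 → 𝒳 → ℝ}

/-- Codewords and decoders for all the blocks of a superposition code, with small average errors.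
The decoder of the destination first finds `ℓ` and then `m`. -/
theorem exists_blocks
    (h₁ : p₁ ∈ stdSimplex ℝ 𝒜) (h₂ : ∀ a, p₂ a ∈ stdSimplex ℝ 𝒰)
    (h₃ : ∀ a u, p₃ a u ∈ stdSimplex ℝ 𝒳)
    {τ : 𝒜 → 𝒳 → Matrix κ κ ℂ} (hτ : ∀ a x, (τ a x).PosSemidef) (hτ1 : ∀ a x, (τ a x).trace = 1)
    {σ : 𝒜 → 𝒳 → Matrix ι ι ℂ} (hσ : ∀ a x, (σ a x).PosSemidef) (hσ1 : ∀ a x, (σ a x).trace = 1)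
    {r s t η : ℝ} (hr : r ∈ Set.Ioo (0 : ℝ) 1) (hs : s ∈ Set.Ioo (0 : ℝ) 1)
    (ht : t ∈ Set.Ioo (0 : ℝ) 1) (hη : 0 < η) {ε : ℝ}
    (hτε : (Fintype.card L - 1 : ℝ) ^ r * cloudChernoff p₁ p₂ p₃ τ r ≤ ε)
    (hσε : (Fintype.card L - 1 : ℝ) ^ s
      * (cloudChernoff p₁ p₂ p₃ σ s * relayWordChernoff p₁ p₂ p₃ σ s) ≤ ε)
    (hσε' : (Fintype.card M - 1 : ℝ) ^ t * sourceChernoff p₁ p₂ p₃ σ t ≤ ε)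
    {b : ℕ} {W : Type*} [Fintype W] (cur : W → Fin (b + 1) → M × L) (prev : W → Fin (b + 1) → L)
    (hprev : ∀ w (j : Fin b), prev w j.succ = (cur w j.castSucc).2) :
    ∃ (a : Fin (b + 1) → L → 𝒜) (x : Fin (b + 1) → M → L → L → 𝒳)
      (Γ : Fin b → L → POVM L κ) (Λ : Fin b → L → POVM L (ι × ι)) (Δ : Fin b → L → L → POVM M ι),
      ∑ w, ∑ j : Fin b,
        (failure ((Γ j (prev w j.castSucc)).op (cur w j.castSucc).2)
            (τ (a j.castSucc (prev w j.castSucc))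
              (x j.castSucc (cur w j.castSucc).1 (cur w j.castSucc).2 (prev w j.castSucc)))
          + failure ((Λ j (prev w j.castSucc)).op (cur w j.castSucc).2)
            (σ (a j.castSucc (prev w j.castSucc))
                (x j.castSucc (cur w j.castSucc).1 (cur w j.castSucc).2 (prev w j.castSucc))
              ⊗ₖ σ (a j.succ (prev w j.succ))
                (x j.succ (cur w j.succ).1 (cur w j.succ).2 (prev w j.succ)))
          + failure ((Δ j (prev w j.castSucc) (cur w j.castSucc).2).op (cur w j.castSucc).1)
            (σ (a j.castSucc (prev w j.castSucc))
              (x j.castSucc (cur w j.castSucc).1 (cur w j.castSucc).2 (prev w j.castSucc))))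
        ≤ Fintype.card W * (b * (12 * (ε + η))) := by
  obtain ⟨Γ, hΓ⟩ := exists_cloud_decoder (M := M) (L := L) h₁ h₂ h₃ hτ hτ1 hr hη
  obtain ⟨Λ, hΛ⟩ := exists_window_decoder (M := M) (L := L) h₁ h₂ h₃ hσ hσ1 hs hη
  obtain ⟨Δ, hΔ⟩ := exists_source_decoder (M := M) (L := L) h₁ h₂ h₃ hσ hσ1 ht hη
  have hμ : (codebookLaw p₁ p₂ p₃ : Codebook M L 𝒜 𝒰 𝒳 → ℝ) ∈ stdSimplex ℝ _ :=
    codebookLaw_mem h₁ h₂ h₃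
  let Q : Fin (b + 1) → Codebook M L 𝒜 𝒰 𝒳 → ℝ := fun _ => codebookLaw p₁ p₂ p₃
  have hQ : ∀ j, Q j ∈ stdSimplex ℝ _ := fun _ => hμ
  let F : (Fin (b + 1) → Codebook M L 𝒜 𝒰 𝒳) → ℝ := fun ω => ∑ w, ∑ j : Fin b,
        (failure ((Γ (ω j.castSucc) (prev w j.castSucc)).op (cur w j.castSucc).2)
            (τ ((ω j.castSucc).1 (prev w j.castSucc))
              ((ω j.castSucc).2.2
                ((cur w j.castSucc).1, (cur w j.castSucc).2, prev w j.castSucc)))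
          + failure ((Λ (ω j.castSucc) (ω j.succ) (prev w j.castSucc)).op (cur w j.castSucc).2)
            (σ ((ω j.castSucc).1 (prev w j.castSucc))
                ((ω j.castSucc).2.2
                  ((cur w j.castSucc).1, (cur w j.castSucc).2, prev w j.castSucc))
              ⊗ₖ σ ((ω j.succ).1 (cur w j.castSucc).2)
                ((ω j.succ).2.2 ((cur w j.succ).1, (cur w j.succ).2, (cur w j.castSucc).2)))
          + failure ((Δ (ω j.castSucc) (prev w j.castSucc) (cur w j.castSucc).2).op
              (cur w j.castSucc).1)
            (σ ((ω j.castSucc).1 (prev w j.castSucc))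
              ((ω j.castSucc).2.2
                ((cur w j.castSucc).1, (cur w j.castSucc).2, prev w j.castSucc))))
  obtain ⟨ω, hω⟩ := exists_le_expect (prodLaw_mem hQ) F
  refine ⟨fun j => (ω j).1, fun j m l l' => (ω j).2.2 (m, l, l'), fun j => Γ (ω j.castSucc),
    fun j => Λ (ω j.castSucc) (ω j.succ), fun j => Δ (ω j.castSucc), ?_⟩
  -- The relay's word in block j+1 carries the ℓ that is decoded from block j; the window decoder
  -- relies on this match.
  simp only [hprev]
  refine hω.trans ?_
  simp only [F, expect_sum, expect_add]
  rw [← Finset.card_univ, ← nsmul_eq_mul]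
  refine Finset.sum_le_card_nsmul _ _ _ fun w _ => ?_
  have hb : (b : ℝ) * (12 * (ε + η)) = (Finset.univ : Finset (Fin b)).card • (12 * (ε + η)) := by
    simp
  rw [hb]
  refine Finset.sum_le_card_nsmul _ _ _ fun j _ => ?_
  have hj : j.castSucc ≠ j.succ := j.castSucc_lt_succ.ne
  have e1 := (expect_prodLaw_apply hQ j.castSucc fun c =>
    failure ((Γ c (prev w j.castSucc)).op (cur w j.castSucc).2)
      (τ (c.1 (prev w j.castSucc))
        (c.2.2 ((cur w j.castSucc).1, (cur w j.castSucc).2, prev w j.castSucc)))).trans_le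
    (hΓ _ _ _)
  have e2 := (expect_prodLaw_apply₂ hQ hj fun c c' =>
    failure ((Λ c c' (prev w j.castSucc)).op (cur w j.castSucc).2)
      (σ (c.1 (prev w j.castSucc))
          (c.2.2 ((cur w j.castSucc).1, (cur w j.castSucc).2, prev w j.castSucc))
        ⊗ₖ σ (c'.1 (cur w j.castSucc).2)
          (c'.2.2 ((cur w j.succ).1, (cur w j.succ).2, (cur w j.castSucc).2)))).trans_le
    (hΛ _ _ _ _ _)
  have e3 := (expect_prodLaw_apply hQ j.castSucc fun c =>
    failure ((Δ c (prev w j.castSucc) (cur w j.castSucc).2).op (cur w j.castSucc).1)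
      (σ (c.1 (prev w j.castSucc))
        (c.2.2 ((cur w j.castSucc).1, (cur w j.castSucc).2, prev w j.castSucc)))).trans_le
    (hΔ _ _ _)
  -- Each of the three decoders contributes 4(ε + η).
  linarith

end Blocks

/-! ### Gentle measurement in Hilbert-Schmidt norm -/

section Gentle

variable {ι κ : Type*} [Fintype ι] [Fintype κ]

/-- The Hilbert-Schmidt norm. -/
def hsNorm (A : Matrix ι κ ℂ) : ℝ := √(Aᴴ * A).trace.re

theorem re_trace_conjTranspose_mul_self (A : Matrix ι κ ℂ) :
    (Aᴴ * A).trace.re = ∑ k : κ × ι, ‖A k.2 k.1‖ ^ 2 := by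
  rw [Matrix.trace, Complex.re_sum, Fintype.sum_prod_type]
  refine Finset.sum_congr rfl fun i _ => ?_
  rw [diag_apply, Matrix.mul_apply, Complex.re_sum]
  refine Finset.sum_congr rfl fun j _ => ?_
  rw [conjTranspose_apply, Complex.star_def, mul_comm, Complex.mul_conj, Complex.ofReal_re,
    Complex.normSq_eq_norm_sq]

theorem hsNorm_eq (A : Matrix ι κ ℂ) :
    hsNorm A = ‖WithLp.toLp 2 (fun k : κ × ι => A k.2 k.1)‖ := by
  rw [hsNorm, re_trace_conjTranspose_mul_self, EuclideanSpace.norm_eq]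

theorem hsNorm_add_le (A C : Matrix ι κ ℂ) : hsNorm (A + C) ≤ hsNorm A + hsNorm C := by
  rw [hsNorm_eq, hsNorm_eq, hsNorm_eq]
  exact norm_add_le (WithLp.toLp 2 (fun k : κ × ι => A k.2 k.1))
    (WithLp.toLp 2 (fun k : κ × ι => C k.2 k.1))

theorem hsNorm_sq (A : Matrix ι κ ℂ) : hsNorm A ^ 2 = (Aᴴ * A).trace.re := by
  rw [hsNorm, Real.sq_sqrt]
  rw [re_trace_conjTranspose_mul_self]
  positivity

variable [DecidableEq ι]

/-- A contraction. -/
def IsContraction (K : Matrix ι ι ℂ) : Prop := (1 - Kᴴ * K).PosSemidef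

theorem IsContraction.hsNorm_mul_le {K : Matrix ι ι ℂ} (hK : IsContraction K) (A : Matrix ι κ ℂ) :
    hsNorm (K * A) ≤ hsNorm A := by
  classical
  refine Real.sqrt_le_sqrt ?_
  have h := re_trace_nonneg (hK.conjTranspose_mul_mul_same A)
  rw [Matrix.mul_sub, Matrix.sub_mul, Matrix.mul_one, Matrix.trace_sub, Complex.sub_re] at h
  rw [conjTranspose_mul, Matrix.mul_assoc, ← Matrix.mul_assoc Kᴴ, ← Matrix.mul_assoc Aᴴ]
  linarith

theorem IsContraction.mul {K C : Matrix ι ι ℂ} (hK : IsContraction K) (hC : IsContraction C) :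
    IsContraction (K * C) := by
  have h := (hK.conjTranspose_mul_mul_same C).add hC
  unfold IsContraction
  convert h using 1
  rw [conjTranspose_mul]
  noncomm_ring

theorem isContraction_one : IsContraction (1 : Matrix ι ι ℂ) := by
  simpa [IsContraction] using PosSemidef.zero

theorem isContraction_list_prod {l : List (Matrix ι ι ℂ)} (h : ∀ K ∈ l, IsContraction K) :
    IsContraction l.prod := by
  induction l with
  | nil => exact isContraction_one
  | cons K l ih =>
    rw [List.prod_cons]
    exact (h K (by simp)).mul (ih fun C hC => h C (by simp [hC]))

/-- The disturbance of the state `ρ` by the measurement operator `K`. -/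
def disturbance (K ρ : Matrix ι ι ℂ) : ℝ := √((1 - K)ᴴ * (1 - K) * ρ).trace.re

/-- With S = √ρ, traces against ρ become squared Hilbert-Schmidt norms, so that the triangle
inequality is available. -/
theorem exists_mul_conjTranspose {ρ : Matrix ι ι ℂ} (hρ : ρ.PosSemidef) :
    ∃ S : Matrix ι ι ℂ, ρ = S * Sᴴ ∧
      (∀ A : Matrix ι ι ℂ, (Aᴴ * A * ρ).trace.re = hsNorm (A * S) ^ 2) ∧
      ∀ K, disturbance K ρ = hsNorm ((1 - K) * S) := by
  refine ⟨mpow ρ (1 / 2), ?_, ?_⟩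
  · rw [(mpow_posSemidef hρ _).1, mpow_mul hρ (by norm_num)]
    norm_num [mpow_one hρ]
  · have hρ2 : mpow ρ (1 / 2) * mpow ρ (1 / 2) = ρ := by
      rw [mpow_mul hρ (by norm_num)]
      norm_num [mpow_one hρ]
    have h : ∀ A : Matrix ι ι ℂ, (Aᴴ * A * ρ).trace.re
        = ((A * mpow ρ (1 / 2))ᴴ * (A * mpow ρ (1 / 2))).trace.re := by
      intro A
      conv_lhs => rw [← hρ2]
      rw [conjTranspose_mul, (mpow_posSemidef hρ _).1, ← Matrix.mul_assoc, Matrix.trace_mul_comm,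
        Matrix.mul_assoc, Matrix.mul_assoc]
    exact ⟨fun A => by rw [h, hsNorm_sq], fun K => by rw [disturbance, h, hsNorm]⟩

theorem disturbance_nonneg (K ρ : Matrix ι ι ℂ) : 0 ≤ disturbance K ρ := Real.sqrt_nonneg _

/-- 1 - KC = (1 - K) + K(1 - C), and the contraction K does not increase the norm of the second
term. -/
theorem disturbance_mul_le {K C ρ : Matrix ι ι ℂ} (hρ : ρ.PosSemidef) (hK : IsContraction K) :
    disturbance (K * C) ρ ≤ disturbance K ρ + disturbance C ρ := by
  obtain ⟨S, -, -, hS⟩ := exists_mul_conjTranspose hρ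
  rw [hS, hS, hS]
  have : (1 - K * C) * S = (1 - K) * S + K * ((1 - C) * S) := by noncomm_ring
  rw [this]
  exact (hsNorm_add_le _ _).trans (add_le_add_right (hK.hsNorm_mul_le _) _)

/-- A noncommutative union bound: all the disturbances are measured on the undisturbed state,
although the measurements act in sequence. -/
theorem disturbance_list_prod_le {l : List (Matrix ι ι ℂ)} {ρ : Matrix ι ι ℂ} (hρ : ρ.PosSemidef)
    (h : ∀ K ∈ l, IsContraction K) :
    disturbance l.prod ρ ≤ (l.map fun K => disturbance K ρ).sum := by
  induction l with
  | nil => simp [disturbance]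
  | cons K l ih =>
    rw [List.prod_cons, List.map_cons, List.sum_cons]
    exact (disturbance_mul_le hρ (h K (by simp))).trans
      (add_le_add_right (ih fun C hC => h C (by simp [hC])) _)

/-- A measurement operator that disturbs a state little has a likely outcome. -/
theorem failure_le_disturbance {K ρ : Matrix ι ι ℂ} (hρ : ρ.PosSemidef) (hρ1 : ρ.trace = 1) :
    failure (Kᴴ * K) ρ ≤ 2 * disturbance K ρ := by
  obtain ⟨S, hSS, hS, hS'⟩ := exists_mul_conjTranspose hρ
  have h1 : hsNorm S = 1 := by
    rw [hsNorm, Matrix.trace_mul_comm, ← hSS, hρ1]; simp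
  have h2 : hsNorm S ≤ disturbance K ρ + hsNorm (K * S) := by
    rw [hS']
    refine le_trans (le_of_eq ?_) (hsNorm_add_le _ _)
    congr 1; noncomm_ring
  have h3 : failure (Kᴴ * K) ρ = 1 - hsNorm (K * S) ^ 2 := by
    rw [failure, Matrix.sub_mul, Matrix.trace_sub, Complex.sub_re, Matrix.one_mul, hρ1, hS]; simp
  rw [h3]
  have h4 : 0 ≤ hsNorm (K * S) := Real.sqrt_nonneg _
  have h5 := disturbance_nonneg K ρ
  rw [h1] at h2
  -- 1 - t² ≤ 2(1 - t) with t = ‖K S‖.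
  nlinarith [sq_nonneg (hsNorm (K * S) - 1)]

theorem conjDiag_posSemidef_iff {U : Matrix ι ι ℂ} (hU : Uᴴ * U = 1) {d : ι → ℝ} :
    (conjDiag U d).PosSemidef ↔ ∀ i, 0 ≤ d i := by
  refine ⟨fun h i => ?_, fun h => conjDiag_posSemidef U h⟩
  have h1 := h.conjTranspose_mul_mul_same U
  have h2 : Uᴴ * conjDiag U d * U = diagonal fun i => (d i : ℂ) := by
    rw [conjDiag, ← Matrix.mul_assoc, ← Matrix.mul_assoc, hU, Matrix.one_mul, Matrix.mul_assoc, hU,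
      Matrix.mul_one]
  rw [h2, posSemidef_diagonal_iff] at h1
  exact_mod_cast h1 i

theorem one_sub_conjDiag {U : Matrix ι ι ℂ} (hU : Uᴴ * U = 1) (d : ι → ℝ) :
    1 - conjDiag U d = conjDiag U fun i => 1 - d i := by
  rw [← conjDiag_sub U (fun _ => 1) d, conjDiag_const hU]; simp

/-- In the eigenbasis of Λ this is (1 - √d)² ≤ 1 - d for 0 ≤ d ≤ 1. -/
theorem disturbance_sqrt_le {Λ ρ : Matrix ι ι ℂ} (hΛ : Λ.PosSemidef) (hΛ1 : (1 - Λ).PosSemidef)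
    (hρ : ρ.PosSemidef) : disturbance (mpow Λ (1 / 2)) ρ ≤ √(failure Λ ρ) := by
  refine Real.sqrt_le_sqrt (re_trace_mul_le_left ?_ hρ)
  obtain ⟨U, d, hU, hd, rfl⟩ := exists_conjDiag_nonneg hΛ
  rw [one_sub_conjDiag hU] at hΛ1 ⊢
  rw [mpow_conjDiag hU, one_sub_conjDiag hU, (conjDiag_isHermitian U _).eq, conjDiag_mul hU,
    conjDiag_sub]
  refine conjDiag_posSemidef U fun i => ?_
  have h1 : d i ≤ 1 := sub_nonneg.mp ((conjDiag_posSemidef_iff hU).mp hΛ1 i)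
  rw [← Real.sqrt_eq_rpow]
  have h2 := Real.sq_sqrt (hd i)
  have h3 := Real.sqrt_le_one.mpr h1
  nlinarith [Real.sqrt_nonneg (d i)]

theorem mpow_half_mul_self {Λ : Matrix ι ι ℂ} (hΛ : Λ.PosSemidef) :
    (mpow Λ (1 / 2))ᴴ * mpow Λ (1 / 2) = Λ := by
  rw [(mpow_posSemidef hΛ _).1, mpow_mul hΛ (by norm_num)]
  norm_num [mpow_one hΛ]

theorem POVM.one_sub_posSemidef {κ : Type*} [Fintype κ] (Λ : POVM κ ι) (k : κ) :
    (1 - Λ.op k).PosSemidef := by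
  classical
  rw [← Λ.sum_eq_one, ← Finset.add_sum_erase _ _ (Finset.mem_univ k), add_sub_cancel_left]
  exact posSemidef_sum _ fun l _ => Λ.posSemidef l

theorem QMeasurement.isContraction {κ : Type*} [Fintype κ] (Q : QMeasurement κ ι) (k : κ) :
    IsContraction (Q.kraus k) := by
  classical
  unfold IsContraction
  rw [← Q.sum_eq_one, ← Finset.add_sum_erase _ _ (Finset.mem_univ k), add_sub_cancel_left]
  exact posSemidef_sum _ fun l _ => posSemidef_conjTranspose_mul_self _

end Gentle

/-! ### Operators on two tensor factors -/

section Windows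
open scoped Kronecker

variable {Y N : Type*} [Fintype Y] [DecidableEq Y] [Fintype N] [DecidableEq N]

/-- The system of the factors `i` and `k` and that of the other factors. -/
def windowEquiv {i k : N} (hik : i ≠ k) :
    (N → Y) ≃ (Y × Y) × ({l : N // l ≠ i ∧ l ≠ k} → Y) where
  toFun s := ((s i, s k), fun l => s l)
  invFun p l := if h : l = i then p.1.1 else if h' : l = k then p.1.2 else p.2 ⟨l, h, h'⟩
  left_inv s := by
    funext l
    by_cases h : l = i
    · subst h; simp
    · by_cases h' : l = k
      · subst h'; simp [h]
      · simp [h, h']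
  right_inv p := by
    obtain ⟨⟨y, z⟩, r⟩ := p
    simp only [Prod.mk.injEq, dif_pos, dif_neg hik.symm, true_and]
    funext ⟨l, hl⟩
    simp [hl.1, hl.2]

/-- An operator on the factors `i` and `k`, extended to all the factors. -/
def windowEmb {i k : N} (hik : i ≠ k) (K : Matrix (Y × Y) (Y × Y) ℂ) :
    Matrix (N → Y) (N → Y) ℂ :=
  (K ⊗ₖ (1 : Matrix ({l : N // l ≠ i ∧ l ≠ k} → Y) ({l : N // l ≠ i ∧ l ≠ k} → Y) ℂ)).submatrix
    (windowEquiv hik) (windowEquiv hik)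

variable {i k : N} (hik : i ≠ k)

omit [Fintype Y] in
theorem windowEmb_apply (K : Matrix (Y × Y) (Y × Y) ℂ) (s t : N → Y) :
    windowEmb hik K s t
      = if ∀ l, l ≠ i → l ≠ k → s l = t l then K (s i, s k) (t i, t k) else 0 := by
  rw [windowEmb, submatrix_apply, kroneckerMap_apply, one_apply]
  have : (windowEquiv hik s).2 = (windowEquiv hik t).2 ↔ ∀ l, l ≠ i → l ≠ k → s l = t l := by
    simp [windowEquiv, funext_iff]
  simp only [this, mul_ite, mul_one, mul_zero]
  rfl

theorem windowEmb_mul (K C : Matrix (Y × Y) (Y × Y) ℂ) :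
    windowEmb hik K * windowEmb hik C = windowEmb hik (K * C) := by
  rw [windowEmb, windowEmb, submatrix_mul_equiv, ← mul_kronecker_mul, Matrix.mul_one, windowEmb]

omit [Fintype Y] in
theorem one_sub_windowEmb (K : Matrix (Y × Y) (Y × Y) ℂ) :
    1 - windowEmb hik K = windowEmb hik (1 - K) := by
  have h1 : windowEmb hik (1 : Matrix (Y × Y) (Y × Y) ℂ) = 1 := by
    rw [windowEmb, one_kronecker_one, submatrix_one_equiv]
  rw [← h1]
  ext s t
  simp only [windowEmb_apply, Matrix.sub_apply]
  split_ifs <;> simp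

omit [Fintype Y] in
theorem conjTranspose_windowEmb (K : Matrix (Y × Y) (Y × Y) ℂ) :
    (windowEmb hik K)ᴴ = windowEmb hik Kᴴ := by
  rw [windowEmb, conjTranspose_submatrix, conjTranspose_kronecker, conjTranspose_one, windowEmb]

theorem isContraction_windowEmb {K : Matrix (Y × Y) (Y × Y) ℂ} (hK : IsContraction K) :
    IsContraction (windowEmb hik K) := by
  unfold IsContraction
  rw [conjTranspose_windowEmb, windowEmb_mul, one_sub_windowEmb]
  exact (PosSemidef.kronecker hK PosSemidef.one).submatrix _

/-- The factors outside the window meet the identity and contribute their traces, which are 1. -/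
theorem trace_windowEmb_mul (K : Matrix (Y × Y) (Y × Y) ℂ) {ρ : N → Matrix Y Y ℂ}
    (hρ : ∀ l, (ρ l).trace = 1) :
    (windowEmb hik K * piKron ρ).trace = (K * (ρ i ⊗ₖ ρ k)).trace := by
  have : piKron ρ = ((ρ i ⊗ₖ ρ k) ⊗ₖ
      piKron fun l : {l : N // l ≠ i ∧ l ≠ k} => ρ l).submatrix (windowEquiv hik)
        (windowEquiv hik) := by
    ext s t
    rw [submatrix_apply, kroneckerMap_apply, kroneckerMap_apply, piKron_apply, piKron_apply,
      ← Finset.mul_prod_erase _ _ (Finset.mem_univ i),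
      ← Finset.mul_prod_erase _ _ (Finset.mem_erase.mpr ⟨hik.symm, Finset.mem_univ k⟩), ← mul_assoc]
    congr 1
    exact Finset.prod_subtype (p := fun l => l ≠ i ∧ l ≠ k) _ (by simp [and_comm])
      (fun l => ρ l (s l) (t l))
  rw [this, windowEmb, submatrix_mul_equiv, ← mul_kronecker_mul, Matrix.one_mul,
    Matrix.trace]
  simp only [diag_apply, submatrix_apply]
  rw [Equiv.sum_comp (windowEquiv hik) fun p => ((K * (ρ i ⊗ₖ ρ k)) ⊗ₖ
    piKron fun l : {l : N // l ≠ i ∧ l ≠ k} => ρ l) p p]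
  exact (trace_kronecker _ _).trans (by simp [trace_piKron, hρ])

theorem disturbance_windowEmb (K : Matrix (Y × Y) (Y × Y) ℂ) {ρ : N → Matrix Y Y ℂ}
    (hρ : ∀ l, (ρ l).trace = 1) :
    disturbance (windowEmb hik K) (piKron ρ) = disturbance K (ρ i ⊗ₖ ρ k) := by
  rw [disturbance, one_sub_windowEmb, conjTranspose_windowEmb, windowEmb_mul,
    trace_windowEmb_mul hik _ hρ, disturbance]

end Windows

/-! ### Union bounds for product effects -/

section Bipartite
open scoped Kronecker

variable {ι κ : Type*} [Fintype ι] [DecidableEq ι] [Fintype κ] [DecidableEq κ]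

omit [DecidableEq ι] in
theorem trace_kronecker_one_mul (A : Matrix ι ι ℂ) (Ψ : Matrix (ι × κ) (ι × κ) ℂ) :
    ((A ⊗ₖ (1 : Matrix κ κ ℂ)) * Ψ).trace
      = (A * reduce (fun (k : ι) (m : κ) => (k, m)) Ψ).trace := by
  simp only [Matrix.trace, diag_apply, Matrix.mul_apply, Fintype.sum_prod_type, kroneckerMap_apply,
    one_apply, reduce, of_apply, Finset.mul_sum]
  refine Finset.sum_congr rfl fun i _ => ?_
  rw [Finset.sum_comm]
  simp

omit [DecidableEq κ] in
theorem trace_one_kronecker_mul (A : Matrix κ κ ℂ) (Ψ : Matrix (ι × κ) (ι × κ) ℂ) :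
    (((1 : Matrix ι ι ℂ) ⊗ₖ A) * Ψ).trace
      = (A * reduce (fun (k : κ) (m : ι) => (m, k)) Ψ).trace := by
  simp only [Matrix.trace, diag_apply, Matrix.mul_apply, Fintype.sum_prod_type, kroneckerMap_apply,
    one_apply, reduce, of_apply, Finset.mul_sum]
  rw [Finset.sum_comm]
  refine Finset.sum_congr rfl fun i _ => ?_
  simp only [ite_mul, one_mul, zero_mul, Finset.sum_ite_irrel, Finset.sum_const_zero,
    Finset.sum_ite_eq, Finset.mem_univ, if_true]
  exact Finset.sum_comm

/-- 1 - A⊗C = (1-A)⊗1 + 1⊗(1-C) - (1-A)⊗(1-C), and the last term only helps. No product structure of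
Ψ is needed, so correlated outputs of relay and destination are allowed. -/
theorem failure_kronecker_le {A : Matrix ι ι ℂ} {C : Matrix κ κ ℂ}
    {Ψ : Matrix (ι × κ) (ι × κ) ℂ} (hA : (1 - A).PosSemidef) (hC : (1 - C).PosSemidef)
    (hΨ : Ψ.PosSemidef) :
    failure (A ⊗ₖ C) Ψ ≤ failure A (reduce (fun (k : ι) (m : κ) => (k, m)) Ψ)
      + failure C (reduce (fun (k : κ) (m : ι) => (m, k)) Ψ) := by
  have h := re_trace_mul_nonneg (hA.kronecker hC) hΨ
  have e : 1 - A ⊗ₖ C = (1 - A) ⊗ₖ 1 + 1 ⊗ₖ (1 - C) - (1 - A) ⊗ₖ (1 - C) := by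
    ext ⟨i, j⟩ ⟨i', j'⟩
    simp only [Matrix.sub_apply, Matrix.add_apply, kroneckerMap_apply, one_apply, Prod.mk.injEq]
    by_cases h1 : i = i' <;> by_cases h2 : j = j' <;> simp [h1, h2] <;> ring
  rw [failure, failure, failure, ← trace_kronecker_one_mul, ← trace_one_kronecker_mul, e,
    Matrix.sub_mul, Matrix.add_mul, Matrix.trace_sub, Matrix.trace_add, Complex.sub_re,
    Complex.add_re]
  linarith

omit [DecidableEq ι] in
theorem trace_mul_eq_ofReal {A C : Matrix ι ι ℂ} (hA : A.IsHermitian) (hC : C.IsHermitian) :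
    (A * C).trace = ((A * C).trace.re : ℂ) := by
  refine Complex.ext rfl ?_
  rw [Complex.ofReal_im, ← Complex.conj_eq_iff_im, ← Complex.star_def, ← trace_conjTranspose,
    conjTranspose_mul, hA, hC, Matrix.trace_mul_comm]

theorem one_sub_prod_le {N : Type*} (s : Finset N) {f : N → ℝ} (h0 : ∀ i, 0 ≤ f i)
    (h1 : ∀ i, f i ≤ 1) : 1 - ∏ i ∈ s, f i ≤ ∑ i ∈ s, (1 - f i) := by
  classical
  induction s using Finset.induction_on with
  | empty => simp
  | insert a s ha ih =>
    rw [Finset.prod_insert ha, Finset.sum_insert ha]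
    have h2 : ∏ i ∈ s, f i ≤ 1 := Finset.prod_le_one (fun i _ => h0 i) fun i _ => h1 i
    nlinarith [h0 a, h1 a]

variable {N : Type*} [Fintype N] [DecidableEq N]

theorem one_sub_piKron_posSemidef {A : N → Matrix ι ι ℂ} (hA : ∀ i, (A i).PosSemidef)
    (hA1 : ∀ i, (1 - A i).PosSemidef) : (1 - piKron A).PosSemidef := by
  choose U d hU hd h using fun i => exists_conjDiag_nonneg (hA i)
  obtain rfl : A = fun i => conjDiag (U i) (d i) := funext h
  rw [piKron_conjDiag, one_sub_conjDiag (piKron_unitary hU)]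
  refine conjDiag_posSemidef _ fun s => sub_nonneg.mpr ?_
  refine Finset.prod_le_one (fun i _ => hd i _) fun i _ => ?_
  have := hA1 i
  rw [one_sub_conjDiag (hU i), conjDiag_posSemidef_iff (hU i)] at this
  exact sub_nonneg.mp (this _)

theorem failure_piKron_le {A ρ : N → Matrix ι ι ℂ} (hA : ∀ i, (A i).PosSemidef)
    (hA1 : ∀ i, (1 - A i).PosSemidef) (hρ : ∀ i, (ρ i).PosSemidef) (hρ1 : ∀ i, (ρ i).trace = 1) :
    failure (piKron A) (piKron ρ) ≤ ∑ i, failure (A i) (ρ i) := by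
  have hf : ∀ i, failure (A i) (ρ i) = 1 - (A i * ρ i).trace.re := fun i => by
    rw [failure, Matrix.sub_mul, Matrix.trace_sub, Matrix.one_mul, hρ1, Complex.sub_re,
      Complex.one_re]
  have h : failure (piKron A) (piKron ρ) = 1 - ∏ i, (A i * ρ i).trace.re := by
    rw [failure, Matrix.sub_mul, Matrix.trace_sub, Matrix.one_mul, piKron_mul, trace_piKron,
      trace_piKron, Finset.prod_congr rfl fun i _ => trace_mul_eq_ofReal (hA i).1 (hρ i).1]
    simp only [hρ1, Finset.prod_const_one, Complex.sub_re, Complex.one_re]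
    norm_cast
  rw [h]
  simp only [hf]
  refine one_sub_prod_le _ (fun i => re_trace_mul_nonneg (hA i) (hρ i)) fun i => ?_
  have := re_trace_mul_nonneg (hA1 i) (hρ i)
  change 0 ≤ failure (A i) (ρ i) at this
  rw [hf] at this
  linarith

end Bipartite

/-! ### Marginals of products of bipartite states -/

section Bipartite

variable {N β γ : Type*} [Fintype N] [Fintype β] [Fintype γ]

/-- The tensor product of a family of bipartite operators, as a bipartite operator. -/
def biKron (ρ : N → Matrix (β × γ) (β × γ) ℂ) :
    Matrix ((N → β) × (N → γ)) ((N → β) × (N → γ)) ℂ :=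
  Matrix.of fun s t => ∏ i, ρ i (s.1 i, s.2 i) (t.1 i, t.2 i)

variable [DecidableEq N]

theorem biKron_posSemidef {ρ : N → Matrix (β × γ) (β × γ) ℂ} (hρ : ∀ i, (ρ i).PosSemidef) :
    (biKron ρ).PosSemidef := by
  classical
  exact (piKron_posSemidef hρ).submatrix fun s : (N → β) × (N → γ) => fun i => (s.1 i, s.2 i)

omit [Fintype β] in
theorem reduce_fst_biKron (ρ : N → Matrix (β × γ) (β × γ) ℂ) :
    reduce (fun (k : N → β) (m : N → γ) => (k, m)) (biKron ρ)
      = piKron fun i => reduce (fun (k : β) (m : γ) => (k, m)) (ρ i) := by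
  ext s t
  simp only [reduce, of_apply, biKron, piKron_apply]
  rw [Fintype.prod_sum]

omit [Fintype γ] in
theorem reduce_snd_biKron (ρ : N → Matrix (β × γ) (β × γ) ℂ) :
    reduce (fun (k : N → γ) (m : N → β) => (m, k)) (biKron ρ)
      = piKron fun i => reduce (fun (k : γ) (m : β) => (m, k)) (ρ i) := by
  ext s t
  simp only [reduce, of_apply, biKron, piKron_apply]
  rw [Fintype.prod_sum]

end Bipartite

/-! ### The two-step measurement of the destination -/

section Sequential
open scoped Kronecker

variable {M L ι : Type*} [Fintype M] [Fintype L] [Fintype ι] [DecidableEq ι]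

/-- The measurement that first finds `ℓ` by means of `Λ`, and then `m` by means of `Δ ℓ` on the
first factor. -/
def sequentialMeas (Λ : POVM L (ι × ι)) (Δ : L → POVM M ι) : QMeasurement (M × L) (ι × ι) where
  kraus k := (mpow ((Δ k.2).op k.1) (1 / 2) ⊗ₖ (1 : Matrix ι ι ℂ)) * mpow (Λ.op k.2) (1 / 2)
  sum_eq_one := by
    rw [Fintype.sum_prod_type_right, ← Λ.sum_eq_one]
    refine Finset.sum_congr rfl fun l _ => ?_
    have h : ∀ m, ((mpow ((Δ l).op m) (1 / 2) ⊗ₖ (1 : Matrix ι ι ℂ)) * mpow (Λ.op l) (1 / 2))ᴴ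
        * ((mpow ((Δ l).op m) (1 / 2) ⊗ₖ (1 : Matrix ι ι ℂ)) * mpow (Λ.op l) (1 / 2))
        = (mpow (Λ.op l) (1 / 2))ᴴ * ((Δ l).op m ⊗ₖ 1) * mpow (Λ.op l) (1 / 2) := by
      intro m
      rw [← mpow_half_mul_self ((Δ l).posSemidef m), conjTranspose_mul, conjTranspose_kronecker,
        mpow_half_mul_self ((Δ l).posSemidef m), Matrix.mul_assoc, ← Matrix.mul_assoc (_ ⊗ₖ _),
        ← mul_kronecker_mul, mpow_half_mul_self ((Δ l).posSemidef m), conjTranspose_one,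
        Matrix.mul_one, Matrix.mul_assoc]
    have h1 : ∑ m, (Δ l).op m ⊗ₖ (1 : Matrix ι ι ℂ) = 1 := by
      rw [← one_kronecker_one, ← (Δ l).sum_eq_one]
      ext i j
      simp [Matrix.sum_apply, Finset.sum_mul]
    simp only [h]
    rw [← Finset.sum_mul, ← Finset.mul_sum, h1, Matrix.mul_one,
      mpow_half_mul_self (Λ.posSemidef l)]

omit [Fintype ι] in
theorem one_sub_kronecker_one (K : Matrix ι ι ℂ) :
    (1 : Matrix (ι × ι) (ι × ι) ℂ) - K ⊗ₖ (1 : Matrix ι ι ℂ) = (1 - K) ⊗ₖ 1 := by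
  ext ⟨i, j⟩ ⟨i', j'⟩
  simp only [Matrix.sub_apply, kroneckerMap_apply, one_apply, Prod.mk.injEq]
  by_cases h1 : i = i' <;> by_cases h2 : j = j' <;> simp [h1, h2]

theorem disturbance_kronecker_one {K σ σ' : Matrix ι ι ℂ} (h1 : σ'.trace = 1) :
    disturbance (K ⊗ₖ (1 : Matrix ι ι ℂ)) (σ ⊗ₖ σ') = disturbance K σ := by
  rw [disturbance, one_sub_kronecker_one, conjTranspose_kronecker, ← mul_kronecker_mul, ← mul_kronecker_mul,
    trace_kronecker, conjTranspose_one, Matrix.one_mul, Matrix.one_mul, h1, mul_one, disturbance]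

/-- The operator for ℓ acts on both blocks, that for m on the first block only. Each is the square
root of an effect and so costs the square root of its failure probability. -/
theorem disturbance_sequentialMeas_le (Λ : POVM L (ι × ι)) (Δ : L → POVM M ι)
    {σ σ' : Matrix ι ι ℂ} (hσ : σ.PosSemidef) (hσ' : σ'.PosSemidef) (h1 : σ'.trace = 1) (m : M)
    (l : L) :
    disturbance ((sequentialMeas Λ Δ).kraus (m, l)) (σ ⊗ₖ σ')
      ≤ √(failure (Λ.op l) (σ ⊗ₖ σ')) + √(failure ((Δ l).op m) σ) := by
  have hK : IsContraction (mpow ((Δ l).op m) (1 / 2) ⊗ₖ (1 : Matrix ι ι ℂ)) := by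
    unfold IsContraction
    rw [conjTranspose_kronecker, ← mul_kronecker_mul, mpow_half_mul_self ((Δ l).posSemidef m),
      conjTranspose_one, Matrix.one_mul, one_sub_kronecker_one]
    exact ((Δ l).one_sub_posSemidef m).kronecker PosSemidef.one
  refine (disturbance_mul_le (hσ.kronecker hσ') hK).trans ?_
  rw [disturbance_kronecker_one h1, add_comm]
  exact add_le_add
    (disturbance_sqrt_le (Λ.posSemidef l) (Λ.one_sub_posSemidef l) (hσ.kronecker hσ'))
    (disturbance_sqrt_le ((Δ l).posSemidef m) ((Δ l).one_sub_posSemidef m) hσ)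

end Sequential

/-! ### Error of the whole protocol for a given code -/

section Run
open scoped Kronecker

variable {X X₁ B₁ B : Type*} [Fintype B₁] [Fintype B] [DecidableEq B₁] [DecidableEq B]
  (𝒩 : RelayChannel X X₁ B₁ B) {n b : ℕ} (C : PDFCode X X₁ B₁ B n b) (w : C.Messages)

namespace PDFCode

theorem relayState_eq (j : Fin (b + 1)) : C.relayState 𝒩 w j = piKron fun i =>
    𝒩.relayOut (C.relayWord j (C.prev w j) i)
      (C.sourceWord j (C.cur w j).1 (C.cur w j).2 (C.prev w j) i) :=
  reduce_fst_biKron _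

theorem destState_eq (j : Fin (b + 1)) : C.destState 𝒩 w j = piKron fun i =>
    𝒩.destOut (C.relayWord j (C.prev w j) i)
      (C.sourceWord j (C.cur w j).1 (C.cur w j).2 (C.prev w j) i) :=
  reduce_snd_biKron _

theorem relayState_posSemidef (j : Fin (b + 1)) : (C.relayState 𝒩 w j).PosSemidef := by
  rw [relayState_eq]
  exact piKron_posSemidef fun i => 𝒩.relayOut_posSemidef _ _

theorem destState_posSemidef (j : Fin (b + 1)) : (C.destState 𝒩 w j).PosSemidef := by
  rw [destState_eq]
  exact piKron_posSemidef fun i => 𝒩.destOut_posSemidef _ _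

theorem trace_relayState (j : Fin (b + 1)) : (C.relayState 𝒩 w j).trace = 1 := by
  rw [relayState_eq, trace_piKron]
  exact Finset.prod_eq_one fun i _ => 𝒩.trace_relayOut _ _

theorem trace_destState (j : Fin (b + 1)) : (C.destState 𝒩 w j).trace = 1 := by
  rw [destState_eq, trace_piKron]
  exact Finset.prod_eq_one fun i _ => 𝒩.trace_destOut _ _

theorem totalState_posSemidef : (C.totalState 𝒩 w).PosSemidef :=
  biKron_posSemidef fun _ => biKron_posSemidef fun _ => 𝒩.posSemidef _ _

/-- The effects of the correct decisions of the relay in the blocks. -/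
def relayEffect : Fin (b + 1) → Matrix (Fin n → B₁) (Fin n → B₁) ℂ :=
  Fin.snoc (α := fun _ => Matrix (Fin n → B₁) (Fin n → B₁) ℂ)
    (fun j : Fin b => (C.relayPOVM j (C.prev w j.castSucc)).op (w j).2) 1

theorem relayTotal_eq : C.relayTotal w = piKron (C.relayEffect w) := by
  ext s t
  rw [piKron_apply, Fin.prod_univ_castSucc]
  simp [relayEffect, relayTotal, one_apply]

theorem relayEffect_posSemidef (j : Fin (b + 1)) : (C.relayEffect w j).PosSemidef := by
  refine Fin.lastCases ?_ (fun j => ?_) j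
  · rw [relayEffect, Fin.snoc_last]; exact PosSemidef.one
  · rw [relayEffect, Fin.snoc_castSucc]; exact (C.relayPOVM _ _).posSemidef _

theorem one_sub_relayEffect_posSemidef (j : Fin (b + 1)) :
    (1 - C.relayEffect w j).PosSemidef := by
  refine Fin.lastCases ?_ (fun j => ?_) j
  · rw [relayEffect, Fin.snoc_last, sub_self]; exact PosSemidef.zero
  · rw [relayEffect, Fin.snoc_castSucc]; exact (C.relayPOVM _ _).one_sub_posSemidef _

theorem failure_relayTotal_le :
    failure (C.relayTotal w) (piKron (C.relayState 𝒩 w))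
      ≤ ∑ j : Fin b, failure ((C.relayPOVM j (C.prev w j.castSucc)).op (w j).2)
        (C.relayState 𝒩 w j.castSucc) := by
  rw [relayTotal_eq]
  refine (failure_piKron_le (C.relayEffect_posSemidef w) (C.one_sub_relayEffect_posSemidef w)
    (C.relayState_posSemidef 𝒩 w) (C.trace_relayState 𝒩 w)).trans_eq ?_
  rw [Fin.sum_univ_castSucc]
  simp [relayEffect, failure]

theorem windowOp_eq (j : Fin b) : C.windowOp w j = windowEmb j.castSucc_lt_succ.ne
    ((C.destMeas j (C.prev w j.castSucc)).kraus (w j)) := by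
  ext s t
  rw [windowEmb_apply, windowOp, of_apply]
  split_ifs <;> rfl

/-- The disturbance by the destination's measurement of the blocks `j` and `j+1`. -/
def windowDisturbance (j : Fin b) : ℝ :=
  disturbance ((C.destMeas j (C.prev w j.castSucc)).kraus (w j))
    (C.destState 𝒩 w j.castSucc ⊗ₖ C.destState 𝒩 w j.succ)

theorem isContraction_windowOp (j : Fin b) : IsContraction (C.windowOp w j) := by
  rw [windowOp_eq]
  exact isContraction_windowEmb _ (QMeasurement.isContraction _ _)

theorem isContraction_destTotal : IsContraction (C.destTotal w) := by
  refine isContraction_list_prod fun K hK => ?_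
  rw [List.mem_reverse, List.mem_ofFn] at hK
  obtain ⟨j, rfl⟩ := hK
  exact C.isContraction_windowOp w j

theorem disturbance_destTotal_le :
    disturbance (C.destTotal w) (piKron (C.destState 𝒩 w))
      ≤ ∑ j, C.windowDisturbance 𝒩 w j := by
  refine (disturbance_list_prod_le (piKron_posSemidef (C.destState_posSemidef 𝒩 w))
    fun K hK => ?_).trans_eq ?_
  · rw [List.mem_reverse, List.mem_ofFn] at hK
    obtain ⟨j, rfl⟩ := hK
    exact C.isContraction_windowOp w j
  · rw [List.map_reverse, List.sum_reverse, List.map_ofFn, List.sum_ofFn]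
    refine Finset.sum_congr rfl fun j _ => ?_
    rw [Function.comp_apply, windowOp_eq, disturbance_windowEmb _ _ (C.trace_destState 𝒩 w)]
    rfl

/-- The probability of an error in the run of the whole protocol, for given messages. -/
theorem failure_total_le :
    failure (C.relayTotal w ⊗ₖ ((C.destTotal w)ᴴ * C.destTotal w)) (C.totalState 𝒩 w)
      ≤ (∑ j : Fin b, failure ((C.relayPOVM j (C.prev w j.castSucc)).op (w j).2)
        (C.relayState 𝒩 w j.castSucc)) + 2 * ∑ j, C.windowDisturbance 𝒩 w j := by
  have hR : (1 - C.relayTotal w).PosSemidef := by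
    rw [relayTotal_eq]
    exact one_sub_piKron_posSemidef (C.relayEffect_posSemidef w)
      (C.one_sub_relayEffect_posSemidef w)
  refine (failure_kronecker_le hR (C.isContraction_destTotal w)
    (C.totalState_posSemidef 𝒩 w)).trans ?_
  -- Both marginals of the total state are products over the blocks, whatever the correlation
  -- between relay and destination.
  have e1 : reduce (fun (k : Fin (b + 1) → Fin n → B₁) (m : Fin (b + 1) → Fin n → B) => (k, m))
      (C.totalState 𝒩 w) = piKron (C.relayState 𝒩 w) := reduce_fst_biKron _
  have e2 : reduce (fun (k : Fin (b + 1) → Fin n → B) (m : Fin (b + 1) → Fin n → B₁) => (m, k))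
      (C.totalState 𝒩 w) = piKron (C.destState 𝒩 w) := reduce_snd_biKron _
  rw [e1, e2]
  have h1 : (piKron (C.destState 𝒩 w)).trace = 1 := by
    rw [trace_piKron]
    exact Finset.prod_eq_one fun j _ => C.trace_destState 𝒩 w j
  refine add_le_add (C.failure_relayTotal_le 𝒩 w) ?_
  refine (failure_le_disturbance (piKron_posSemidef (C.destState_posSemidef 𝒩 w)) h1).trans ?_
  exact mul_le_mul_of_nonneg_left (C.disturbance_destTotal_le 𝒩 w) (by norm_num)

theorem trace_totalState : (C.totalState 𝒩 w).trace = 1 := by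
  rw [← trace_reduce_fst]
  have e1 : reduce (fun (k : Fin (b + 1) → Fin n → B₁) (m : Fin (b + 1) → Fin n → B) => (k, m))
      (C.totalState 𝒩 w) = piKron (C.relayState 𝒩 w) := reduce_fst_biKron _
  rw [e1, trace_piKron]
  exact Finset.prod_eq_one fun j _ => C.trace_relayState 𝒩 w j

theorem card_messages_pos : (0 : ℝ) < Fintype.card C.Messages := by
  have : Nonempty C.Messages := ⟨fun _ => (⟨0, C.numM.pos⟩, ⟨0, C.numL.pos⟩)⟩
  exact_mod_cast Fintype.card_pos

theorem average_mono {f g : C.Messages → ℝ} (h : ∀ w, f w ≤ g w) : C.average f ≤ C.average g :=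
  div_le_div_of_nonneg_right (Finset.sum_le_sum fun w _ => h w) C.card_messages_pos.le

theorem average_add (f g : C.Messages → ℝ) :
    C.average (fun w => f w + g w) = C.average f + C.average g := by
  simp [average, Finset.sum_add_distrib, add_div]

theorem average_mul_left (c : ℝ) (f : C.Messages → ℝ) :
    C.average (fun w => c * f w) = c * C.average f := by
  simp only [average, ← Finset.mul_sum, mul_div_assoc]

theorem average_sum {κ : Type*} (s : Finset κ) (f : κ → C.Messages → ℝ) :
    C.average (fun w => ∑ k ∈ s, f k w) = ∑ k ∈ s, C.average (f k) := by
  simp only [average, Finset.sum_div]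
  exact Finset.sum_comm

theorem average_const (c : ℝ) : C.average (fun _ => c) = c := by
  rw [average, Finset.sum_const, Finset.card_univ, nsmul_eq_mul,
    mul_div_cancel_left₀ _ C.card_messages_pos.ne']

/-- Concavity of the square root, by Cauchy-Schwarz; it carries the disturbance bounds from fixed
messages to averages. -/
theorem average_sqrt_le {f : C.Messages → ℝ} (hf : ∀ w, 0 ≤ f w) :
    C.average (fun w => √(f w)) ≤ √(C.average f) := by
  refine Real.le_sqrt_of_sq_le ?_
  have h := sq_sum_le_card_mul_sum_sq (s := (Finset.univ : Finset C.Messages))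
    (f := fun w => √(f w))
  simp only [Real.sq_sqrt (hf _), Finset.card_univ] at h
  have hN := C.card_messages_pos
  rw [average, average, div_pow, div_le_div_iff₀ (by positivity) hN]
  nlinarith

theorem totalError_eq : C.totalError 𝒩 = C.average fun w =>
    failure (C.relayTotal w ⊗ₖ ((C.destTotal w)ᴴ * C.destTotal w)) (C.totalState 𝒩 w) := by
  rw [totalError]
  conv_lhs => rw [← C.average_const 1]
  rw [average, average, average, ← sub_div, ← Finset.sum_sub_distrib]
  congr 1
  refine Finset.sum_congr rfl fun w _ => ?_
  rw [failure, Matrix.sub_mul, Matrix.trace_sub, Complex.sub_re, Matrix.one_mul,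
    C.trace_totalState 𝒩 w, Complex.one_re]

end PDFCode

end Run

/-! ### Single-letter form of the word quantities -/

section Words

variable {ι : Type*} [Fintype ι] [DecidableEq ι] {n : ℕ}

omit [Fintype ι] [DecidableEq ι] in
theorem mix_prodLaw {S : Type*} [Fintype S] (Q : Fin n → S → ℝ) (A : Fin n → S → Matrix ι ι ℂ) :
    (mix (prodLaw Q) fun x => piKron fun i => A i (x i)) = piKron fun i => mix (Q i) (A i) := by
  simp only [mix, prodLaw, Complex.ofReal_prod]
  exact piKron_sum (fun i x => (Q i x : ℂ)) A

variable {𝒜 𝒰 𝒳 : Type*} [Fintype 𝒜] [Fintype 𝒰] [Fintype 𝒳]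
  {p₁ : 𝒜 → ℝ} {p₂ : 𝒜 → 𝒰 → ℝ} {p₃ : 𝒜 → 𝒰 → 𝒳 → ℝ} {σ : 𝒜 → 𝒳 → Matrix ι ι ℂ}

/-- The states of words. -/
def wordState (n : ℕ) (σ : 𝒜 → 𝒳 → Matrix ι ι ℂ) (a : Fin n → 𝒜) (x : Fin n → 𝒳) :
    Matrix (Fin n → ι) (Fin n → ι) ℂ := piKron fun i => σ (a i) (x i)

/-- The law of words with independent letters. -/
def wordLaw (n : ℕ) (p₁ : 𝒜 → ℝ) : (Fin n → 𝒜) → ℝ := prodLaw fun _ => p₁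

/-- The conditional law of `u`-words. -/
def wordLaw₂ (n : ℕ) (p₂ : 𝒜 → 𝒰 → ℝ) (a : Fin n → 𝒜) : (Fin n → 𝒰) → ℝ :=
  prodLaw fun i => p₂ (a i)

/-- The conditional law of `x`-words. -/
def wordLaw₃ (n : ℕ) (p₃ : 𝒜 → 𝒰 → 𝒳 → ℝ) (a : Fin n → 𝒜) (u : Fin n → 𝒰) : (Fin n → 𝒳) → ℝ :=
  prodLaw fun i => p₃ (a i) (u i)

omit [Fintype ι] [DecidableEq ι] [Fintype 𝒜] [Fintype 𝒰] in
theorem cloudState_word (a : Fin n → 𝒜) (u : Fin n → 𝒰) :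
    cloudState (wordLaw₃ n p₃) (wordState n σ) a u
      = piKron fun i => cloudState p₃ σ (a i) (u i) :=
  mix_prodLaw (fun i => p₃ (a i) (u i)) fun i => σ (a i)

omit [Fintype ι] [DecidableEq ι] [Fintype 𝒜] in
theorem relayWordState_word (a : Fin n → 𝒜) :
    relayWordState (wordLaw₂ n p₂) (wordLaw₃ n p₃) (wordState n σ) a
      = piKron fun i => relayWordState p₂ p₃ σ (a i) := by
  simp only [relayWordState, funext (cloudState_word (p₃ := p₃) (σ := σ) a)]
  exact mix_prodLaw (fun i => p₂ (a i)) fun i => cloudState p₃ σ (a i)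

omit [Fintype ι] [DecidableEq ι] in
theorem meanState_word :
    meanState (wordLaw n p₁) (wordLaw₂ n p₂) (wordLaw₃ n p₃) (wordState n σ)
      = piKron fun _ => meanState p₁ p₂ p₃ σ := by
  simp only [meanState, funext (relayWordState_word (p₂ := p₂) (p₃ := p₃) (σ := σ))]
  exact mix_prodLaw (fun _ => p₁) fun _ => relayWordState p₂ p₃ σ

variable (h₁ : p₁ ∈ stdSimplex ℝ 𝒜) (h₂ : ∀ a, p₂ a ∈ stdSimplex ℝ 𝒰)
  (h₃ : ∀ a u, p₃ a u ∈ stdSimplex ℝ 𝒳) (hσ : ∀ a x, (σ a x).PosSemidef)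
include h₂ h₃ hσ

/-- The states of words are tensor products and the letters are independent given the outer words,
so the inner and then the outer expectation factor over the positions. -/
theorem cloudChernoff_word (s : ℝ) :
    cloudChernoff (wordLaw n p₁) (wordLaw₂ n p₂) (wordLaw₃ n p₃) (wordState n σ) s
      = cloudChernoff p₁ p₂ p₃ σ s ^ n := by
  have hA : ∀ a u, (cloudState p₃ σ a u).PosSemidef := fun a u =>
    mix_posSemidef (h₃ a u).1 (hσ a)
  have hB : ∀ a, (relayWordState p₂ p₃ σ a).PosSemidef := fun a =>
    mix_posSemidef (h₂ a).1 (hA a)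
  simp only [cloudChernoff, cloudState_word, relayWordState_word,
    chernoff_piKron (fun i => hA _ _) (fun i => hB _)]
  calc _ = expect (wordLaw n p₁) fun a => ∏ i, expect (p₂ (a i)) fun u =>
        chernoff (cloudState p₃ σ (a i) u) (relayWordState p₂ p₃ σ (a i)) s := by
        congr 1; funext a
        exact expect_prodLaw_prod (fun i => p₂ (a i)) fun i u =>
          chernoff (cloudState p₃ σ (a i) u) (relayWordState p₂ p₃ σ (a i)) s
    _ = _ := (expect_prodLaw_prod (fun _ => p₁) fun _ a => expect (p₂ a) fun u =>
        chernoff (cloudState p₃ σ a u) (relayWordState p₂ p₃ σ a) s).trans (by simp)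

omit h₂ in
theorem sourceChernoff_word (s : ℝ) :
    sourceChernoff (wordLaw n p₁) (wordLaw₂ n p₂) (wordLaw₃ n p₃) (wordState n σ) s
      = sourceChernoff p₁ p₂ p₃ σ s ^ n := by
  have hA : ∀ a u, (cloudState p₃ σ a u).PosSemidef := fun a u =>
    mix_posSemidef (h₃ a u).1 (hσ a)
  simp only [sourceChernoff, cloudState_word, wordState,
    chernoff_piKron (fun i => hσ _ _) (fun i => hA _ _)]
  calc _ = expect (wordLaw n p₁) fun a => expect (wordLaw₂ n p₂ a) fun u => ∏ i,
        expect (p₃ (a i) (u i)) fun x => chernoff (σ (a i) x) (cloudState p₃ σ (a i) (u i)) s := by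
        congr 1; funext a; congr 1; funext u
        exact expect_prodLaw_prod (fun i => p₃ (a i) (u i)) fun i x =>
          chernoff (σ (a i) x) (cloudState p₃ σ (a i) (u i)) s
    _ = expect (wordLaw n p₁) fun a => ∏ i, expect (p₂ (a i)) fun u => expect (p₃ (a i) u)
        fun x => chernoff (σ (a i) x) (cloudState p₃ σ (a i) u) s := by
        congr 1; funext a
        exact expect_prodLaw_prod (fun i => p₂ (a i)) fun i u => expect (p₃ (a i) u)
          fun x => chernoff (σ (a i) x) (cloudState p₃ σ (a i) u) s
    _ = _ := (expect_prodLaw_prod (fun _ => p₁) fun _ a => expect (p₂ a) fun u =>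
        expect (p₃ a u) fun x => chernoff (σ a x) (cloudState p₃ σ a u) s).trans (by simp)

include h₁ in
theorem relayWordChernoff_word (s : ℝ) :
    relayWordChernoff (wordLaw n p₁) (wordLaw₂ n p₂) (wordLaw₃ n p₃) (wordState n σ) s
      = relayWordChernoff p₁ p₂ p₃ σ s ^ n := by
  have hB : ∀ a, (relayWordState p₂ p₃ σ a).PosSemidef := fun a =>
    mix_posSemidef (h₂ a).1 fun u => mix_posSemidef (h₃ a u).1 (hσ a)
  have hC : (meanState p₁ p₂ p₃ σ).PosSemidef := mix_posSemidef h₁.1 hB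
  simp only [relayWordChernoff, relayWordState_word, meanState_word,
    chernoff_piKron (fun i => hB _) (fun i => hC)]
  exact (expect_prodLaw_prod (fun _ => p₁) fun _ a =>
    chernoff (relayWordState p₂ p₃ σ a) (meanState p₁ p₂ p₃ σ) s).trans (by simp)

end Words

/-! ### From average failures to codes -/

section Codes
open scoped Kronecker

variable {X X₁ B₁ B : Type*} [Fintype X] [Fintype X₁] [Fintype B₁] [Fintype B]
  [DecidableEq B₁] [DecidableEq B]

namespace PDFCode

omit [Fintype X] [Fintype X₁] in
theorem cur_castSucc {n b : ℕ} (C : PDFCode X X₁ B₁ B n b) (w : C.Messages) (j : Fin b) :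
    C.cur w j.castSucc = w j := by
  rw [cur, Fin.snoc_castSucc]

omit [Fintype X] [Fintype X₁] in
/-- The errors of a code whose destination decodes `ℓ` before `m`. -/
theorem errors_le (𝒩 : RelayChannel X X₁ B₁ B) {n b : ℕ} (C : PDFCode X X₁ B₁ B n b)
    (Λ : Fin b → Fin C.numL → POVM (Fin C.numL) ((Fin n → B) × (Fin n → B)))
    (Δ : Fin b → Fin C.numL → Fin C.numL → POVM (Fin C.numM) (Fin n → B))
    (hC : ∀ j l', C.destMeas j l' = sequentialMeas (Λ j l') (Δ j l')) {D : ℝ}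
    (hD : ∑ w : C.Messages, ∑ j : Fin b,
      (failure ((C.relayPOVM j (C.prev w j.castSucc)).op (w j).2) (C.relayState 𝒩 w j.castSucc)
        + failure ((Λ j (C.prev w j.castSucc)).op (w j).2)
          (C.destState 𝒩 w j.castSucc ⊗ₖ C.destState 𝒩 w j.succ)
        + failure ((Δ j (C.prev w j.castSucc) (w j).2).op (w j).1) (C.destState 𝒩 w j.castSucc))
      ≤ Fintype.card C.Messages * D) :
    (∀ j, C.relayError 𝒩 j + C.destError 𝒩 j ≤ D + 4 * √D) ∧
      C.totalError 𝒩 ≤ D + b * (4 * √D) := by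
  set f : C.Messages → Fin b → ℝ := fun w j =>
    failure ((C.relayPOVM j (C.prev w j.castSucc)).op (w j).2) (C.relayState 𝒩 w j.castSucc)
    with hf
  set g : C.Messages → Fin b → ℝ := fun w j =>
    failure ((Λ j (C.prev w j.castSucc)).op (w j).2)
      (C.destState 𝒩 w j.castSucc ⊗ₖ C.destState 𝒩 w j.succ) with hg
  set h : C.Messages → Fin b → ℝ := fun w j =>
    failure ((Δ j (C.prev w j.castSucc) (w j).2).op (w j).1) (C.destState 𝒩 w j.castSucc) with hh
  have hf0 : ∀ w j, 0 ≤ f w j := fun w j =>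
    re_trace_mul_nonneg (POVM.one_sub_posSemidef _ _) (C.relayState_posSemidef 𝒩 w _)
  have hg0 : ∀ w j, 0 ≤ g w j := fun w j =>
    re_trace_mul_nonneg (POVM.one_sub_posSemidef _ _)
      ((C.destState_posSemidef 𝒩 w _).kronecker (C.destState_posSemidef 𝒩 w _))
  have hh0 : ∀ w j, 0 ≤ h w j := fun w j =>
    re_trace_mul_nonneg (POVM.one_sub_posSemidef _ _) (C.destState_posSemidef 𝒩 w _)
  have htot : C.average (fun w => ∑ j, (f w j + g w j + h w j)) ≤ D := by
    rw [average, div_le_iff₀ C.card_messages_pos, mul_comm]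
    exact hD
  have hle : ∀ w j, f w j + g w j + h w j ≤ ∑ j, (f w j + g w j + h w j) := fun w j =>
    Finset.single_le_sum (f := fun j => f w j + g w j + h w j)
      (fun j _ => add_nonneg (add_nonneg (hf0 w j) (hg0 w j)) (hh0 w j)) (Finset.mem_univ j)
  have hgD : ∀ j, C.average (fun w => g w j) ≤ D := fun j =>
    (C.average_mono fun w => by linarith [hle w j, hf0 w j, hh0 w j]).trans htot
  have hhD : ∀ j, C.average (fun w => h w j) ≤ D := fun j =>
    (C.average_mono fun w => by linarith [hle w j, hf0 w j, hg0 w j]).trans htot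
  have hfD : C.average (fun w => ∑ j, f w j) ≤ D :=
    (C.average_mono fun w => Finset.sum_le_sum fun j _ => by
      linarith [hg0 w j, hh0 w j]).trans htot
  have hfD' : ∀ j, C.average (fun w => f w j) ≤ D := fun j =>
    (C.average_mono fun w => by linarith [hle w j, hg0 w j, hh0 w j]).trans htot
  have hdist : ∀ w j, C.windowDisturbance 𝒩 w j ≤ √(g w j) + √(h w j) := by
    intro w j
    rw [windowDisturbance, hC]
    exact disturbance_sequentialMeas_le _ _ (C.destState_posSemidef 𝒩 w _)
      (C.destState_posSemidef 𝒩 w _) (C.trace_destState 𝒩 w _) _ _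
  -- One √D comes from decoding ℓ and one from decoding m. The passage from disturbance to failure
  -- doubles the sum, hence the 4√D in the conclusion.
  have havg : ∀ j, C.average (fun w => C.windowDisturbance 𝒩 w j) ≤ 2 * √D := by
    intro j
    refine (C.average_mono fun w => hdist w j).trans ?_
    rw [C.average_add, two_mul]
    exact add_le_add
      ((C.average_sqrt_le fun w => hg0 w j).trans (Real.sqrt_le_sqrt (hgD j)))
      ((C.average_sqrt_le fun w => hh0 w j).trans (Real.sqrt_le_sqrt (hhD j)))
  refine ⟨fun j => add_le_add (hfD' j) ?_, ?_⟩
  · have : C.destError 𝒩 j ≤ C.average fun w => 2 * C.windowDisturbance 𝒩 w j :=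
      C.average_mono fun w => failure_le_disturbance
        ((C.destState_posSemidef 𝒩 w _).kronecker (C.destState_posSemidef 𝒩 w _)) (by
          rw [trace_kronecker, C.trace_destState, C.trace_destState, one_mul])
    rw [C.average_mul_left] at this
    linarith [havg j]
  · rw [totalError_eq]
    refine (C.average_mono fun w => C.failure_total_le 𝒩 w).trans ?_
    rw [C.average_add, C.average_mul_left, C.average_sum Finset.univ
      fun j w => C.windowDisturbance 𝒩 w j]
    refine add_le_add hfD ?_
    have : ∑ j : Fin b, C.average (fun w => C.windowDisturbance 𝒩 w j) ≤ ∑ j : Fin b, 2 * √D :=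
      Finset.sum_le_sum fun j _ => havg j
    rw [Finset.sum_const, Finset.card_univ, Fintype.card_fin, nsmul_eq_mul] at this
    linarith

end PDFCode

/-- Random coding with superposition codes of block length `n`. -/
theorem exists_code (𝒩 : RelayChannel X X₁ B₁ B) {U : Type*} [Fintype U] {p₁ : X₁ → ℝ}
    {p₂ : X₁ → U → ℝ} {p₃ : X₁ → U → X → ℝ} (h₁ : p₁ ∈ stdSimplex ℝ X₁)
    (h₂ : ∀ a, p₂ a ∈ stdSimplex ℝ U) (h₃ : ∀ a u, p₃ a u ∈ stdSimplex ℝ X)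
    {r s t ε : ℝ} (hr : r ∈ Set.Ioo (0 : ℝ) 1) (hs : s ∈ Set.Ioo (0 : ℝ) 1)
    (ht : t ∈ Set.Ioo (0 : ℝ) 1) (hε : 0 < ε) (numM numL : ℕ+) (n b : ℕ)
    (hτε : ((numL : ℝ) - 1) ^ r * cloudChernoff p₁ p₂ p₃ 𝒩.relayOut r ^ n ≤ ε)
    (hσε : ((numL : ℝ) - 1) ^ s * (cloudChernoff p₁ p₂ p₃ 𝒩.destOut s ^ n
      * relayWordChernoff p₁ p₂ p₃ 𝒩.destOut s ^ n) ≤ ε)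
    (hσε' : ((numM : ℝ) - 1) ^ t * sourceChernoff p₁ p₂ p₃ 𝒩.destOut t ^ n ≤ ε) :
    ∃ C : PDFCode X X₁ B₁ B n b, C.numM = numM ∧ C.numL = numL ∧
      (∀ j, C.relayError 𝒩 j + C.destError 𝒩 j
        ≤ b * (24 * ε) + 4 * √(b * (24 * ε))) ∧
      C.totalError 𝒩 ≤ b * (24 * ε) + b * (4 * √(b * (24 * ε))) := by
  have : Nonempty (Fin numM) := ⟨⟨0, numM.pos⟩⟩
  have : Nonempty (Fin numL) := ⟨⟨0, numL.pos⟩⟩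
  let cur : (Fin b → Fin numM × Fin numL) → Fin (b + 1) → Fin numM × Fin numL := fun w =>
    Fin.snoc (α := fun _ => Fin numM × Fin numL) w (⟨0, numM.pos⟩, ⟨0, numL.pos⟩)
  let prev : (Fin b → Fin numM × Fin numL) → Fin (b + 1) → Fin numL := fun w =>
    Fin.cons (α := fun _ => Fin numL) ⟨0, numL.pos⟩ fun j => (w j).2
  have hcur : ∀ w j, cur w (Fin.castSucc j) = w j := fun w j => Fin.snoc_castSucc ..
  obtain ⟨a, x, Γ, Λ, Δ, h⟩ := exists_blocks (M := Fin numM) (L := Fin numL)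
    (p₁ := wordLaw n p₁) (p₂ := wordLaw₂ n p₂) (p₃ := wordLaw₃ n p₃)
    (prodLaw_mem fun _ => h₁) (fun a => prodLaw_mem fun _ => h₂ _)
    (fun a u => prodLaw_mem fun _ => h₃ _ _)
    (τ := wordState n 𝒩.relayOut) (fun a x => piKron_posSemidef fun i => 𝒩.relayOut_posSemidef _ _)
    (fun a x => (trace_piKron _).trans (Finset.prod_eq_one fun i _ => 𝒩.trace_relayOut _ _))
    (σ := wordState n 𝒩.destOut) (fun a x => piKron_posSemidef fun i => 𝒩.destOut_posSemidef _ _)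
    (fun a x => (trace_piKron _).trans (Finset.prod_eq_one fun i _ => 𝒩.trace_destOut _ _))
    hr hs ht hε (ε := ε)
    (by rwa [cloudChernoff_word h₂ h₃ 𝒩.relayOut_posSemidef, Fintype.card_fin])
    (by rwa [cloudChernoff_word h₂ h₃ 𝒩.destOut_posSemidef,
      relayWordChernoff_word h₁ h₂ h₃ 𝒩.destOut_posSemidef, Fintype.card_fin])
    (by rwa [sourceChernoff_word h₃ 𝒩.destOut_posSemidef, Fintype.card_fin])
    (b := b) cur prev (fun w j => by rw [hcur]; exact Fin.cons_succ ..)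
  let C : PDFCode X X₁ B₁ B n b :=
    { numM := numM
      numL := numL
      sourceWord := x
      relayWord := a
      relayPOVM := Γ
      destMeas := fun j l' => sequentialMeas (Λ j l') (Δ j l') }
  refine ⟨C, rfl, rfl, C.errors_le 𝒩 Λ Δ (fun _ _ => rfl) ?_⟩
  -- The regularization η of the POVMs was taken equal to ε.
  have e : (b : ℝ) * (24 * ε) = b * (12 * (ε + ε)) := by ring
  rw [e]
  refine le_trans (le_of_eq ?_) h
  refine Finset.sum_congr rfl fun w _ => Finset.sum_congr rfl fun j _ => ?_
  rw [C.relayState_eq, C.destState_eq, C.destState_eq, ← C.cur_castSucc w j]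
  rfl

end Codes

/-! ### Choice of rates and exponents -/

section Achievability
open Filter Topology

/-- A joint distribution factors into a marginal and a conditional distribution. -/
theorem exists_kernel {A W : Type*} [Fintype W] [Nonempty W] {p : A → W → ℝ}
    (hp : ∀ a w, 0 ≤ p a w) :
    ∃ k : A → W → ℝ, (∀ a, k a ∈ stdSimplex ℝ W) ∧ ∀ a w, p a w = (∑ v, p a v) * k a w := by
  classical
  have : ∀ a, ∃ k ∈ stdSimplex ℝ W, ∀ w, p a w = (∑ v, p a v) * k w := by
    intro a
    have h0 : 0 ≤ ∑ v, p a v := Finset.sum_nonneg fun v _ => hp a v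
    rcases h0.eq_or_lt with h | h
    -- When the marginal vanishes the conditional law is arbitrary; a point mass serves.
    · obtain ⟨w₀⟩ := ‹Nonempty W›
      refine ⟨Pi.single w₀ 1, single_mem_stdSimplex ℝ w₀, fun w => ?_⟩
      rw [← h, zero_mul]
      exact (Finset.sum_eq_zero_iff_of_nonneg fun v _ => hp a v).mp h.symm w (Finset.mem_univ w)
    · refine ⟨fun w => p a w / ∑ v, p a v, ⟨fun w => div_nonneg (hp a w) h0, ?_⟩, fun w => ?_⟩
      · rw [← Finset.sum_div, div_self h.ne']
      · rw [mul_div_cancel₀ _ h.ne']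
  choose k hk hk' using this
  exact ⟨k, hk, hk'⟩

/-- The order x₁, then u, then x is that of the superposition. The conditional laws are genuine
distributions even at letters of probability 0, as the random codebook requires. -/
theorem exists_factorization {A U X : Type*} [Fintype A] [Fintype U] [Fintype X]
    {p : U × X × A → ℝ} (hp : p ∈ stdSimplex ℝ (U × X × A)) :
    ∃ (p₁ : A → ℝ) (p₂ : A → U → ℝ) (p₃ : A → U → X → ℝ), p₁ ∈ stdSimplex ℝ A ∧
      (∀ a, p₂ a ∈ stdSimplex ℝ U) ∧ (∀ a u, p₃ a u ∈ stdSimplex ℝ X) ∧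
      ∀ u x a, p (u, x, a) = p₁ a * p₂ a u * p₃ a u x := by
  have hne : Nonempty (U × X × A) := by
    by_contra h
    rw [not_nonempty_iff] at h
    have := hp.2
    simp at this
  obtain ⟨u₀, x₀, -⟩ := hne
  have : Nonempty U := ⟨u₀⟩
  have : Nonempty X := ⟨x₀⟩
  obtain ⟨k₃, hk₃, h3⟩ := exists_kernel (p := fun (l : A × U) x => p (l.2, x, l.1))
    fun _ _ => hp.1 _
  obtain ⟨k₂, hk₂, h2⟩ := exists_kernel (p := fun (a : A) u => ∑ x, p (u, x, a))
    fun a u => Finset.sum_nonneg fun _ _ => hp.1 _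
  refine ⟨fun a => ∑ u, ∑ x, p (u, x, a), k₂, fun a u => k₃ (a, u), ⟨fun a =>
    Finset.sum_nonneg fun _ _ => Finset.sum_nonneg fun _ _ => hp.1 _, ?_⟩, hk₂,
    fun a u => hk₃ _, fun u x a => ?_⟩
  · rw [← hp.2, Fintype.sum_prod_type, Finset.sum_comm]
    refine Finset.sum_congr rfl fun u _ => ?_
    rw [Fintype.sum_prod_type, Finset.sum_comm]
  · rw [← h2]
    exact h3 (a, u) x

/-- A number of messages of rate `R`. -/
def messageCount (R : ℝ) (n : ℕ) : ℕ+ :=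
  ⟨⌈(2 : ℝ) ^ (n * R)⌉₊, Nat.ceil_pos.mpr (by positivity)⟩

theorem le_messageCount (R : ℝ) (n : ℕ) : (2 : ℝ) ^ (n * R) ≤ messageCount R n := Nat.le_ceil _

/-- Only the wrong messages count, and subtracting 1 absorbs the rounding up: there are at most
2^{nR} of them. Hence a negative rate is allowed, and the rate splitting needs no case distinction.
-/
theorem eventually_messageCount_mul_le {R s q ε : ℝ} (hs : 0 < s) (hq : 0 ≤ q)
    (h : (2 : ℝ) ^ (R * s) * q < 1) (hε : 0 < ε) :
    ∀ᶠ n : ℕ in atTop, ((messageCount R n : ℝ) - 1) ^ s * q ^ n ≤ ε := by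
  have h0 : 0 ≤ (2 : ℝ) ^ (R * s) * q := by positivity
  filter_upwards [(tendsto_pow_atTop_nhds_zero_of_lt_one h0 h).eventually_le_const hε] with n hn
  refine le_trans ?_ hn
  rw [mul_pow]
  refine mul_le_mul_of_nonneg_right ?_ (by positivity)
  have h1 : (1 : ℝ) ≤ messageCount R n := by exact_mod_cast (messageCount R n).pos
  have h2 : (messageCount R n : ℝ) - 1 ≤ (2 : ℝ) ^ (n * R) := by
    have : (messageCount R n : ℝ) < (2 : ℝ) ^ (n * R) + 1 := Nat.ceil_lt_add_one (by positivity)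
    linarith
  calc ((messageCount R n : ℝ) - 1) ^ s ≤ ((2 : ℝ) ^ (n * R)) ^ s :=
        Real.rpow_le_rpow (sub_nonneg.mpr h1) h2 hs.le
    _ = ((2 : ℝ) ^ (R * s)) ^ n := by
        rw [← Real.rpow_mul (by norm_num), ← Real.rpow_natCast, ← Real.rpow_mul (by norm_num)]
        congr 1; ring

variable {X X₁ B₁ B : Type*} [Fintype X] [Fintype X₁] [Fintype B₁] [Fintype B]
  [DecidableEq X] [DecidableEq X₁] [DecidableEq B₁] [DecidableEq B]

/-- All rates below the value of a fixed input distribution are achieved. -/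
theorem eventually_exists_code (𝒩 : RelayChannel X X₁ B₁ B) {k : ℕ} {p : Fin k × X × X₁ → ℝ}
    (hp : p ∈ stdSimplex ℝ (Fin k × X × X₁)) {R : ℝ}
    (hR : R < min (infoXX₁B 𝒩 p) (infoUB₁X₁ 𝒩 p + infoXBX₁U 𝒩 p)) (b : ℕ) {ε : ℝ} (hε : 0 < ε) :
    ∀ᶠ n : ℕ in atTop, ∃ C : PDFCode X X₁ B₁ B n b,
      (2 : ℝ) ^ ((n : ℝ) * R) ≤ (C.numM : ℝ) * (C.numL : ℝ) ∧
      (∀ j : Fin b, C.relayError 𝒩 j + C.destError 𝒩 j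
        ≤ b * (24 * ε) + 4 * √(b * (24 * ε))) ∧
      C.totalError 𝒩 ≤ b * (24 * ε) + b * (4 * √(b * (24 * ε))) := by
  obtain ⟨p₁, p₂, p₃, h₁, h₂, h₃, hfac⟩ := exists_factorization hp
  have hI₁ := infoXX₁B_eq 𝒩 h₃ hfac
  have hI₂ := infoUB₁X₁_eq 𝒩 h₂ h₃ hfac
  have hI₃ := infoXBX₁U_eq 𝒩 h₃ hfac
  set J₂ := entropy (mix p₁ fun x₁ => mix (p₂ x₁) fun u => mix (p₃ x₁ u) (𝒩.destOut x₁))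
        - ∑ x₁, p₁ x₁ * entropy (mix (p₂ x₁) fun u => mix (p₃ x₁ u) (𝒩.destOut x₁)) with hJ₂
  set J₁ := ∑ x₁, p₁ x₁ * (entropy (mix (p₂ x₁) fun u => mix (p₃ x₁ u) (𝒩.destOut x₁))
        - ∑ u, p₂ x₁ u * entropy (mix (p₃ x₁ u) (𝒩.destOut x₁))) with hJ₁
  rw [lt_min_iff] at hR
  -- Half of the smaller gap, so that both bounds stay strict after g is spent.
  obtain ⟨g, hg0, hg1, hg2⟩ : ∃ g : ℝ, 0 < g ∧ R + g < infoXX₁B 𝒩 p ∧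
      R + g < infoUB₁X₁ 𝒩 p + infoXBX₁U 𝒩 p := by
    refine ⟨min (infoXX₁B 𝒩 p - R) (infoUB₁X₁ 𝒩 p + infoXBX₁U 𝒩 p - R) / 2, ?_, ?_, ?_⟩
    · exact half_pos (lt_min (by linarith [hR.1]) (by linarith [hR.2]))
    · linarith [min_le_left (infoXX₁B 𝒩 p - R) (infoUB₁X₁ 𝒩 p + infoXBX₁U 𝒩 p - R), hR.1]
    · linarith [min_le_right (infoXX₁B 𝒩 p - R) (infoUB₁X₁ 𝒩 p + infoXBX₁U 𝒩 p - R), hR.2]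
  -- With this split `hg2` becomes Rl < I(U;B₁|X₁), and `hg1` becomes Rl < J₁ + J₂ by the chain
  -- rule.
  set Rm := infoXBX₁U 𝒩 p - g with hRm
  set Rl := R - Rm with hRl
  have hAD : ∀ a u, (cloudState p₃ 𝒩.destOut a u).PosSemidef := fun a u =>
    mix_posSemidef (h₃ a u).1 (𝒩.destOut_posSemidef a)
  have hBD : ∀ a, (relayWordState p₂ p₃ 𝒩.destOut a).PosSemidef := fun a =>
    mix_posSemidef (h₂ a).1 (hAD a)
  have hAR : ∀ a u, (cloudState p₃ 𝒩.relayOut a u).PosSemidef := fun a u =>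
    mix_posSemidef (h₃ a u).1 (𝒩.relayOut_posSemidef a)
  -- the relay
  have k₁ : ∀ᶠ s in 𝓝[>] (0 : ℝ), (2 : ℝ) ^ (Rl * s) * cloudChernoff p₁ p₂ p₃ 𝒩.relayOut s < 1 :=
    eventually_exponent h₁ h₂ (A := cloudState p₃ 𝒩.relayOut)
      hAR
      (fun a u => mix_trace (h₃ a u) (𝒩.trace_relayOut a))
      (lt_of_lt_of_eq (by linarith) hI₂)
  -- the destination, first step
  have k₂ : ∀ᶠ s in 𝓝[>] (0 : ℝ), (2 : ℝ) ^ (Rl * s) *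
      (cloudChernoff p₁ p₂ p₃ 𝒩.destOut s * relayWordChernoff p₁ p₂ p₃ 𝒩.destOut s) < 1 := by
    -- Rl is divided between the two blocks as J₁ and J₂ minus half the slack each. Both exponents
    -- are then eventually good as s tends to 0, so a common s exists.
    have hd : 0 < J₁ + J₂ - Rl := by linarith
    have e₁ : ∀ᶠ s in 𝓝[>] (0 : ℝ), (2 : ℝ) ^ ((J₁ - (J₁ + J₂ - Rl) / 2) * s)
        * cloudChernoff p₁ p₂ p₃ 𝒩.destOut s < 1 :=
      eventually_exponent h₁ h₂ (A := cloudState p₃ 𝒩.destOut)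
        hAD
        (fun a u => mix_trace (h₃ a u) (𝒩.trace_destOut a))
        (lt_of_lt_of_eq (by linarith) hJ₁)
    -- There is nothing to condition on for the relay's word, hence the one-point alphabet.
    have e₂ := eventually_exponent (C := Unit) (W := X₁) (q := fun _ => 1) (k := fun _ => p₁)
      (by simp [stdSimplex]) (fun _ => h₁) (A := fun _ => relayWordState p₂ p₃ 𝒩.destOut)
      (fun _ => hBD)
      (fun _ a => mix_trace (h₂ a) fun u => mix_trace (h₃ a u) (𝒩.trace_destOut a))
      (R := J₂ - (J₁ + J₂ - Rl) / 2) (by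
        simp only [Finset.univ_unique, Finset.sum_const, Finset.card_singleton, one_smul, one_mul]
        exact lt_of_lt_of_eq (by linarith) hJ₂)
    filter_upwards [e₁, e₂] with s hs₁ hs₂
    simp only [Finset.univ_unique, Finset.sum_const, Finset.card_singleton, one_smul, one_mul]
      at hs₂
    change _ * relayWordChernoff p₁ p₂ p₃ 𝒩.destOut s < 1 at hs₂
    have hc : 0 ≤ relayWordChernoff p₁ p₂ p₃ 𝒩.destOut s :=
      expect_nonneg h₁.1 fun a => chernoff_nonneg (hBD a) (mix_posSemidef h₁.1 hBD) _
    rw [show Rl * s = (J₁ - (J₁ + J₂ - Rl) / 2) * s + (J₂ - (J₁ + J₂ - Rl) / 2) * s by ring,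
      Real.rpow_add (by norm_num), mul_mul_mul_comm]
    exact mul_lt_one_of_nonneg_of_lt_one_right hs₁.le (by positivity) hs₂
  -- the destination, second step
  have k₃ : ∀ᶠ s in 𝓝[>] (0 : ℝ), (2 : ℝ) ^ (Rm * s) * sourceChernoff p₁ p₂ p₃ 𝒩.destOut s < 1 := by
    have e := eventually_exponent (C := X₁ × Fin k) (W := X) (q := fun c => p₁ c.1 * p₂ c.1 c.2)
      (k := fun c => p₃ c.1 c.2) ⟨fun c => mul_nonneg (h₁.1 _) ((h₂ _).1 _), by
        simp only [Fintype.sum_prod_type, ← Finset.mul_sum, (h₂ _).2, mul_one, h₁.2]⟩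
      (fun c => h₃ c.1 c.2) (A := fun c => 𝒩.destOut c.1) (fun c => 𝒩.destOut_posSemidef c.1)
      (fun c => 𝒩.trace_destOut c.1) (R := Rm) (by
        have : Rm < infoXBX₁U 𝒩 p := by linarith
        rw [hI₃] at this
        simpa only [Fintype.sum_prod_type, Finset.mul_sum, mul_assoc] using this)
    filter_upwards [e] with s hs
    have : sourceChernoff p₁ p₂ p₃ 𝒩.destOut s = ∑ c : X₁ × Fin k, p₁ c.1 * p₂ c.1 c.2 *
        ∑ x, p₃ c.1 c.2 x * chernoff (𝒩.destOut c.1 x) (mix (p₃ c.1 c.2) (𝒩.destOut c.1)) s := by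
      simp only [sourceChernoff, expect, Fintype.sum_prod_type, Finset.mul_sum, mul_assoc]
    rwa [this]
  have h01 : ∀ᶠ s in 𝓝[>] (0 : ℝ), s ∈ Set.Ioo (0 : ℝ) 1 := Ioo_mem_nhdsGT (by norm_num)
  -- The three decoders have separate Chernoff parameters.
  obtain ⟨r, hr, hr01⟩ := (k₁.and h01).exists
  obtain ⟨s, hs, hs01⟩ := (k₂.and h01).exists
  obtain ⟨t, ht, ht01⟩ := (k₃.and h01).exists
  have q₁ : 0 ≤ cloudChernoff p₁ p₂ p₃ 𝒩.relayOut r :=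
    expect_nonneg h₁.1 fun a => expect_nonneg (h₂ a).1 fun u =>
      chernoff_nonneg (hAR a u) (mix_posSemidef (h₂ a).1 (hAR a)) _
  have q₂ : 0 ≤ cloudChernoff p₁ p₂ p₃ 𝒩.destOut s :=
    expect_nonneg h₁.1 fun a => expect_nonneg (h₂ a).1 fun u =>
      chernoff_nonneg (hAD a u) (hBD a) _
  have q₃ : 0 ≤ relayWordChernoff p₁ p₂ p₃ 𝒩.destOut s :=
    expect_nonneg h₁.1 fun a => chernoff_nonneg (hBD a) (mix_posSemidef h₁.1 hBD) _
  have q₄ : 0 ≤ sourceChernoff p₁ p₂ p₃ 𝒩.destOut t :=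
    expect_nonneg h₁.1 fun a => expect_nonneg (h₂ a).1 fun u => expect_nonneg (h₃ a u).1 fun x =>
      chernoff_nonneg (𝒩.destOut_posSemidef a x) (hAD a u) _
  filter_upwards [eventually_messageCount_mul_le hr01.1 q₁ hr hε,
    eventually_messageCount_mul_le hs01.1 (mul_nonneg q₂ q₃) hs hε,
    eventually_messageCount_mul_le ht01.1 q₄ ht hε] with n hn₁ hn₂ hn₃
  rw [mul_pow] at hn₂
  obtain ⟨C, hM, hL, h⟩ := exists_code 𝒩 h₁ h₂ h₃ hr01 hs01 ht01 hε (messageCount Rm n)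
    (messageCount Rl n) n b hn₁ hn₂ hn₃
  refine ⟨C, ?_, h⟩
  rw [hM, hL, show (n : ℝ) * R = n * Rm + n * Rl by rw [hRl]; ring, Real.rpow_add (by norm_num)]
  exact mul_le_mul (le_messageCount _ _) (le_messageCount _ _) (by positivity) (by positivity)

theorem exists_small (b : ℕ) {ε : ℝ} (hε : 0 < ε) : ∃ e : ℝ, 0 < e ∧
    b * (24 * e) + 4 * √(b * (24 * e)) ≤ ε ∧ b * (24 * e) + b * (4 * √(b * (24 * e))) ≤ ε := by
  have h1 : Tendsto (fun e : ℝ => b * (24 * e) + 4 * √(b * (24 * e))) (𝓝[>] 0) (𝓝 0) := by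
    have : Continuous fun e : ℝ => b * (24 * e) + 4 * √(b * (24 * e)) := by fun_prop
    simpa using (this.tendsto 0).mono_left nhdsWithin_le_nhds
  have h2 : Tendsto (fun e : ℝ => b * (24 * e) + b * (4 * √(b * (24 * e)))) (𝓝[>] 0) (𝓝 0) := by
    have : Continuous fun e : ℝ => b * (24 * e) + b * (4 * √(b * (24 * e))) := by fun_prop
    simpa using (this.tendsto 0).mono_left nhdsWithin_le_nhds
  obtain ⟨e, he, he1, he2⟩ := ((eventually_mem_nhdsWithin (s := Set.Ioi (0 : ℝ)) (a := 0)).and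
    ((h1.eventually_le_const hε).and (h2.eventually_le_const hε))).exists
  exact ⟨e, he, he1, he2⟩

end Achievability

end QuantumRelay

end

/-! ### The achievability theorem -/

theorem mainTheorem8 {X X₁ B₁ B : Type*} [Fintype X] [Fintype X₁] [Fintype B₁] [Fintype B]
    [DecidableEq X] [DecidableEq X₁] [DecidableEq B₁] [DecidableEq B]
    (𝒩 : QuantumRelay.RelayChannel X X₁ B₁ B) (R : ℝ)
    (hR : (R : EReal) ≤ QuantumRelay.pdfRate 𝒩) :
    QuantumRelay.IsAchievable 𝒩 R := by
  intro b ε hε δ hδ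
  -- The loss δ makes the inequality strict, so that one distribution suffices even if the supremum
  -- is not attained.
  have hlt : ((R - δ : ℝ) : EReal) < QuantumRelay.pdfRate 𝒩 :=
    lt_of_lt_of_le (EReal.coe_lt_coe_iff.mpr (by linarith)) hR
  rw [QuantumRelay.pdfRate, lt_iSup_iff] at hlt
  obtain ⟨k, hk⟩ := hlt
  rw [lt_iSup_iff] at hk
  obtain ⟨⟨p, hp⟩, hlt⟩ := hk
  rw [EReal.coe_lt_coe_iff] at hlt
  obtain ⟨e, he, he1, he2⟩ := QuantumRelay.exists_small b hε
  obtain ⟨N, hN⟩ := Filter.eventually_atTop.mp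
    (QuantumRelay.eventually_exists_code 𝒩 hp hlt b he)
  refine ⟨N, fun n hn => ?_⟩
  obtain ⟨C, hC1, hC2, hC3⟩ := hN n hn
  exact ⟨C, hC1, fun j => (hC2 j).trans he1, hC3.trans he2⟩
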